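/- **Conventions.** Cardinals are identified with initial ordinals. $[X]^n$ is the set of $n$-element subsets of $X$, $[\mu]^\lambda$ is the set of subsets of $\mu$ of cardinality $\lambda$, and $\mathrm{otp}(a)$ is the order type of a set $a$ of ordinals. For $i<\mathrm{otp}(a)$, $a(i)$ is the $i$-th element of $a$ in increasing order, and $a[I]=\{a(i) : i\in I\}$. Sets of ordinals $a,b$ are *aligned* if $\mathrm{otp}(a)=\mathrm{otp}(b)$ and $\mathrm{otp}(a\cap\gamma)=\mathrm{otp}(b\cap\gamma)$ for all $\gamma\in a\cap b$. Put $\mathbf r(a,b)=\{i<\mathrm{otp}(a) : a(i)\in b\}$ and $\mathrm{tp}_{\mathrm{int}}(a,b)=\{(i,j)\in\mathrm{otp}(a)\times\mathrm{otp}(b) : a(i)=b(j)\}$. For a set $H$ of ordinals and $1\le n<\omega$: * A family of sets $\langle u_b : b\in[H]^n\rangle$ is an *$n$-dimensional $\Delta$-system* if there are sets $R^{\mathbf m}_a$ ($\mathbf m\subseteq n$, $a\in[H]^{|\mathbf m|}$) such that $u_b\cap u_{b'}=R^{\mathbf m}_{b\cap b'}$ for all aligned $b,b'\in[H]^n$ with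 $\mathbf r(b,b')=\mathbf m$. * A family of sets of ordinals $\langle u_b : b\in[H]^n\rangle$ is a *uniform $n$-dimensional $\Delta$-system* if there are an ordinal $\rho$ and sets $\mathbf r_{\mathbf m}\subseteq\rho$ ($\mathbf m\subseteq n$) such that: $\mathrm{otp}(u_b)=\rho$ for all $b\in[H]^n$; whenever $a,b\in[H]^n$ are aligned with $\mathbf r(a,b)=\mathbf m$, the sets $u_a,u_b$ are aligned with $\mathbf r(u_a,u_b)=\mathbf r_{\mathbf m}$; and $\mathbf r_{\mathbf m_0\cap\mathbf m_1}=\mathbf r_{\mathbf m_0}\cap\mathbf r_{\mathbf m_1}$ for all $\mathbf m_0,\mathbf m_1\subseteq n$. For $m<n$ and $a\in[H]^n$, an ordinal $\alpha$ is *$m$-possible* for $a$ if $a(m-1)<\alpha$ (when $m>0$) and $\alpha<a(m+1)$ (when $m+1<n$); then $a_{m\mapsto\alpha}=(a\setminus\{a(m)\})\cup\{\alpha\}$. Sets $a,b\in[H]^n$ are *aligned above $m$* if $a[n\setminus m]$ and $b[n\setminus m]$ are aligned. For cardinals $\kappa<\chi$, $\chi$ is *${<}\kappa$-inaccessible* if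 $\nu^{<\kappa}<\chi$ for all cardinals $\nu<\chi$. For an infinite regular cardinal $\chi$ let $\sigma(\chi,1)=\chi$ and $\sigma(\chi,n+1)=(2^{<\sigma(\chi,n)})^+$ for $n\ge1$. An uncountable cardinal $\lambda$ is *weakly compact* if for every $c:[\lambda]^2\to2$ there is $H\in[\lambda]^\lambda$ such that $c$ is constant on $[H]^2$. **Statement.** Let $1\le n<\omega$, let $\kappa<\lambda$ be infinite regular cardinals, let $\lambda^*$ be the least ${<}\kappa$-inaccessible cardinal $\ge\lambda$, and let $\mu$ be an infinite cardinal. Consider the following assertions. 1. $\mu\ge\sigma(\lambda^*,n)$. 2. For every cardinal $\nu<\lambda$, every $g:[\mu]^n\to\nu$ and every family $\langle u_b : b\in[\mu]^n\rangle$ of sets of ordinals with $|u_b|<\kappa$ for all $b$, there are $H\in[\mu]^\lambda$ and $k<\nu$ such that (a) $g(b)=k$ for all $b\in[H]^n$; (b) $\langle u_b : b\in[H]^n\rangle$ is a uniform $n$-dimensional $\Delta$-system; (c) for all $a,b\in[H]^n$ and $m<n$, if $a,b$ are aligned above $m$ and $a(m)=b(m)$, then $\mathrm{tp}_{\mathrm{int}}(u_a,u_b)=\mathrm{tp}_{\mathrm{int}}(u_{a_{m\mapsto\alpha}},u_{b_{m\mapsto\alpha}})$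 for every $\alpha\in H$ that is $m$-possible for both $a$ and $b$. 3. For every family $\langle u_b : b\in[\mu]^n\rangle$ of sets with $|u_b|<\kappa$ for all $b$, there is $H\in[\mu]^\lambda$ such that $\langle u_b : b\in[H]^n\rangle$ is an $n$-dimensional $\Delta$-system. Then (1) implies (2), and (2) implies (3). If moreover $n=1$ or $\lambda$ is not weakly compact, then (1), (2) and (3) are equivalent. -/

import Mathlib

open Cardinal Ordinal Set

universe u

noncomputable section

namespace DeltaSystem

/-! ### Sets of ordinals as increasing sequences -/

/-- The order type of a set of ordinals. -/
def otp (a : Set Ordinal.{u}) : Ordinal.{u + 1} :=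
  @Ordinal.type a (fun x y => x < y) inferInstance

/-- `IsNth a i γ` says that `γ` is the `i`-th element of `a`, in symbols `a(i) = γ`: that is,
`γ ∈ a` and `otp (a ∩ γ) = i`, the ordinal `γ` being identified with the set of its predecessors. -/
def IsNth (a : Set Ordinal.{u}) (i : Ordinal.{u + 1}) (γ : Ordinal.{u}) : Prop :=
  γ ∈ a ∧ otp (a ∩ Iio γ) = i

/-- `a[I] = {a(i) | i ∈ I}`. -/
def sub (a : Set Ordinal.{u}) (I : Set Ordinal.{u + 1}) : Set Ordinal.{u} :=
  {γ | ∃ i ∈ I, IsNth a i γ}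

/-- Two sets of ordinals are aligned if they have the same order type and every common element
occupies the same relative position in both. -/
def Aligned (a b : Set Ordinal.{u}) : Prop :=
  otp a = otp b ∧ ∀ γ ∈ a ∩ b, otp (a ∩ Iio γ) = otp (b ∩ Iio γ)

/-- `𝐫(a, b) = {i < otp a | a(i) ∈ b}`. -/
def rset (a b : Set Ordinal.{u}) : Set Ordinal.{u + 1} :=
  {i | ∃ γ ∈ b, IsNth a i γ}

/-- `a` and `b` are aligned above `i` if `a[ρ \ i]` and `b[ρ \ i]` are aligned, where `ρ` is the
common order type of `a` and `b`. -/
def AlignedAbove (i : Ordinal.{u + 1}) (a b : Set Ordinal.{u}) : Prop :=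
  Aligned (sub a (Ici i)) (sub b (Ici i))

/-- The intersection type of `a` and `b`, the set of all pairs `(i, j)` with `a(i) = b(j)`. -/
def tpInt (a b : Set Ordinal.{u}) : Set (Ordinal.{u + 1} × Ordinal.{u + 1}) :=
  {p | ∃ γ, IsNth a p.1 γ ∧ IsNth b p.2 γ}

/-- `α` is `m`-possible for `a`: `a(m - 1) < α` if `m > 0`, and `α < a(m + 1)` if
`m + 1 < otp a`. -/
def Possible (m : ℕ) (a : Set Ordinal.{u}) (α : Ordinal.{u}) : Prop :=
  (∀ (i : ℕ) (γ : Ordinal.{u}), i + 1 = m → IsNth a i γ → γ < α) ∧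
    (∀ γ : Ordinal.{u}, IsNth a ((m + 1 : ℕ) : Ordinal.{u + 1}) γ → α < γ)

open Classical in
/-- `a_{m ↦ α} = (a \ {a(m)}) ∪ {α}`, for a finite set `a` of ordinals. -/
def replaceNth (a : Finset Ordinal.{u}) (m : ℕ) (α : Ordinal.{u}) : Finset Ordinal.{u} :=
  insert α (a.filter fun γ => ¬ IsNth (a : Set Ordinal.{u}) m γ)

/-! ### Families indexed by `[H]^n` -/

/-- `[H]^n` for a natural number `n`: the `n`-element subsets of `H`. -/
def nSubsets (H : Set Ordinal.{u}) (n : ℕ) : Set (Finset Ordinal.{u}) :=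
  {b | (b : Set Ordinal.{u}) ⊆ H ∧ b.card = n}

/-- `[μ]^lam` for cardinals `μ`, `lam`: the subsets of (the initial ordinal of) `μ` of
cardinality `lam`. -/
def subsetsOfCard (μ lam : Cardinal.{u}) : Set (Set Ordinal.{u}) :=
  {H | H ⊆ Iio μ.ord ∧ Cardinal.mk H = Cardinal.lift.{u + 1} lam}

/-- `⟨U b | b ∈ [H]^n⟩` is an `n`-dimensional `Δ`-system, with roots `R m a` for `m ⊆ n` and
`a ∈ [H]^{|m|}`. Only the values of `U` on `[H]^n` matter. -/
def IsDeltaSystem {X : Type*} (n : ℕ) (H : Set Ordinal.{u}) (U : Finset Ordinal.{u} → Set X) :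
    Prop :=
  ∃ R : Set Ordinal.{u + 1} → Finset Ordinal.{u} → Set X,
    ∀ m ⊆ Iio (n : Ordinal.{u + 1}), ∀ b ∈ nSubsets H n, ∀ b' ∈ nSubsets H n,
      Aligned (b : Set Ordinal.{u}) b' → rset (b : Set Ordinal.{u}) b' = m →
        U b ∩ U b' = R m (b ∩ b')

/-- `⟨U b | b ∈ [H]^n⟩` is a uniform `n`-dimensional `Δ`-system of sets of ordinals. -/
def IsUniformDeltaSystem (n : ℕ) (H : Set Ordinal.{u})
    (U : Finset Ordinal.{u} → Set Ordinal.{u}) : Prop :=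
  ∃ (ρ : Ordinal.{u + 1}) (r : Set Ordinal.{u + 1} → Set Ordinal.{u + 1}),
    (∀ m ⊆ Iio (n : Ordinal.{u + 1}), r m ⊆ Iio ρ) ∧
    (∀ b ∈ nSubsets H n, otp (U b) = ρ) ∧
    (∀ a ∈ nSubsets H n, ∀ b ∈ nSubsets H n, ∀ m ⊆ Iio (n : Ordinal.{u + 1}),
      Aligned (a : Set Ordinal.{u}) b → rset (a : Set Ordinal.{u}) b = m →
        Aligned (U a) (U b) ∧ rset (U a) (U b) = r m) ∧
    (∀ m₀ ⊆ Iio (n : Ordinal.{u + 1}), ∀ m₁ ⊆ Iio (n : Ordinal.{u + 1}),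
      r (m₀ ∩ m₁) = r m₀ ∩ r m₁)

/-- The intersection types of members of the family are preserved when the common `m`-th element
of two index sets that are aligned above `m` is moved to another admissible place in `H`. -/
def PreservesIntersectionTypes (n : ℕ) (H : Set Ordinal.{u})
    (U : Finset Ordinal.{u} → Set Ordinal.{u}) : Prop :=
  ∀ a ∈ nSubsets H n, ∀ b ∈ nSubsets H n, ∀ m < n,
    AlignedAbove (m : Ordinal.{u + 1}) (a : Set Ordinal.{u}) b →
    (∃ γ, IsNth (a : Set Ordinal.{u}) m γ ∧ IsNth (b : Set Ordinal.{u}) m γ) →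
    ∀ α ∈ H, Possible m (a : Set Ordinal.{u}) α → Possible m (b : Set Ordinal.{u}) α →
      tpInt (U a) (U b) = tpInt (U (replaceNth a m α)) (U (replaceNth b m α))

/-! ### Cardinals -/

/-- `χ` is `<κ`-inaccessible: `κ < χ`, and `ν^{<κ} < χ` for all cardinals `ν < χ`. -/
def IsLTInaccessible (κ χ : Cardinal.{u}) : Prop :=
  κ < χ ∧ ∀ ν < χ, ν ^< κ < χ

/-- `σ(χ, 1) = χ` and `σ(χ, n + 1) = (2^{<σ(χ, n)})⁺` for `n ≥ 1`.
The value at `n = 0` is irrelevant. -/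
def sigma (χ : Cardinal.{u}) : ℕ → Cardinal.{u}
  | 0 => χ
  | 1 => χ
  | n + 2 => Order.succ (2 ^< sigma χ (n + 1))

/-- The partition relation `μ → (lam)^n_ν`. -/
def Arrow (μ lam : Cardinal.{u}) (n : ℕ) (ν : Cardinal.{u}) : Prop :=
  ∀ c : Finset Ordinal.{u} → Ordinal.{u}, (∀ b ∈ nSubsets (Iio μ.ord) n, c b < ν.ord) →
    ∃ H ∈ subsetsOfCard μ lam, ∃ k, ∀ b ∈ nSubsets H n, c b = k

/-- An uncountable cardinal `lam` is weakly compact if `lam → (lam)^2_2`. -/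
def IsWeaklyCompact (lam : Cardinal.{u}) : Prop :=
  ℵ₀ < lam ∧ Arrow lam lam 2 2

/-! ### The two combinatorial statements -/

/-- For every `ν < lam`, every `g : [μ]^n → ν` and every family `⟨U b | b ∈ [μ]^n⟩` of sets of
ordinals of size `< κ`, there are `H ∈ [μ]^lam` and `k < ν` such that `g` takes the constant value
`k` on `[H]^n`, the family restricted to `[H]^n` is a uniform `n`-dimensional `Δ`-system, and
intersection types are preserved on `[H]^n`. -/
def UniformRefinement (n : ℕ) (κ lam μ : Cardinal.{u}) : Prop :=
  ∀ ν < lam, ∀ g : Finset Ordinal.{u} → Ordinal.{u},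
    (∀ b ∈ nSubsets (Iio μ.ord) n, g b < ν.ord) →
    ∀ U : Finset Ordinal.{u} → Set Ordinal.{u},
      (∀ b ∈ nSubsets (Iio μ.ord) n, Cardinal.mk (U b) < Cardinal.lift.{u + 1} κ) →
      ∃ H ∈ subsetsOfCard μ lam, ∃ k < ν.ord,
        (∀ b ∈ nSubsets H n, g b = k) ∧
        IsUniformDeltaSystem n H U ∧
        PreservesIntersectionTypes n H U

/-- Every family `⟨U b | b ∈ [μ]^n⟩` of arbitrary sets of size `< κ` contains an `n`-dimensional
`Δ`-system indexed by `[H]^n` for some `H ∈ [μ]^lam`. -/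
def DeltaRefinement (n : ℕ) (κ lam μ : Cardinal.{u}) : Prop :=
  ∀ (X : Type u) (U : Finset Ordinal.{u} → Set X),
    (∀ b ∈ nSubsets (Iio μ.ord) n, Cardinal.mk (U b) < κ) →
    ∃ H ∈ subsetsOfCard μ lam, IsDeltaSystem n H U

end DeltaSystem

end

-- For (1) ⇒ (2), the argument runs at `lamStar`, which is regular and closed under powers with
-- exponent below `κ`, and the dimension is raised by induction. In dimension one this is the
-- classical Δ-system lemma (`exists_root`) followed by pigeonhole. For the step from `n` to `n + 1`
-- (`refines_succ`), an index set of size `(2^{<σ})⁺` is reflected: a set `N` plays the role of an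
-- elementary submodel closed under subsets of size `< σ`, and `δ` is an index above `N`. A greedy
-- choice yields `σ` many indices `γ` in `N` for which `U (insert γ b)` looks like `U (insert δ b)`
-- relative to everything built below `γ` (`exists_reflecting`). The inductive hypothesis is applied
-- to the `n`-dimensional family `b ↦ U (insert δ b)`. After a last thinning, members with the same
-- top index meet as the members of that family do. Members with different tops, the smaller of
-- which is not in the other index set, meet in the positions where that family meets inside `N`.
-- `Good.succ` turns these two facts into uniformity in dimension `n + 1`.
--
-- For (2) ⇒ (3), `H` is thinned so that infinitely many points of the old set remain in every gap.
-- If two aligned pairs have the same common part in the same positions, a fresh index set meeting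
-- both in exactly that part can be inserted (`exists_fresh`), and uniformity carries the
-- intersection from one pair to the other.
--
-- (3) ⇒ (1) goes by contraposition. By `isLeast_cases`, either `lamStar = lam` or `lamStar =
-- (ν^{<κ})⁺` with `ν < lam`. In the second case the branches of the tree of `ν`-valued sequences of
-- length `< κ` have no large Δ-subsystem (`not_deltaRefinement_one`). In the first case dimension
-- one is a matter of size. In dimension two a bad pair colouring of `lam` is pulled back along the
-- levels of the binary tree of height `lam` and coded into the sets (`not_deltaRefinement_two`); a
-- finite colouring coded in a Δ-system has to be constant. Higher dimensions follow by stepping up: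
-- evaluating a family on `μ'` at the splitting points of subsets of `μ'` gives a family on `2^{μ'}`
-- with one more dimension (`deltaRefinement_of_succ`).

universe v

noncomputable section

namespace DeltaSystem

/-! ### Cardinal arithmetic and sets of ordinals -/

/-- `ν ^ c < lam` for all `ν < lam` and `c < κ`. -/
def PowClosed (κ lam : Cardinal.{v}) : Prop :=
  ∀ ν < lam, ∀ c < κ, ν ^ c < lam

/-- Makes `B` behave like the initial ordinal of `c`: if some initial segment of a `c`-sized set
still has size `c`, the segment below the least such point works. -/
theorem exists_subset_small_initial {α : Type v} [LinearOrder α] [WellFoundedLT α]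
    {c : Cardinal.{v}} {A : Set α} (h : c ≤ #A) :
    ∃ B ⊆ A, #B = c ∧ ∀ x ∈ B, #(B ∩ Iio x : Set α) < c := by
  obtain ⟨B₀, hB₀, hc⟩ := Cardinal.le_mk_iff_exists_subset.1 h
  by_cases hall : ∀ x ∈ B₀, #(B₀ ∩ Iio x : Set α) < c
  · exact ⟨B₀, hB₀, hc, hall⟩
  · push Not at hall
    have hne : {x | x ∈ B₀ ∧ c ≤ #(B₀ ∩ Iio x : Set α)}.Nonempty := hall
    obtain ⟨x, hx, hmin⟩ := WellFounded.has_min (wellFounded_lt (α := α)) _ hne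
    refine ⟨B₀ ∩ Iio x, fun y hy => hB₀ hy.1, ?_, fun y hy => ?_⟩
    · exact le_antisymm (hc ▸ mk_le_mk_of_subset inter_subset_left) hx.2
    · by_contra hlt
      push Not at hlt
      refine hmin y ⟨hy.1, hlt.trans (mk_le_mk_of_subset ?_)⟩ hy.2
      exact fun z hz => ⟨hz.1.1, hz.2⟩

/-- Well-founded recursion packaged as a set. The equivalence also gives maximality: a point above
all of `H` that satisfies `P H` would itself belong to `H`, which is how later arguments reach
contradictions. -/
theorem exists_greedy {α : Type v} [LinearOrder α] [WellFoundedLT α]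
    (P : Set α → α → Prop) : ∃ H : Set α, ∀ γ, γ ∈ H ↔ P (H ∩ Iio γ) γ := by
  let F : (γ : α) → ((y : α) → y < γ → Prop) → Prop :=
    fun γ ih => P {y | ∃ h : y < γ, ih y h} γ
  refine ⟨{γ | (wellFounded_lt (α := α)).fix F γ}, fun γ => ?_⟩
  rw [mem_ofPred_eq, WellFounded.fix_eq]
  simp only [F]
  have : {y | ∃ _ : y < γ, (wellFounded_lt (α := α)).fix F y} =
      {γ | (wellFounded_lt (α := α)).fix F γ} ∩ Iio γ := by
    ext y
    simp [and_comm]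
  simp only [F] at this
  rw [this]

/-- The part of `A` that is bounded by an element of the small set `X` is small. -/
theorem mk_lower_lt {α : Type v} [LinearOrder α] {c : Cardinal.{v}} (hc : c.IsRegular)
    {A X : Set α} (hX : #X < c) (hXA : X ⊆ A) (hA : ∀ x ∈ A, #(A ∩ Iio x : Set α) < c) :
    #{γ | γ ∈ A ∧ ∃ x ∈ X, γ ≤ x} < c := by
  have h : {γ | γ ∈ A ∧ ∃ x ∈ X, γ ≤ x} ⊆ X ∪ ⋃ x ∈ X, A ∩ Iio x := by
    rintro γ ⟨hγ, x, hx, hle⟩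
    rcases hle.eq_or_lt with rfl | hlt
    · exact Or.inl hx
    · exact Or.inr (mem_biUnion hx ⟨hγ, hlt⟩)
  refine (mk_le_mk_of_subset h).trans_lt ((mk_union_le _ _).trans_lt ?_)
  refine add_lt_of_lt hc.aleph0_le hX ?_
  exact (card_biUnion_lt_iff_forall_of_isRegular hc hX).2 fun x hx => hA x (hXA hx)

theorem exists_above {α : Type v} [LinearOrder α] {c : Cardinal.{v}} (hc : c.IsRegular)
    {A X : Set α} (hX : #X < c) (hXA : X ⊆ A) (hAc : c ≤ #A)
    (hA : ∀ x ∈ A, #(A ∩ Iio x : Set α) < c) : ∃ γ ∈ A, ∀ x ∈ X, x < γ := by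
  by_contra hcon
  push Not at hcon
  refine absurd (mk_lower_lt hc hX hXA hA) (not_lt.2 (hAc.trans (mk_le_mk_of_subset ?_)))
  exact fun γ hγ => ⟨hγ, hcon γ hγ⟩

/-- A greedy set of size `< c` would leave a point of `A` that is above it and not bad for it, since
the points below or bad are fewer than `c`; the greedy rule would have accepted that point. -/
theorem exists_thin {α : Type v} [LinearOrder α] [WellFoundedLT α] {c : Cardinal.{v}}
    (hc : c.IsRegular) {A : Set α} (hAc : #A = c) (hA : ∀ x ∈ A, #(A ∩ Iio x : Set α) < c)
    (Bad : Set α → α → Prop)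
    (hBad : ∀ X ⊆ A, #X < c → #{γ | γ ∈ A ∧ Bad X γ} < c) :
    ∃ H ⊆ A, #H = c ∧ ∀ γ ∈ H, ¬ Bad (H ∩ Iio γ) γ := by
  obtain ⟨H, hH⟩ := exists_greedy fun X γ => γ ∈ A ∧ ¬ Bad X γ
  have hHA : H ⊆ A := fun γ hγ => ((hH γ).1 hγ).1
  refine ⟨H, hHA, ?_, fun γ hγ => ((hH γ).1 hγ).2⟩
  by_contra hne
  have hlt : #H < c := lt_of_le_of_ne (hAc ▸ mk_le_mk_of_subset hHA) hne
  have h1 := mk_lower_lt hc hlt hHA hA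
  have h2 := hBad H hHA hlt
  refine absurd (add_lt_of_lt hc.aleph0_le h1 h2) (not_lt.2 ?_)
  refine hAc.ge.trans ((mk_le_mk_of_subset ?_).trans (mk_union_le _ _))
  intro γ hγ
  by_cases h : ∃ x ∈ H, γ ≤ x
  · exact Or.inl ⟨hγ, h⟩
  · push Not at h
    refine Or.inr ⟨hγ, ?_⟩
    by_contra hb
    have hI : H ∩ Iio γ = H := inter_eq_left.2 h
    have : γ ∈ H := (hH γ).2 ⟨hγ, hI.symm ▸ hb⟩
    exact lt_irrefl _ (h γ this)

theorem mk_Iio_toType_lt {c : Cardinal.{v}} (i : c.ord.ToType) : #(Iio i) < c := by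
  simpa using mk_Iio_lt i (by simp)

theorem exists_toType_bound {c d : Cardinal.{v}} (h : d < c) :
    ∃ i : c.ord.ToType, d = #(Iio i) := by
  have h1 : d.ord < type (α := c.ord.ToType) (· < ·) := by
    rw [Ordinal.type_toType]
    exact ord_lt_ord.2 h
  refine ⟨Ordinal.enum (α := c.ord.ToType) (· < ·) ⟨d.ord, h1⟩, ?_⟩
  have h2 := Ordinal.typein_enum (α := c.ord.ToType) (· < ·) h1
  have h3 := congrArg Ordinal.card h2
  rw [card_ord] at h3
  exact h3.symm

theorem exists_toType_above {κ : Cardinal.{v}} (hκ : κ.IsRegular) {X : Set κ.ord.ToType}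
    (hX : #X < κ) : ∃ i, ∀ x ∈ X, x < i := by
  obtain ⟨γ, -, hγ⟩ := exists_above (α := κ.ord.ToType) hκ (A := univ) hX
    (subset_univ _) (by simp) (fun x _ => by simpa using mk_Iio_toType_lt x)
  exact ⟨γ, hγ⟩

theorem mk_subsets_lt {α : Type v} {κ lam : Cardinal.{v}} (hκ : ℵ₀ ≤ κ) (hlam : lam.IsRegular)
    (hlt : κ < lam) (hpow : PowClosed κ lam) {N : Set α} (hN : #N < lam) :
    #{t : Set α | t ⊆ N ∧ #t < κ} < lam := by
  let f : κ.ord.ToType → Set (Set α) := fun i => {t | t ⊆ N ∧ #t ≤ #(Iio i)}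
  have h : {t : Set α | t ⊆ N ∧ #t < κ} ⊆ ⋃ i, f i := by
    rintro t ⟨htN, ht⟩
    obtain ⟨i, hi⟩ := exists_toType_bound ht
    exact mem_iUnion.2 ⟨i, htN, hi.le⟩
  refine (mk_le_mk_of_subset h).trans_lt ?_
  refine (card_iUnion_lt_iff_forall_of_isRegular hlam (by simpa using hlt)).2 fun i => ?_
  have hi : #(Iio i) < κ := mk_Iio_toType_lt i
  refine lt_of_le_of_lt (b := max (#N) ℵ₀ ^ #(Iio i)) ?_
    (hpow _ (max_lt hN (hκ.trans_lt hlt)) _ hi)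
  exact mk_bounded_subset_le N _

/-- A set of size `< lam` closed under a given operation on sets of size `< κ`. -/
theorem exists_closed {α : Type v} {κ lam : Cardinal.{v}} (hκ : κ.IsRegular)
    (hlam : lam.IsRegular) (hlt : κ < lam) (hpow : PowClosed κ lam) (B : Set α → Set α)
    (hB : ∀ y : Set α, #y < κ → #(B y) < lam) :
    ∃ N : Set α, #N < lam ∧ ∀ y ⊆ N, #y < κ → B y ⊆ N := by
  -- Stage `i` collects `B y` for all small `y` inside the union of the earlier stages. Since `κ` is
  -- regular, a small subset of the final union already lies in the union of the stages below some
  -- `i`, so `κ` stages suffice.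
  let F : (i : κ.ord.ToType) → ((j : κ.ord.ToType) → j < i → Set α) → Set α :=
    fun i ih => {x | ∃ y : Set α, (y ⊆ (⋃ j : Iio i, ih j.1 j.2) ∧ #(↥y) < κ) ∧ x ∈ B y}
  let wf := wellFounded_lt (α := κ.ord.ToType)
  let G : κ.ord.ToType → Set α := wf.fix F
  have hG : ∀ i, G i = ⋃ y ∈ ({y | y ⊆ (⋃ j : Iio i, G j.1) ∧ #y < κ} : Set (Set α)), B y := by
    intro i
    have : G i = F i fun j _ => G j := WellFounded.fix_eq _ _ _
    rw [this]
    ext x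
    simp [F, and_assoc]
  have hsub : ∀ i (y : Set α), y ⊆ (⋃ j : Iio i, G j.1) → #y < κ → B y ⊆ G i := by
    intro i y hy hyκ
    rw [hG i]
    exact fun x hx => mem_biUnion (t := B) (show y ∈ ({y | _ ∧ _} : Set (Set α)) from ⟨hy, hyκ⟩) hx
  have hcard : ∀ i, #(G i) < lam := by
    intro i
    induction i using wf.induction with
    | _ i ih =>
      rw [hG i]
      have h1 : #(⋃ j : Iio i, G j.1) < lam :=
        (card_iUnion_lt_iff_forall_of_isRegular hlam
          ((mk_Iio_toType_lt i).trans hlt)).2 fun j => ih j.1 j.2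
      exact (card_biUnion_lt_iff_forall_of_isRegular hlam
        (mk_subsets_lt hκ.aleph0_le hlam hlt hpow h1)).2 fun y hy => hB y hy.2
  refine ⟨⋃ i, G i, ?_, fun y hy hyκ => ?_⟩
  · exact (card_iUnion_lt_iff_forall_of_isRegular hlam (by simpa using hlt)).2 hcard
  · have hch : ∀ x : y, ∃ i, x.1 ∈ G i := fun x => mem_iUnion.1 (hy x.2)
    choose r hr using hch
    obtain ⟨i, hi⟩ := exists_toType_above hκ (X := range r) (mk_range_le.trans_lt hyκ)
    refine (hsub i y (fun x hx => ?_) hyκ).trans (subset_iUnion _ _)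
    exact mem_iUnion.2 ⟨⟨r ⟨x, hx⟩, hi _ ⟨_, rfl⟩⟩, hr ⟨x, hx⟩⟩

theorem le_powerlt_self {κ ν : Cardinal.{v}} (hν : 2 ≤ ν) : κ ≤ ν ^< κ := by
  by_contra! h
  have h1 := le_powerlt ν h
  exact absurd ((Cardinal.cantor' _ (by exact lt_of_lt_of_le one_lt_two hν)).trans_le h1)
    (lt_irrefl _)

/-- Let `T` be the set of sequences over `ν` of length `< κ`. By regularity the lengths occurring in
a map from `c` to `T` are bounded below `κ`, so there are at most `κ` many classes of maps, each of
size at most `ν ^ ((d + d) * c)` with `d < κ`. -/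
theorem powerlt_pow_le {κ ν c : Cardinal.{v}} (hκ : κ.IsRegular) (hν : 2 ≤ ν) (hc : c < κ) :
    (ν ^< κ) ^ c ≤ ν ^< κ := by
  set θ := ν ^< κ with hθ
  have hκθ : κ ≤ θ := le_powerlt_self hν
  let T := Σ i : κ.ord.ToType, (Iio i → ν.out)
  have hT : θ ≤ #T := by
    rw [hθ, powerlt_le]
    intro x hx
    obtain ⟨i, hi⟩ := exists_toType_bound hx
    have : ν ^ x = #(Iio i → ν.out) := by simp [hi]
    rw [this]
    exact mk_le_of_injective (f := fun g => (⟨i, g⟩ : T)) fun g h hgh => by simpa [T] using hgh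
  let S : κ.ord.ToType → Set (c.out → T) := fun i => {f | ∀ x, (f x).1 < i}
  have hS : ∀ i, #(S i) ≤ θ := by
    intro i
    let T' := Σ j : Iio i, (Iio j.1 → ν.out)
    have h1 : #(S i) ≤ #(c.out → T') := by
      refine mk_le_of_injective
        (f := fun (f : S i) x => (⟨⟨(f.1 x).1, f.2 x⟩, (f.1 x).2⟩ : T')) ?_
      intro f g hfg
      ext x : 2
      have := congrFun hfg x
      rw [Sigma.mk.injEq] at this
      exact Sigma.ext (congrArg Subtype.val this.1) this.2
    set d := #(Iio i) with hd
    have hdκ : d < κ := mk_Iio_toType_lt i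
    have h2 : #T' ≤ ν ^ d * ν ^ d := by
      rw [mk_sigma]
      calc (sum fun j : Iio i => #(Iio j.1 → ν.out)) ≤ sum fun _ : Iio i => ν ^ d := by
            refine sum_le_sum _ _ fun j => ?_
            rw [mk_pi, prod_const, mk_out, Cardinal.lift_id, Cardinal.lift_id]
            refine power_le_power_left (by positivity) ?_
            exact mk_le_mk_of_subset (Iio_subset_Iio j.2.le)
        _ = d * ν ^ d := by rw [sum_const, Cardinal.lift_id, Cardinal.lift_id]
        _ ≤ ν ^ d * ν ^ d := by
            gcongr
            exact (cantor d).le.trans (power_le_power_right hν)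
    calc #(S i) ≤ #(c.out → T') := h1
      _ = #T' ^ c := by simp
      _ ≤ (ν ^ d * ν ^ d) ^ c := power_le_power_right h2
      _ = ν ^ ((d + d) * c) := by rw [← power_add, power_mul]
      _ ≤ θ := le_powerlt _ (mul_lt_of_lt hκ.aleph0_le (add_lt_of_lt hκ.aleph0_le hdκ hdκ) hc)
  have hcov : (univ : Set (c.out → T)) ⊆ ⋃ i, S i := by
    intro f _
    obtain ⟨i, hi⟩ := exists_toType_above hκ (X := range fun x => (f x).1)
      (mk_range_le.trans_lt (by simpa using hc))
    exact mem_iUnion.2 ⟨i, fun x => hi _ ⟨x, rfl⟩⟩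
  calc θ ^ c ≤ #T ^ c := power_le_power_right hT
    _ = #(univ : Set (c.out → T)) := by simp
    _ ≤ #(⋃ i, S i) := mk_le_mk_of_subset hcov
    _ ≤ sum fun i => #(S i) := mk_iUnion_le_sum_mk
    _ ≤ sum fun _ : κ.ord.ToType => θ := sum_le_sum _ _ hS
    _ = κ * θ := by simp
    _ ≤ θ * θ := by gcongr
    _ = θ := mul_eq_self (hκ.aleph0_le.trans hκθ)

theorem powClosed_succ_powerlt {κ ν : Cardinal.{v}} (hκ : κ.IsRegular) (hν : 2 ≤ ν) :
    PowClosed κ (Order.succ (ν ^< κ)) := by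
  intro τ hτ c hc
  rw [Order.lt_succ_iff] at hτ ⊢
  exact (power_le_power_right hτ).trans (powerlt_pow_le hκ hν hc)

/-! ### Order types and positions -/

theorem otp_inter_Iio {a : Set Ordinal.{u}} {γ : Ordinal.{u}} (h : γ ∈ a) :
    otp (a ∩ Iio γ) = Ordinal.typein (α := a) (· < ·) ⟨γ, h⟩ := by
  rw [← Ordinal.type_subrel]
  unfold otp
  refine Ordinal.type_eq.2 ⟨⟨⟨fun x => ⟨⟨x.1, x.2.1⟩, x.2.2⟩, fun x => ⟨x.1.1, x.1.2, x.2⟩,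
    fun x => rfl, fun x => rfl⟩, Iff.rfl⟩⟩

theorem otp_Iio_lt {a : Set Ordinal.{u}} {γ : Ordinal.{u}} (h : γ ∈ a) :
    otp (a ∩ Iio γ) < otp a := by
  rw [otp_inter_Iio h]
  exact Ordinal.typein_lt_type _ _

theorem otp_Iio_lt_otp_Iio {a : Set Ordinal.{u}} {γ γ' : Ordinal.{u}} (h : γ ∈ a) (h' : γ' ∈ a)
    (hlt : γ < γ') : otp (a ∩ Iio γ) < otp (a ∩ Iio γ') := by
  rw [otp_inter_Iio h, otp_inter_Iio h', Ordinal.typein_lt_typein]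
  exact hlt

theorem IsNth.unique {a : Set Ordinal.{u}} {i : Ordinal.{u + 1}} {γ γ' : Ordinal.{u}}
    (h : IsNth a i γ) (h' : IsNth a i γ') : γ = γ' := by
  rcases lt_trichotomy γ γ' with hlt | rfl | hlt
  · exact absurd (otp_Iio_lt_otp_Iio h.1 h'.1 hlt) (by rw [h.2, h'.2]; exact lt_irrefl _)
  · rfl
  · exact absurd (otp_Iio_lt_otp_Iio h'.1 h.1 hlt) (by rw [h.2, h'.2]; exact lt_irrefl _)

theorem IsNth.pos_unique {a : Set Ordinal.{u}} {i j : Ordinal.{u + 1}} {γ : Ordinal.{u}}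
    (h : IsNth a i γ) (h' : IsNth a j γ) : i = j :=
  h.2.symm.trans h'.2

theorem IsNth.lt_otp {a : Set Ordinal.{u}} {i : Ordinal.{u + 1}} {γ : Ordinal.{u}}
    (h : IsNth a i γ) : i < otp a :=
  h.2 ▸ otp_Iio_lt h.1

theorem isNth_of_mem {a : Set Ordinal.{u}} {γ : Ordinal.{u}} (h : γ ∈ a) :
    IsNth a (otp (a ∩ Iio γ)) γ :=
  ⟨h, rfl⟩

theorem exists_isNth {a : Set Ordinal.{u}} {i : Ordinal.{u + 1}} (h : i < otp a) :
    ∃ γ, IsNth a i γ := by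
  obtain ⟨x, hx⟩ := Ordinal.typein_surj (α := a) (· < ·) h
  exact ⟨x.1, x.2, by rw [otp_inter_Iio x.2, ← hx]⟩

theorem card_otp (a : Set Ordinal.{u}) : (otp a).card = #a := rfl

theorem otp_lt_ord {a : Set Ordinal.{u}} {κ : Cardinal.{u + 1}} (h : #a < κ) : otp a < κ.ord := by
  rw [lt_ord, card_otp]
  exact h

theorem otp_eq_of_tpInt {a b : Set Ordinal.{u}} (h : tpInt a a = tpInt b b) : otp a = otp b := by
  have key : ∀ {a b : Set Ordinal.{u}}, tpInt a a = tpInt b b → otp a ≤ otp b := by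
    intro a b h
    by_contra! hlt
    obtain ⟨γ, hγ⟩ := exists_isNth hlt
    have : (otp b, otp b) ∈ tpInt b b := h ▸ ⟨γ, hγ, hγ⟩
    obtain ⟨δ, hδ, -⟩ := this
    exact lt_irrefl _ hδ.lt_otp
  exact le_antisymm (key h) (key h.symm)

theorem tpInt_self (a : Set Ordinal.{u}) : tpInt a a = {p | p.1 = p.2 ∧ p.1 < otp a} := by
  ext ⟨i, j⟩
  constructor
  · rintro ⟨γ, h, h'⟩
    exact ⟨h.pos_unique h', h.lt_otp⟩
  · rintro ⟨h, h'⟩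
    obtain ⟨γ, hγ⟩ := exists_isNth h'
    exact ⟨γ, hγ, (show i = j from h) ▸ hγ⟩

theorem tpInt_swap {a b : Set Ordinal.{u}} {i j : Ordinal.{u + 1}} :
    (i, j) ∈ tpInt a b ↔ (j, i) ∈ tpInt b a :=
  ⟨fun ⟨γ, h, h'⟩ => ⟨γ, h', h⟩, fun ⟨γ, h, h'⟩ => ⟨γ, h', h⟩⟩

/-! ### Finite index sets -/

/-- The position of `γ` in the finite set `b`. -/
def pos (b : Finset Ordinal.{u}) (γ : Ordinal.{u}) : ℕ := (b.filter (· < γ)).card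

theorem otp_finset (b : Finset Ordinal.{u}) : otp (b : Set Ordinal.{u}) = b.card := by
  unfold otp
  rw [Ordinal.type_fintype]
  simp

theorem otp_finset_Iio (b : Finset Ordinal.{u}) (γ : Ordinal.{u}) :
    otp ((b : Set Ordinal.{u}) ∩ Iio γ) = pos b γ := by
  have : (b : Set Ordinal.{u}) ∩ Iio γ = ((b.filter (· < γ) : Finset _) : Set Ordinal.{u}) := by
    ext; simp
  rw [this, otp_finset, pos]

theorem isNth_finset {b : Finset Ordinal.{u}} {i : ℕ} {γ : Ordinal.{u}} :
    IsNth (b : Set Ordinal.{u}) i γ ↔ γ ∈ b ∧ pos b γ = i := by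
  simp [IsNth, otp_finset_Iio]

theorem isNth_finset' {b : Finset Ordinal.{u}} {i : Ordinal.{u + 1}} {γ : Ordinal.{u}} :
    IsNth (b : Set Ordinal.{u}) i γ ↔ γ ∈ b ∧ (pos b γ : Ordinal.{u + 1}) = i := by
  simp [IsNth, otp_finset_Iio]

theorem pos_lt_card {b : Finset Ordinal.{u}} {γ : Ordinal.{u}} (h : γ ∈ b) : pos b γ < b.card :=
  Finset.card_lt_card (Finset.filter_ssubset.2 ⟨γ, h, lt_irrefl _⟩)

theorem pos_lt_pos {b : Finset Ordinal.{u}} {γ γ' : Ordinal.{u}} (h : γ ∈ b) (hlt : γ < γ') :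
    pos b γ < pos b γ' := by
  refine Finset.card_lt_card ⟨fun x hx => ?_, fun hsub => ?_⟩
  · simp only [Finset.mem_filter] at hx ⊢
    exact ⟨hx.1, hx.2.trans hlt⟩
  · have := hsub (Finset.mem_filter.2 ⟨h, hlt⟩)
    simp at this

theorem pos_mono (b : Finset Ordinal.{u}) {γ γ' : Ordinal.{u}} (hle : γ ≤ γ') :
    pos b γ ≤ pos b γ' := by
  refine Finset.card_le_card fun x hx => ?_
  simp only [Finset.mem_filter] at hx ⊢
  exact ⟨hx.1, hx.2.trans_le hle⟩

theorem pos_inj {b : Finset Ordinal.{u}} {γ γ' : Ordinal.{u}} (h : γ ∈ b) (h' : γ' ∈ b)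
    (heq : pos b γ = pos b γ') : γ = γ' := by
  rcases lt_trichotomy γ γ' with hlt | rfl | hlt
  · exact absurd heq (pos_lt_pos h hlt).ne
  · rfl
  · exact absurd heq (pos_lt_pos h' hlt).ne'

theorem exists_pos {b : Finset Ordinal.{u}} {i : ℕ} (h : i < b.card) : ∃ γ ∈ b, pos b γ = i := by
  have h' : (i : Ordinal.{u + 1}) < otp (b : Set Ordinal.{u}) := by
    rw [otp_finset]; exact_mod_cast h
  obtain ⟨γ, hγ⟩ := exists_isNth h'
  exact ⟨γ, isNth_finset.1 hγ⟩

/-- Alignment of finite sets in terms of positions. -/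
def FinAligned (a b : Finset Ordinal.{u}) : Prop :=
  a.card = b.card ∧ ∀ γ ∈ a, γ ∈ b → pos a γ = pos b γ

open Classical in
/-- The finite set of positions of the elements of `a ∩ b` in `a`. -/
def finRset (a b : Finset Ordinal.{u}) : Finset ℕ := (a.filter (· ∈ b)).image (pos a)

theorem mem_finRset {a b : Finset Ordinal.{u}} {i : ℕ} :
    i ∈ finRset a b ↔ ∃ γ ∈ a, γ ∈ b ∧ pos a γ = i := by
  simp [finRset, and_assoc]

theorem finRset_subset (a b : Finset Ordinal.{u}) : finRset a b ⊆ Finset.range a.card := by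
  intro i hi
  obtain ⟨γ, h, -, rfl⟩ := mem_finRset.1 hi
  exact Finset.mem_range.2 (pos_lt_card h)

theorem aligned_finset {a b : Finset Ordinal.{u}} :
    Aligned (a : Set Ordinal.{u}) b ↔ FinAligned a b := by
  simp [Aligned, FinAligned, otp_finset, otp_finset_Iio]

theorem FinAligned.symm {a b : Finset Ordinal.{u}} (h : FinAligned a b) : FinAligned b a :=
  ⟨h.1.symm, fun γ hb ha => (h.2 γ ha hb).symm⟩

theorem finAligned_refl (a : Finset Ordinal.{u}) : FinAligned a a := ⟨rfl, fun _ _ _ => rfl⟩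

theorem FinAligned.finRset_comm {a b : Finset Ordinal.{u}} (h : FinAligned a b) :
    finRset b a = finRset a b := by
  ext i
  simp only [mem_finRset]
  constructor
  · rintro ⟨γ, hb, ha, rfl⟩
    exact ⟨γ, ha, hb, h.2 γ ha hb⟩
  · rintro ⟨γ, ha, hb, rfl⟩
    exact ⟨γ, hb, ha, (h.2 γ ha hb).symm⟩

theorem finRset_self (a : Finset Ordinal.{u}) : finRset a a = Finset.range a.card := by
  refine Finset.Subset.antisymm (finRset_subset a a) fun i hi => ?_
  obtain ⟨γ, h, h'⟩ := exists_pos (Finset.mem_range.1 hi)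
  exact mem_finRset.2 ⟨γ, h, h, h'⟩

theorem rset_finset {a b : Finset Ordinal.{u}} {i : Ordinal.{u + 1}} :
    i ∈ rset (a : Set Ordinal.{u}) b ↔ ∃ k ∈ finRset a b, (k : Ordinal.{u + 1}) = i := by
  constructor
  · rintro ⟨γ, hb, ha⟩
    rw [isNth_finset'] at ha
    exact ⟨_, mem_finRset.2 ⟨γ, ha.1, hb, rfl⟩, ha.2⟩
  · rintro ⟨k, hk, rfl⟩
    obtain ⟨γ, ha, hb, rfl⟩ := mem_finRset.1 hk
    exact ⟨γ, hb, isNth_finset.2 ⟨ha, rfl⟩⟩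

/-! ### The inductive statement and its one-dimensional case -/

/-- Combinatorial form of uniformity together with preservation of intersection types. -/
structure Good (n : ℕ) (H : Set Ordinal.{u}) (U : Finset Ordinal.{u} → Set Ordinal.{u})
    (ρ : Ordinal.{u + 1}) (r : Finset ℕ → Set Ordinal.{u + 1}) : Prop where
  otp_eq : ∀ b ∈ nSubsets H n, otp (U b) = ρ
  tp : ∀ a ∈ nSubsets H n, ∀ b ∈ nSubsets H n, FinAligned a b →
    tpInt (U a) (U b) = {p | p.1 = p.2 ∧ p.1 ∈ r (finRset a b)}
  inter : ∀ m₀ ⊆ Finset.range n, ∀ m₁ ⊆ Finset.range n, r (m₀ ∩ m₁) = r m₀ ∩ r m₁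
  sub : ∀ m ⊆ Finset.range n, r m ⊆ Iio ρ
  move : ∀ a ∈ nSubsets H n, ∀ b ∈ nSubsets H n, ∀ γ ∈ a, γ ∈ b →
    (∀ x ∈ a, x ∈ b → γ ≤ x → pos a x = pos b x) → ∀ α ∈ H,
    (∀ x ∈ a, (x < γ → x < α) ∧ (γ < x → α < x)) →
    (∀ x ∈ b, (x < γ → x < α) ∧ (γ < x → α < x)) →
    tpInt (U a) (U b) = tpInt (U (insert α (a.erase γ))) (U (insert α (b.erase γ)))

theorem nSubsets_mono {H H' : Set Ordinal.{u}} (h : H' ⊆ H) (n : ℕ) :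
    nSubsets H' n ⊆ nSubsets H n :=
  fun _ hb => ⟨hb.1.trans h, hb.2⟩

theorem Good.mono {n : ℕ} {H H' : Set Ordinal.{u}} {U : Finset Ordinal.{u} → Set Ordinal.{u}}
    {ρ : Ordinal.{u + 1}} {r : Finset ℕ → Set Ordinal.{u + 1}} (h : Good n H U ρ r)
    (hH : H' ⊆ H) : Good n H' U ρ r where
  otp_eq b hb := h.otp_eq b (nSubsets_mono hH n hb)
  tp a ha b hb := h.tp a (nSubsets_mono hH n ha) b (nSubsets_mono hH n hb)
  inter := h.inter
  sub := h.sub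
  move a ha b hb γ hγ hγ' hal α hα :=
    h.move a (nSubsets_mono hH n ha) b (nSubsets_mono hH n hb) γ hγ hγ' hal α (hH hα)

/-- Every family of sets of size `< κ` indexed by the `n`-subsets of a set of size at least `σ`
can be refined, together with a colouring, to an index set of size `lam`. -/
def Refines (n : ℕ) (κ lam σ : Cardinal.{u + 1}) : Prop :=
  ∀ A : Set Ordinal.{u}, σ ≤ #A → ∀ (Q : Type (u + 1)) (g : Finset Ordinal.{u} → Q)
    (U : Finset Ordinal.{u} → Set Ordinal.{u}), #(g '' nSubsets A n) < lam →
    (∀ b ∈ nSubsets A n, #(U b) < κ) →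
    ∃ H ⊆ A, #H = lam ∧ (∃ k, ∀ b ∈ nSubsets H n, g b = k) ∧ ∃ ρ r, Good n H U ρ r

/-- For each candidate root `y`, let `G y` be a greedy family of indices whose sets contain `y` and
meet pairwise inside `y`. If all `G y` with small `y` were small, some `N` of size `< lam` would
contain the sets indexed by `G y` for every small `y ⊆ N`. An index `γ` above all these families
then satisfies the rule for the root `f γ ∩ N`, so it lies in a family it is supposed to bound. -/
theorem exists_root {α Y : Type v} [LinearOrder α] [WellFoundedLT α] {κ lam : Cardinal.{v}}
    (hκ : κ.IsRegular) (hlam : lam.IsRegular) (hlt : κ < lam) (hpow : PowClosed κ lam)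
    {A : Set α} (hA : lam ≤ #A) (f : α → Set Y) (hf : ∀ γ ∈ A, #(f γ) < κ) :
    ∃ H ⊆ A, #H = lam ∧ ∃ y : Set Y, #y < κ ∧
      ∀ a ∈ H, y ⊆ f a ∧ ∀ b ∈ H, a ≠ b → f a ∩ f b ⊆ y := by
  obtain ⟨A', hA', hAc, hinit⟩ := exists_subset_small_initial hA
  choose G hG using fun y : Set Y => exists_greedy (α := α)
    fun X γ => γ ∈ A' ∧ y ⊆ f γ ∧ ∀ η ∈ X, f η ∩ f γ ⊆ y
  have hGA : ∀ y, G y ⊆ A' := fun y γ hγ => ((hG y γ).1 hγ).1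
  by_cases hbig : ∃ y : Set Y, #y < κ ∧ lam ≤ #(G y)
  · obtain ⟨y, hy, hle⟩ := hbig
    obtain ⟨H, hH, hc⟩ := Cardinal.le_mk_iff_exists_subset.1 hle
    refine ⟨H, hH.trans ((hGA y).trans hA'), hc, y, hy, fun a ha => ?_⟩
    have h1 := (hG y a).1 (hH ha)
    refine ⟨h1.2.1, fun b hb hab => ?_⟩
    rcases lt_or_gt_of_ne hab with hlt | hlt
    · exact ((hG y b).1 (hH hb)).2.2 a ⟨hH ha, hlt⟩
    · rw [inter_comm]
      exact h1.2.2 b ⟨hH hb, hlt⟩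
  · exfalso
    push Not at hbig
    obtain ⟨N, hN, hcl⟩ := exists_closed hκ hlam hlt hpow (fun y => ⋃ η ∈ G y, f η)
      fun y hy => (card_biUnion_lt_iff_forall_of_isRegular hlam (hbig y hy)).2
        fun η hη => (hf η (hA' (hGA y hη))).trans hlt
    have hX : #(⋃ y ∈ ({y | y ⊆ N ∧ #(↥y) < κ} : Set (Set Y)), G y : Set α) < lam :=
      (card_biUnion_lt_iff_forall_of_isRegular hlam
        (mk_subsets_lt hκ.aleph0_le hlam hlt hpow hN)).2 fun y hy => hbig y hy.2
    obtain ⟨γ, hγ, habove⟩ := exists_above hlam hX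
      (iUnion₂_subset fun y _ => hGA y) hAc.ge hinit
    have hy : f γ ∩ N ⊆ N ∧ #(f γ ∩ N : Set Y) < κ :=
      ⟨inter_subset_right, (mk_le_mk_of_subset inter_subset_left).trans_lt (hf γ (hA' hγ))⟩
    have hmem : γ ∈ G (f γ ∩ N) := by
      refine (hG _ γ).2 ⟨hγ, inter_subset_left, fun η hη z hz => ⟨hz.2, ?_⟩⟩
      exact hcl _ hy.1 hy.2 (mem_biUnion hη.1 hz.1)
    exact lt_irrefl _ (habove γ (mem_biUnion (t := G)
      (show f γ ∩ N ∈ ({y | _ ∧ _} : Set (Set Y)) from hy) hmem))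

theorem exists_const {α Q : Type v} {lam : Cardinal.{v}} (hlam : lam.IsRegular) {H : Set α}
    (hH : #H = lam) (f : α → Q) (hf : #(f '' H) < lam) :
    ∃ H' ⊆ H, #H' = lam ∧ ∃ k, ∀ x ∈ H', f x = k := by
  by_contra hcon
  push Not at hcon
  have h1 : ∀ k ∈ f '' H, #{x | x ∈ H ∧ f x = k} < lam := by
    intro k _
    refine lt_of_le_of_ne (hH ▸ mk_le_mk_of_subset fun x hx => hx.1) fun heq => ?_
    obtain ⟨x, hx, hne⟩ := hcon _ (fun x hx => hx.1) heq k
    exact hne hx.2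
  have h2 := (card_biUnion_lt_iff_forall_of_isRegular hlam hf).2 h1
  refine absurd h2 (not_lt.2 (hH.ge.trans (mk_le_mk_of_subset fun x hx => ?_)))
  exact mem_biUnion (mem_image_of_mem f hx) ⟨hx, rfl⟩

/-- The ordinal coded by an element of `κ.ord.ToType`. -/
def ordOf {κ : Cardinal.{v}} (t : κ.ord.ToType) : Ordinal.{v} :=
  Ordinal.typein (α := κ.ord.ToType) (· < ·) t

theorem exists_ordOf {κ : Cardinal.{v}} {i : Ordinal.{v}} (h : i < κ.ord) :
    ∃ t : κ.ord.ToType, ordOf t = i :=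
  Ordinal.typein_surj (α := κ.ord.ToType) (· < ·) (by rwa [Ordinal.type_toType])

theorem ordOf_injective {κ : Cardinal.{v}} : Function.Injective (ordOf (κ := κ)) :=
  Ordinal.typein_injective _

theorem mk_ordOf_lt {κ : Cardinal.{v}} {i : Ordinal.{v}} (h : i < κ.ord) :
    #{t : κ.ord.ToType | ordOf t < i} < κ := by
  obtain ⟨t, rfl⟩ := exists_ordOf h
  refine (mk_le_mk_of_subset ?_).trans_lt (mk_Iio_toType_lt t)
  intro s hs
  exact (Ordinal.typein_lt_typein (α := κ.ord.ToType) (· < ·)).1 hs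

theorem otp_eq_of_codes {κ : Cardinal.{u + 1}} {a b : Set Ordinal.{u}} (ha : #a < κ) (hb : #b < κ)
    (h : {t : κ.ord.ToType | ordOf t < otp a} = {t : κ.ord.ToType | ordOf t < otp b}) :
    otp a = otp b := by
  have key : ∀ {a b : Set Ordinal.{u}}, #b < κ →
      {t : κ.ord.ToType | ordOf t < otp a} = {t : κ.ord.ToType | ordOf t < otp b} →
      otp a ≤ otp b := by
    intro a b hb h
    by_contra! hlt
    obtain ⟨t, ht⟩ := exists_ordOf (otp_lt_ord hb)
    have : t ∈ {t : κ.ord.ToType | ordOf t < otp b} := h ▸ (show ordOf t < otp a from ht ▸ hlt)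
    exact absurd this (by rw [mem_ofPred_eq, ht]; exact lt_irrefl _)
  exact le_antisymm (key hb h) (key ha h.symm)

/-- The counting behind every pigeonhole over `lam`: an invariant coded by a set of size `< κ`
inside a set of size `< lam` takes fewer than `lam` values. -/
theorem mk_image_code_lt {κ lam : Cardinal.{v}} (hκ : ℵ₀ ≤ κ) (hlam : lam.IsRegular)
    (hlt : κ < lam) (hpow : PowClosed κ lam) {α Y : Type v} {A : Set α} {N : Set Y}
    (hN : #N < lam) (f : α → Set Y) (hf : ∀ a ∈ A, f a ⊆ N ∧ #(f a) < κ) : #(f '' A) < lam := by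
  refine (mk_le_mk_of_subset ?_).trans_lt (mk_subsets_lt hκ hlam hlt hpow hN)
  rintro _ ⟨a, ha, rfl⟩
  exact hf a ha

theorem mk_nth_codes_lt {κ : Cardinal.{u + 1}} {a : Set Ordinal.{u}} (ha : #a < κ)
    (y : Set Ordinal.{u}) :
    #{p : Ordinal.{u} × κ.ord.ToType | p.1 ∈ y ∧ IsNth a (ordOf p.2) p.1} < κ := by
  refine lt_of_le_of_lt ?_ ha
  refine mk_le_of_injective (f := fun p => (⟨p.1.1, p.2.2.1⟩ : a)) ?_
  rintro ⟨⟨z, s⟩, h⟩ ⟨⟨z', t⟩, h'⟩ heq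
  have hz : z = z' := congrArg Subtype.val heq
  subst hz
  have : s = t := ordOf_injective (h.2.pos_unique h'.2)
  subst this
  rfl

/-- With the root `y` fixed, pigeonhole makes the positions of the points of `y` and the order types
constant. Only two patterns occur: equal singletons, where every position is shared, and distinct
ones, where exactly the positions of `y` are. -/
theorem refines_one {κ lam : Cardinal.{u + 1}} (hκ : κ.IsRegular) (hlam : lam.IsRegular)
    (hlt : κ < lam) (hpow : PowClosed κ lam) : Refines 1 κ lam lam := by
  intro A hA Q g U hg hU
  have hsing : ∀ {B : Set Ordinal.{u}} {x}, x ∈ B → ({x} : Finset Ordinal.{u}) ∈ nSubsets B 1 :=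
    fun hx => ⟨by simpa using hx, by simp⟩
  have hU' : ∀ γ ∈ A, #(U {γ}) < κ := fun γ hγ => hU _ (hsing hγ)
  obtain ⟨H₀, hH₀, hc₀, y, hy, hroot⟩ := exists_root hκ hlam hlt hpow hA (fun γ => U {γ}) hU'
  obtain ⟨H₁, hH₁, hc₁, k, hk⟩ := exists_const hlam hc₀ (fun γ => g {γ}) (by
    refine (mk_le_mk_of_subset ?_).trans_lt hg
    rintro _ ⟨x, hx, rfl⟩
    exact ⟨_, hsing (hH₀ hx), rfl⟩)
  obtain ⟨H₂, hH₂, hc₂, P, hP⟩ := exists_const hlam hc₁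
    (fun γ => {p : Ordinal.{u} × κ.ord.ToType | p.1 ∈ y ∧ IsNth (U {γ}) (ordOf p.2) p.1}) (by
    refine mk_image_code_lt hκ.aleph0_le hlam hlt hpow (N := y ×ˢ Set.univ) ?_ _ fun a ha => ⟨?_, ?_⟩
    · rw [mk_setProd]
      exact mul_lt_of_lt hlam.aleph0_le (by simpa using hy.trans hlt) (by simpa using hlt)
    · exact fun p hp => ⟨hp.1, mem_univ _⟩
    · exact mk_nth_codes_lt (hU' a (hH₀ (hH₁ ha))) y)
  obtain ⟨H, hH, hc, O, hO⟩ := exists_const hlam hc₂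
    (fun γ => {t : κ.ord.ToType | ordOf t < otp (U {γ})}) (by
    refine mk_image_code_lt hκ.aleph0_le hlam hlt hpow (N := Set.univ) (by simpa using hlt) _
      fun a ha => ⟨subset_univ _, mk_ordOf_lt (otp_lt_ord (hU' a (hH₀ (hH₁ (hH₂ ha)))))⟩)
  have hHA : H ⊆ A := hH.trans (hH₂.trans (hH₁.trans hH₀))
  obtain ⟨x₀, hx₀⟩ : H.Nonempty := by
    rw [← Set.nonempty_coe_sort, ← mk_ne_zero_iff, hc]
    exact hlam.ne_zero
  have hotp : ∀ x ∈ H, otp (U {x}) = otp (U {x₀}) := fun x hx =>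
    otp_eq_of_codes (hU' x (hHA hx)) (hU' _ (hHA hx₀)) ((hO x hx).trans (hO x₀ hx₀).symm)
  have hnth : ∀ x ∈ H, ∀ x' ∈ H, ∀ z ∈ y, ∀ i, IsNth (U {x}) i z → IsNth (U {x'}) i z := by
    intro x hx x' hx' z hz i hi
    obtain ⟨t, rfl⟩ := exists_ordOf (hi.lt_otp.trans (otp_lt_ord (hU' x (hHA hx))))
    have h : (z, t) ∈ P := hP x (hH hx) ▸ ⟨hz, hi⟩
    rw [← hP x' (hH hx')] at h
    exact h.2
  have hone : ∀ b ∈ nSubsets H 1, ∃ x ∈ H, b = {x} := by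
    rintro b ⟨hb, hb1⟩
    obtain ⟨x, rfl⟩ := Finset.card_eq_one.1 hb1
    exact ⟨x, by simpa using hb, rfl⟩
  refine ⟨H, hHA, hc, ⟨k, fun b hb => ?_⟩, otp (U {x₀}),
    fun m => if 0 ∈ m then Iio (otp (U {x₀})) else {i | ∃ z ∈ y, IsNth (U {x₀}) i z}, ?_⟩
  · obtain ⟨x, hx, rfl⟩ := hone b hb
    exact hk x (hH₂ (hH hx))
  have hsub : {i | ∃ z ∈ y, IsNth (U {x₀}) i z} ⊆ Iio (otp (U {x₀})) := by
    rintro i ⟨z, -, hz⟩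
    exact hz.lt_otp
  refine ⟨fun b hb => ?_, fun a ha b hb hab => ?_, fun m₀ _ m₁ _ => ?_, fun m _ => ?_, ?_⟩
  · obtain ⟨x, hx, rfl⟩ := hone b hb
    exact hotp x hx
  · obtain ⟨x, hx, rfl⟩ := hone a ha
    obtain ⟨x', hx', rfl⟩ := hone b hb
    by_cases hxx : x = x'
    · subst hxx
      have h0 : 0 ∈ finRset {x} {x} := by simp [finRset_self]
      rw [tpInt_self, hotp x hx]
      simp [h0]
    · have h0 : 0 ∉ finRset {x} {x'} := by simp [mem_finRset, hxx]
      simp only [h0, if_false]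
      ext ⟨i, j⟩
      constructor
      · rintro ⟨z, hz, hz'⟩
        have hzy : z ∈ y := (hroot x (hH₁ (hH₂ (hH hx)))).2 x' (hH₁ (hH₂ (hH hx'))) hxx
          ⟨hz.1, hz'.1⟩
        exact ⟨hz.pos_unique (hnth x' hx' x hx z hzy j hz'), z, hzy, hnth x hx _ hx₀ z hzy i hz⟩
      · rintro ⟨hij, z, hzy, hz⟩
        have hij : i = j := hij
        subst hij
        exact ⟨z, hnth _ hx₀ x hx z hzy i hz, hnth _ hx₀ x' hx' z hzy i hz⟩
  · by_cases h0 : 0 ∈ m₀ <;> by_cases h1 : 0 ∈ m₁ <;> simp [h0, h1]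
    · exact hsub
    · exact hsub
  · split_ifs
    · exact le_rfl
    · exact hsub
  · intro a ha b hb γ hγ hγ' _ α hα _ _
    obtain ⟨x, hx, rfl⟩ := hone a ha
    obtain ⟨x', hx', rfl⟩ := hone b hb
    obtain rfl := Finset.mem_singleton.1 hγ
    obtain rfl := Finset.mem_singleton.1 hγ'
    simp [tpInt_self, hotp γ hx, hotp α hα]

/-! ### Reflection -/

theorem mk_image_prod_lt {α Q₁ Q₂ : Type v} {c : Cardinal.{v}} (hc : ℵ₀ ≤ c) {A : Set α}
    {f : α → Q₁} {g : α → Q₂} (hf : #(f '' A) < c) (hg : #(g '' A) < c) :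
    #((fun a => (f a, g a)) '' A) < c := by
  refine lt_of_le_of_lt (b := #(↥((f '' A) ×ˢ (g '' A)))) (mk_le_mk_of_subset ?_) ?_
  · rintro _ ⟨a, ha, rfl⟩
    exact ⟨mem_image_of_mem f ha, mem_image_of_mem g ha⟩
  · rw [mk_setProd]
    exact mul_lt_of_lt hc (by simpa using hf) (by simpa using hg)

theorem mk_image_powerset_lt {α Y : Type v} {σ : Cardinal.{v}} {A : Set α} {N : Set Y}
    (hN : #N < σ) (f : α → Set Y) (hf : ∀ a ∈ A, f a ⊆ N) :
    #(f '' A) < Order.succ (2 ^< σ) := by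
  rw [Order.lt_succ_iff]
  refine le_trans (mk_le_mk_of_subset (t := 𝒫 N) ?_) ?_
  · rintro _ ⟨a, ha, rfl⟩
    exact hf a ha
  · rw [mk_powerset]
    exact le_powerlt _ hN

theorem mk_finsets_lt {α : Type v} {σ : Cardinal.{v}} (hσ : ℵ₀ < σ) {X : Set α} (hX : #X < σ) :
    #{b : Finset α | (b : Set α) ⊆ X} < σ := by
  classical
  refine lt_of_le_of_lt (b := #(Finset X)) ?_ ?_
  · refine mk_le_of_injective
      (f := fun b : {b : Finset α | (b : Set α) ⊆ X} => b.1.subtype (· ∈ X)) ?_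
    intro b b' h
    ext x
    by_cases hx : x ∈ X
    · have := congrArg (fun s => (⟨x, hx⟩ : X) ∈ s) h
      simpa using this
    · exact ⟨fun h' => absurd (b.2 h') hx, fun h' => absurd (b'.2 h') hx⟩
  · rcases finite_or_infinite X with h | h
    · exact (lt_aleph0_of_finite _).trans hσ
    · rwa [mk_finset_of_infinite]

/-- Replaces an elementary submodel. `N` is closed under choosing, for each `S` of size `< σ`, one
representative of every code realized over `S`; there are at most `2^{<σ}` codes, so `N` stays small
enough for some `δ` to lie above `N ∩ A'`. Pairing the code with the part of `S` below the point
forces the representative of `δ` above that part. -/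
theorem exists_reflecting_point {α K : Type v} [LinearOrder α] [WellFoundedLT α]
    {σ : Cardinal.{v}} (hσ : σ.IsRegular) {A : Set α} (hA : Order.succ (2 ^< σ) ≤ #A)
    (code : Set α → α → K) (hcode : ∀ S : Set α, #S < σ → #(code S '' A) < Order.succ (2 ^< σ))
    (B : Set α → Set α) (hB : ∀ y : Set α, #y < σ → #(B y) < Order.succ (2 ^< σ)) :
    ∃ N : Set α, ∃ A' ⊆ A, ∃ δ ∈ A', (∀ y ⊆ N, #y < σ → B y ⊆ N) ∧ (∀ x ∈ N ∩ A', x < δ) ∧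
      ∀ S ⊆ N, #S < σ → ∃ γ ∈ N ∩ A', code S γ = code S δ ∧ ∀ z ∈ S, z < δ → z < γ := by
  classical
  have hle : σ ≤ 2 ^< σ := le_powerlt_self le_rfl
  have hreg : (Order.succ (2 ^< σ)).IsRegular := isRegular_succ (hσ.aleph0_le.trans hle)
  obtain ⟨A', hA', hAc, hinit⟩ := exists_subset_small_initial hA
  let code' : Set α → α → K × Set α := fun S β => (code S β, {z | z ∈ S ∧ z < β})
  have hcode' : ∀ S : Set α, #S < σ → #(code' S '' A') < Order.succ (2 ^< σ) := fun S hS =>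
    mk_image_prod_lt hreg.aleph0_le ((mk_le_mk_of_subset (image_mono hA')).trans_lt (hcode S hS))
      (mk_image_powerset_lt hS _ fun a _ z hz => hz.1)
  let rep : Set α → Set α := fun S =>
    range fun q : code' S '' A' => q.2.choose
  obtain ⟨N, hN, hcl⟩ := exists_closed hσ hreg (Order.lt_succ_of_le hle)
    (powClosed_succ_powerlt hσ le_rfl) (fun y => B y ∪ rep y) fun y hy =>
      (mk_union_le _ _).trans_lt (add_lt_of_lt hreg.aleph0_le (hB y hy)
        (mk_range_le.trans_lt (hcode' y hy)))
  obtain ⟨δ, hδ, habove⟩ := exists_above hreg (X := N ∩ A')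
    ((mk_le_mk_of_subset inter_subset_left).trans_lt hN) inter_subset_right hAc.ge hinit
  refine ⟨N, A', hA', δ, hδ, fun y hy hyσ => subset_union_left.trans (hcl y hy hyσ), habove,
    fun S hS hSσ => ?_⟩
  have hmem : code' S δ ∈ code' S '' A' := mem_image_of_mem _ hδ
  obtain ⟨h1, h2⟩ := hmem.choose_spec
  refine ⟨hmem.choose, ⟨hcl S hS hSσ (Or.inr ⟨⟨_, hmem⟩, rfl⟩), h1⟩, congrArg Prod.fst h2, ?_⟩
  intro z hz hzδ
  have h3 : z ∈ {z | z ∈ S ∧ z < δ} := ⟨hz, hzδ⟩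
  have h4 := congrArg Prod.snd h2
  dsimp only [code'] at h4
  rw [← h4] at h3
  exact h3.2

theorem insert_mem_nSubsets {A X : Set Ordinal.{u}} {n : ℕ} {δ : Ordinal.{u}}
    {b : Finset Ordinal.{u}} (hb : b ∈ nSubsets X n) (hX : X ⊆ A) (hδ : δ ∈ A)
    (hlt : ∀ x ∈ X, x < δ) : insert δ b ∈ nSubsets A (n + 1) := by
  refine ⟨?_, ?_⟩
  · rw [Finset.coe_insert]
    exact insert_subset hδ (hb.1.trans hX)
  · rw [Finset.card_insert_of_notMem, hb.2]
    exact fun h => lt_irrefl _ (hlt _ (hb.1 h))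

theorem mk_nSubsets_lt {σ : Cardinal.{u + 1}} (hσ : ℵ₀ < σ) {X : Set Ordinal.{u}} (hX : #X < σ)
    (n : ℕ) : #(nSubsets X n) < σ :=
  (mk_le_mk_of_subset fun _ hb => hb.1).trans_lt (mk_finsets_lt hσ hX)

/-- The set of parameters relevant for the reflection of sets `insert δ b` with `b` in `[X]^n`. -/
def traceSet (n : ℕ) (U : Finset Ordinal.{u} → Set Ordinal.{u}) (N : Set Ordinal.{u})
    (δ : Ordinal.{u}) (X : Set Ordinal.{u}) : Set Ordinal.{u} :=
  X ∪ ((⋃ b ∈ nSubsets X n, U (insert δ b) ∩ N) ∪ ⋃ c ∈ nSubsets X (n + 1), U c)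

/-- The three codes record colours, mutual intersection types, and the positions of the points of
the trace. Every part of the trace over chosen indices lies in `N`: the chosen indices by choice,
the traces of the `δ`-sets by definition, and each `U c` by closure. Hence reflection applies as
long as fewer than `σ` indices have been chosen. -/
theorem exists_reflecting {n : ℕ} {κ σ : Cardinal.{u + 1}} (hκ : ℵ₀ ≤ κ) (hσ : σ.IsRegular)
    (hκσ : κ < σ) {A : Set Ordinal.{u}} (hA : Order.succ (2 ^< σ) ≤ #A) {Q : Type (u + 1)}
    (g : Finset Ordinal.{u} → Q) (U : Finset Ordinal.{u} → Set Ordinal.{u})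
    (hg : #(g '' nSubsets A (n + 1)) < σ) (hU : ∀ b ∈ nSubsets A (n + 1), #(U b) < κ) :
    ∃ N : Set Ordinal.{u}, ∃ A' ⊆ A, ∃ δ ∈ A, σ ≤ #A' ∧ (∀ x ∈ A', x < δ) ∧
      (∀ c ∈ nSubsets A' (n + 1), U c ⊆ N) ∧
      ∀ γ ∈ A', ∀ b ∈ nSubsets (A' ∩ Iio γ) n, g (insert γ b) = g (insert δ b) ∧
        (∀ b' ∈ nSubsets (A' ∩ Iio γ) n, tpInt (U (insert γ b)) (U (insert γ b')) =
          tpInt (U (insert δ b)) (U (insert δ b'))) ∧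
        ∀ z ∈ traceSet n U N δ (A' ∩ Iio γ), ∀ i,
          IsNth (U (insert γ b)) i z ↔ IsNth (U (insert δ b)) i z := by
  classical
  have hσ0 : ℵ₀ < σ := hκ.trans_lt hκσ
  have hle : σ ≤ 2 ^< σ := le_powerlt_self le_rfl
  have hreg : (Order.succ (2 ^< σ)).IsRegular := isRegular_succ (hσ.aleph0_le.trans hle)
  let T := κ.ord.ToType
  have hT : #T < σ := by simpa [T] using hκσ
  let D : Set Ordinal.{u} → Ordinal.{u} → Set (Finset Ordinal.{u}) :=
    fun S β => nSubsets (S ∩ A ∩ Iio β) n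
  let F : Set Ordinal.{u} → Set (Finset Ordinal.{u}) := fun S => {b | (b : Set Ordinal.{u}) ⊆ S}
  have hF : ∀ S : Set Ordinal.{u}, #S < σ → #(F S) < σ := fun S hS => mk_finsets_lt hσ0 hS
  have hDF : ∀ S β, D S β ⊆ F S := fun S β b hb => hb.1.trans fun x hx => hx.1.1
  let C₁ : Set Ordinal.{u} → Ordinal.{u} → Set (Finset Ordinal.{u} × Q) :=
    fun S β => {p | p.1 ∈ D S β ∧ g (insert β p.1) = p.2}
  let C₂ : Set Ordinal.{u} → Ordinal.{u} →
      Set ((Finset Ordinal.{u} × Finset Ordinal.{u}) × T × T) :=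
    fun S β => {p | (p.1.1 ∈ D S β ∧ p.1.2 ∈ D S β) ∧
      (ordOf p.2.1, ordOf p.2.2) ∈ tpInt (U (insert β p.1.1)) (U (insert β p.1.2))}
  let C₃ : Set Ordinal.{u} → Ordinal.{u} → Set (Finset Ordinal.{u} × Ordinal.{u} × T) :=
    fun S β => {p | p.1 ∈ D S β ∧ p.2.1 ∈ S ∧ IsNth (U (insert β p.1)) (ordOf p.2.2) p.2.1}
  have hins : ∀ {S β b}, b ∈ D S β → β ∈ A → insert β b ∈ nSubsets A (n + 1) := fun hb hβ =>
    insert_mem_nSubsets hb (fun x hx => hx.1.2) hβ fun x hx => hx.2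
  have hprod : ∀ {α₁ α₂ : Type (u + 1)} {s : Set α₁} {t : Set α₂}, #s < σ → #t < σ →
      #(s ×ˢ t : Set (α₁ × α₂)) < σ := fun {_ _ s t} hs ht => by
    rw [mk_setProd]
    exact mul_lt_of_lt hσ.aleph0_le (by simpa using hs) (by simpa using ht)
  have hTu : #(Set.univ : Set T) < σ := by simpa using hT
  obtain ⟨N, A₀, hA₀, δ, hδ, hcl, habove, hrefl⟩ := exists_reflecting_point hσ hA
    (fun S β => (C₁ S β, C₂ S β, C₃ S β)) (fun S hS =>
      mk_image_prod_lt hreg.aleph0_le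
        (mk_image_powerset_lt (N := F S ×ˢ (g '' nSubsets A (n + 1))) (hprod (hF S hS) hg) _ (by
          rintro β hβ ⟨b, q⟩ ⟨hb, hq⟩
          exact ⟨hDF S β hb, _, hins hb hβ, hq⟩))
        (mk_image_prod_lt hreg.aleph0_le
          (mk_image_powerset_lt (N := (F S ×ˢ F S) ×ˢ ((Set.univ : Set T) ×ˢ (Set.univ : Set T)))
            (hprod (hprod (hF S hS) (hF S hS)) (hprod hTu hTu)) _ (by
            rintro β hβ ⟨⟨b, b'⟩, s, t⟩ ⟨⟨hb, hb'⟩, -⟩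
            exact ⟨⟨hDF S β hb, hDF S β hb'⟩, mem_univ _, mem_univ _⟩))
          (mk_image_powerset_lt (N := F S ×ˢ (S ×ˢ (Set.univ : Set T)))
            (hprod (hF S hS) (hprod hS hTu)) _ (by
            rintro β hβ ⟨b, z, t⟩ ⟨hb, hz, -⟩
            exact ⟨hDF S β hb, hz, mem_univ _⟩))))
    (fun y => ⋃ c ∈ nSubsets (y ∩ A) (n + 1), U c) (fun y hy => by
      refine ((card_biUnion_lt_iff_forall_of_isRegular hσ (mk_nSubsets_lt hσ0
        ((mk_le_mk_of_subset inter_subset_left).trans_lt hy) _)).2 fun c hc => ?_).trans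
        (Order.lt_succ_of_le hle)
      exact (hU c (nSubsets_mono inter_subset_right _ hc)).trans hκσ)
  obtain ⟨A', hA'⟩ := exists_greedy (α := Ordinal.{u}) fun X γ => γ ∈ N ∩ A₀ ∧
    (C₁ (traceSet n U N δ X) γ, C₂ (traceSet n U N δ X) γ, C₃ (traceSet n U N δ X) γ) =
    (C₁ (traceSet n U N δ X) δ, C₂ (traceSet n U N δ X) δ, C₃ (traceSet n U N δ X) δ)
  have hsub : A' ⊆ N ∩ A₀ := fun γ hγ => ((hA' γ).1 hγ).1
  have hA'A : A' ⊆ A := fun γ hγ => hA₀ (hsub hγ).2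
  have hlt : ∀ x ∈ A', x < δ := fun x hx => habove x (hsub hx)
  have hcl' : ∀ c ∈ nSubsets A' (n + 1), U c ⊆ N := by
    intro c hc
    refine Subset.trans ?_ (hcl (c : Set Ordinal.{u}) (fun x hx => (hsub (hc.1 hx)).1)
      ((lt_aleph0_of_finite _).trans hσ0))
    exact subset_biUnion_of_mem (u := U) (show c ∈ nSubsets ((c : Set Ordinal.{u}) ∩ A) (n + 1) from
      ⟨fun x hx => ⟨hx, hA'A (hc.1 hx)⟩, hc.2⟩)
  refine ⟨N, A', hA'A, δ, hA₀ hδ, ?_, hlt, hcl', fun γ hγ b hb => ?_⟩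
  -- If `A'` were small, its whole trace would be a small subset of `N`. The point reflecting `δ`
  -- over it would lie above `A'` and yet be admitted to `A'`.
  · by_contra! hsmall
    have htr : traceSet n U N δ A' ⊆ N := by
      rintro x (hx | hx | hx)
      · exact (hsub hx).1
      · obtain ⟨b, -, hb⟩ := mem_iUnion₂.1 hx
        exact hb.2
      · obtain ⟨c, hc, hb⟩ := mem_iUnion₂.1 hx
        exact hcl' c hc hb
    have htrc : #(traceSet n U N δ A') < σ := by
      refine (mk_union_le _ _).trans_lt (add_lt_of_lt hσ.aleph0_le hsmall ?_)
      refine (mk_union_le _ _).trans_lt (add_lt_of_lt hσ.aleph0_le ?_ ?_)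
      · refine (card_biUnion_lt_iff_forall_of_isRegular hσ (mk_nSubsets_lt hσ0 hsmall _)).2
          fun b hb => (mk_le_mk_of_subset inter_subset_left).trans_lt ((hU _ ?_).trans hκσ)
        exact insert_mem_nSubsets hb hA'A (hA₀ hδ) hlt
      · exact (card_biUnion_lt_iff_forall_of_isRegular hσ (mk_nSubsets_lt hσ0 hsmall _)).2
          fun c hc => (hU _ (nSubsets_mono hA'A _ hc)).trans hκσ
    obtain ⟨γ, hγ, hcode, hγlt⟩ := hrefl _ htr htrc
    have hall : ∀ x ∈ A', x < γ := fun x hx => hγlt x (Or.inl hx) (hlt x hx)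
    have hI : A' ∩ Iio γ = A' := inter_eq_left.2 hall
    exact lt_irrefl _ (hall γ ((hA' γ).2 ⟨hγ, by rw [hI]; exact hcode⟩))
  · obtain ⟨-, hcode⟩ := (hA' γ).1 hγ
    set X := A' ∩ Iio γ with hX
    set S := traceSet n U N δ X with hS
    simp only [Prod.mk.injEq] at hcode
    obtain ⟨h1, h2, h3⟩ := hcode
    have hD : ∀ b ∈ nSubsets X n, b ∈ D S γ ∧ b ∈ D S δ := fun b hb =>
      ⟨⟨fun x hx => ⟨⟨Or.inl (hb.1 hx), hA'A (hb.1 hx).1⟩, (hb.1 hx).2⟩, hb.2⟩,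
        ⟨fun x hx => ⟨⟨Or.inl (hb.1 hx), hA'A (hb.1 hx).1⟩, hlt x (hb.1 hx).1⟩, hb.2⟩⟩
    have hsmall : ∀ b ∈ nSubsets X n, #(U (insert γ b)) < κ ∧ #(U (insert δ b)) < κ := fun b hb =>
      ⟨hU _ (hins (hD b hb).1 (hA'A hγ)), hU _ (hins (hD b hb).2 (hA₀ hδ))⟩
    have hnth : ∀ {a : Set Ordinal.{u}} {i z}, #a < κ → IsNth a i z → ∃ t : T, ordOf t = i :=
      fun ha hi => exists_ordOf (hi.lt_otp.trans (otp_lt_ord ha))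
    refine ⟨?_, fun b' hb' => ?_, fun z hz i => ⟨fun hi => ?_, fun hi => ?_⟩⟩
    · have h : (b, g (insert γ b)) ∈ C₁ S γ := ⟨(hD b hb).1, rfl⟩
      rw [h1] at h
      exact h.2.symm
    · ext ⟨i, j⟩
      constructor
      · rintro ⟨z, hi, hj⟩
        obtain ⟨s, rfl⟩ := hnth (hsmall b hb).1 hi
        obtain ⟨t, rfl⟩ := hnth (hsmall b' hb').1 hj
        have h : ((b, b'), s, t) ∈ C₂ S γ := ⟨⟨(hD b hb).1, (hD b' hb').1⟩, z, hi, hj⟩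
        rw [h2] at h
        exact h.2
      · rintro ⟨z, hi, hj⟩
        obtain ⟨s, rfl⟩ := hnth (hsmall b hb).2 hi
        obtain ⟨t, rfl⟩ := hnth (hsmall b' hb').2 hj
        have h : ((b, b'), s, t) ∈ C₂ S δ := ⟨⟨(hD b hb).2, (hD b' hb').2⟩, z, hi, hj⟩
        rw [← h2] at h
        exact h.2
    · obtain ⟨s, rfl⟩ := hnth (hsmall b hb).1 hi
      have h : (b, z, s) ∈ C₃ S γ := ⟨(hD b hb).1, hz, hi⟩
      rw [h3] at h
      exact h.2.2
    · obtain ⟨s, rfl⟩ := hnth (hsmall b hb).2 hi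
      have h : (b, z, s) ∈ C₃ S δ := ⟨(hD b hb).2, hz, hi⟩
      rw [← h3] at h
      exact h.2.2

/-! ### One more dimension -/

theorem exists_top {H : Set Ordinal.{u}} {n : ℕ} {c : Finset Ordinal.{u}}
    (hc : c ∈ nSubsets H (n + 1)) :
    ∃ β ∈ H, ∃ b ∈ nSubsets (H ∩ Iio β) n, c = insert β b := by
  have hne : c.Nonempty := Finset.card_pos.1 (by rw [hc.2]; omega)
  have hmax := c.max'_mem hne
  refine ⟨c.max' hne, hc.1 hmax, c.erase (c.max' hne), ⟨fun x hx => ?_, ?_⟩,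
    (Finset.insert_erase hmax).symm⟩
  · have hx' := Finset.mem_erase.1 (Finset.mem_coe.1 hx)
    exact ⟨hc.1 hx'.2, lt_of_le_of_ne (c.le_max' x hx'.2) hx'.1⟩
  · rw [Finset.card_erase_of_mem hmax, hc.2]
    rfl

theorem pos_insert_of_le {b : Finset Ordinal.{u}} {β x : Ordinal.{u}} (h : x ≤ β) :
    pos (insert β b) x = pos b x := by
  unfold pos
  rw [Finset.filter_insert, if_neg (not_lt.2 h)]

theorem pos_of_forall_lt {b : Finset Ordinal.{u}} {β : Ordinal.{u}} (h : ∀ x ∈ b, x < β) :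
    pos b β = b.card := by
  unfold pos
  rw [Finset.filter_true_of_mem h]

/-- Replacing an element of `b` by one in the same relative position. -/
theorem replace_mem_nSubsets {H : Set Ordinal.{u}} {n : ℕ} {b : Finset Ordinal.{u}}
    {γ α β : Ordinal.{u}} (hb : b ∈ nSubsets (H ∩ Iio β) n) (hγ : γ ∈ b) (hα : α ∈ H) (hαβ : α < β)
    (hpos : ∀ x ∈ b, (x < γ → x < α) ∧ (γ < x → α < x)) :
    insert α (b.erase γ) ∈ nSubsets (H ∩ Iio β) n := by
  have hn : α ∉ b.erase γ := by
    intro h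
    obtain ⟨h1, h2⟩ := Finset.mem_erase.1 h
    rcases lt_or_gt_of_ne h1 with hlt | hlt
    · exact lt_irrefl _ ((hpos α h2).1 hlt)
    · exact lt_irrefl _ ((hpos α h2).2 hlt)
  refine ⟨?_, ?_⟩
  · rw [Finset.coe_insert]
    exact insert_subset ⟨hα, hαβ⟩ fun x hx => hb.1 (Finset.mem_of_mem_erase hx)
  · rw [Finset.card_insert_of_notMem hn, Finset.card_erase_of_mem hγ, hb.2]
    have : 0 < n := hb.2 ▸ Finset.card_pos.2 ⟨γ, hγ⟩
    omega

/-- The top of an index set has position `n`. For aligned sets, `n ∈ m` means that the tops coincide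
and only the lower parts matter, by `htop`; otherwise the tops differ and `hlow` keeps the positions
in `s`. The law for intersections of patterns is inherited from `r`, because cutting with `s`
commutes with it. -/
theorem Good.succ {n : ℕ} {H : Set Ordinal.{u}} {U v : Finset Ordinal.{u} → Set Ordinal.{u}}
    {ρ : Ordinal.{u + 1}} {r : Finset ℕ → Set Ordinal.{u + 1}} {s : Set Ordinal.{u + 1}}
    (hv : Good n H v ρ r)
    (htop : ∀ β ∈ H, ∀ b ∈ nSubsets (H ∩ Iio β) n, ∀ b' ∈ nSubsets (H ∩ Iio β) n,
      tpInt (U (insert β b)) (U (insert β b')) = tpInt (v b) (v b'))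
    (hlow : ∀ β ∈ H, ∀ β' ∈ H, β < β' → ∀ b ∈ nSubsets (H ∩ Iio β) n,
      ∀ b' ∈ nSubsets (H ∩ Iio β') n, β ∉ b' →
      tpInt (U (insert β b)) (U (insert β' b')) = {p | p ∈ tpInt (v b) (v b') ∧ p.1 ∈ s}) :
    Good (n + 1) H U ρ fun m => if n ∈ m then r (m.erase n) else r m ∩ s := by
  have hH : ∀ {β b}, b ∈ nSubsets (H ∩ Iio β) n → b ∈ nSubsets H n := fun hb =>
    nSubsets_mono inter_subset_left n hb
  have hlt : ∀ {β b}, b ∈ nSubsets (H ∩ Iio β) n → ∀ x ∈ b, x < β := fun hb x hx => (hb.1 hx).2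
  have hnot : ∀ {β b}, b ∈ nSubsets (H ∩ Iio β) n → β ∉ b := fun hb h => lt_irrefl _ (hlt hb _ h)
  have hposb : ∀ {β b}, b ∈ nSubsets (H ∩ Iio β) n → ∀ x ∈ b, pos (insert β b) x = pos b x :=
    fun hb x hx => pos_insert_of_le (hlt hb x hx).le
  have hposβ : ∀ {β b}, b ∈ nSubsets (H ∩ Iio β) n → pos (insert β b) β = n :=
    fun hb => by rw [pos_insert_of_le le_rfl, pos_of_forall_lt (hlt hb), hb.2]
  have hposlt : ∀ {β b}, b ∈ nSubsets (H ∩ Iio β) n → ∀ x ∈ b, pos (insert β b) x < n :=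
    fun hb x hx => by rw [hposb hb x hx, ← hb.2]; exact pos_lt_card hx
  have hswap : ∀ {a b c d : Set Ordinal.{u}}, tpInt b a = tpInt d c → tpInt a b = tpInt c d := by
    intro a b c d h
    ext ⟨i, j⟩
    rw [tpInt_swap, h, tpInt_swap]
  have tplt : ∀ β ∈ H, ∀ β' ∈ H, β < β' → ∀ b ∈ nSubsets (H ∩ Iio β) n,
      ∀ b' ∈ nSubsets (H ∩ Iio β') n, FinAligned (insert β b) (insert β' b') →
      n ∉ finRset (insert β b) (insert β' b') ∧
      tpInt (U (insert β b)) (U (insert β' b')) =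
        {p | p.1 = p.2 ∧ p.1 ∈ r (finRset (insert β b) (insert β' b')) ∩ s} := by
    intro β hβ β' hβ' hββ b hb b' hb' hal
    -- `β` has position `n` in the first set and would have a smaller one in the second, so
    -- alignment excludes it from `b'`.
    have hβb' : β ∉ b' := by
      intro h
      have h1 := hal.2 β (Finset.mem_insert_self _ _) (Finset.mem_insert_of_mem h)
      rw [hposβ hb] at h1
      exact absurd (hposlt hb' β h) (by omega)
    have hβ'b : β' ∉ b := fun h => lt_asymm hββ (hlt hb _ h)
    have hset : finRset (insert β b) (insert β' b') = finRset b b' := by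
      ext i
      simp only [mem_finRset]
      constructor
      · rintro ⟨x, hx, hx', rfl⟩
        rcases Finset.mem_insert.1 hx with rfl | hx
        · rcases Finset.mem_insert.1 hx' with rfl | hx'
          · exact absurd hββ (lt_irrefl _)
          · exact absurd hx' hβb'
        · rcases Finset.mem_insert.1 hx' with rfl | hx'
          · exact absurd hx hβ'b
          · exact ⟨x, hx, hx', (hposb hb x hx).symm⟩
      · rintro ⟨x, hx, hx', rfl⟩
        exact ⟨x, Finset.mem_insert_of_mem hx, Finset.mem_insert_of_mem hx', hposb hb x hx⟩
    have hal' : FinAligned b b' := by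
      refine ⟨hb.2.trans hb'.2.symm, fun x hx hx' => ?_⟩
      rw [← hposb hb x hx, ← hposb hb' x hx']
      exact hal.2 x (Finset.mem_insert_of_mem hx) (Finset.mem_insert_of_mem hx')
    rw [hset]
    refine ⟨fun h => ?_, ?_⟩
    · have := finRset_subset _ _ h
      rw [hb.2] at this
      simp at this
    · rw [hlow β hβ β' hβ' hββ b hb b' hb' hβb', hv.tp b (hH hb) b' (hH hb') hal']
      ext p
      simp [and_assoc]
  have movelt : ∀ β ∈ H, ∀ β' ∈ H, β < β' → ∀ b ∈ nSubsets (H ∩ Iio β) n,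
      ∀ b' ∈ nSubsets (H ∩ Iio β') n, ∀ γ ∈ insert β b, γ ∈ insert β' b' →
      (∀ x ∈ insert β b, x ∈ insert β' b' → γ ≤ x → pos (insert β b) x = pos (insert β' b') x) →
      ∀ α ∈ H, (∀ x ∈ insert β b, (x < γ → x < α) ∧ (γ < x → α < x)) →
      (∀ x ∈ insert β' b', (x < γ → x < α) ∧ (γ < x → α < x)) →
      tpInt (U (insert β b)) (U (insert β' b')) =
        tpInt (U (insert α ((insert β b).erase γ))) (U (insert α ((insert β' b').erase γ))) := by
    intro β hβ β' hβ' hββ b hb b' hb' γ hγ hγ' hal α hα hp hp'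
    have hγβ : γ ≤ β := by
      rcases Finset.mem_insert.1 hγ with rfl | h
      · exact le_rfl
      · exact (hlt hb _ h).le
    have hγb' : γ ∈ b' := by
      rcases Finset.mem_insert.1 hγ' with rfl | h
      · exact absurd hγβ (not_le.2 hββ)
      · exact h
    have hβb' : β ∉ b' := by
      intro h
      have h1 := hal β (Finset.mem_insert_self _ _) (Finset.mem_insert_of_mem h) hγβ
      rw [hposβ hb] at h1
      exact absurd (hposlt hb' β h) (by omega)
    have hγb : γ ∈ b := by
      rcases Finset.mem_insert.1 hγ with rfl | h
      · exact absurd hγb' hβb'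
      · exact h
    have hγβ : γ < β := hlt hb _ hγb
    have hαβ : α < β := (hp β (Finset.mem_insert_self _ _)).2 hγβ
    have hpb : ∀ x ∈ b, (x < γ → x < α) ∧ (γ < x → α < x) := fun x hx =>
      hp x (Finset.mem_insert_of_mem hx)
    have hpb' : ∀ x ∈ b', (x < γ → x < α) ∧ (γ < x → α < x) := fun x hx =>
      hp' x (Finset.mem_insert_of_mem hx)
    have hb₁ := replace_mem_nSubsets hb hγb hα hαβ hpb
    have hb₁' := replace_mem_nSubsets hb' hγb' hα (hαβ.trans hββ) hpb'
    rw [Finset.erase_insert_of_ne hγβ.ne', Finset.erase_insert_of_ne (hγβ.trans hββ).ne',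
      Finset.insert_comm, Finset.insert_comm α β', hlow β hβ β' hβ' hββ b hb b' hb' hβb',
      hlow β hβ β' hβ' hββ _ hb₁ _ hb₁', hv.move b (hH hb) b' (hH hb') γ hγb hγb' _ α hα hpb hpb']
    · intro x hx hx' hle
      rw [← hposb hb x hx, ← hposb hb' x hx']
      exact hal x (Finset.mem_insert_of_mem hx) (Finset.mem_insert_of_mem hx') hle
    · intro h
      rcases Finset.mem_insert.1 h with rfl | h
      · exact lt_irrefl _ hαβ
      · exact hβb' (Finset.mem_of_mem_erase h)
  refine ⟨fun c hc => ?_, fun a ha a' ha' hal => ?_, fun m₀ hm₀ m₁ hm₁ => ?_, fun m hm => ?_, ?_⟩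
  · obtain ⟨β, hβ, b, hb, rfl⟩ := exists_top hc
    rw [otp_eq_of_tpInt (htop β hβ b hb b hb)]
    exact hv.otp_eq b (hH hb)
  · obtain ⟨β, hβ, b, hb, rfl⟩ := exists_top ha
    obtain ⟨β', hβ', b', hb', rfl⟩ := exists_top ha'
    rcases lt_trichotomy β β' with hββ | rfl | hββ
    · obtain ⟨h1, h2⟩ := tplt β hβ β' hβ' hββ b hb b' hb' hal
      rw [h2, if_neg h1]
    · have hset : (finRset (insert β b) (insert β b')) = insert n (finRset b b') := by
        ext i
        simp only [mem_finRset, Finset.mem_insert]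
        constructor
        · rintro ⟨x, rfl | hx, hx', rfl⟩
          · exact Or.inl (hposβ hb)
          · rcases hx' with rfl | hx'
            · exact absurd hx (hnot hb)
            · exact Or.inr ⟨x, hx, hx', (hposb hb x hx).symm⟩
        · rintro (rfl | ⟨x, hx, hx', rfl⟩)
          · exact ⟨β, Or.inl rfl, Or.inl rfl, hposβ hb⟩
          · exact ⟨x, Or.inr hx, Or.inr hx', hposb hb x hx⟩
      have hn : n ∉ finRset b b' := fun h => by
        have := finRset_subset _ _ h
        rw [hb.2] at this
        simp at this
      have hal' : FinAligned b b' := by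
        refine ⟨hb.2.trans hb'.2.symm, fun x hx hx' => ?_⟩
        rw [← hposb hb x hx, ← hposb hb' x hx']
        exact hal.2 x (Finset.mem_insert_of_mem hx) (Finset.mem_insert_of_mem hx')
      rw [hset, if_pos (Finset.mem_insert_self _ _), Finset.erase_insert hn,
        htop β hβ b hb b' hb', hv.tp b (hH hb) b' (hH hb') hal']
    · obtain ⟨h1, h2⟩ := tplt β' hβ' β hβ hββ b' hb' b hb hal.symm
      rw [hal.finRset_comm] at h1 h2
      rw [if_neg h1]
      ext ⟨i, j⟩
      rw [tpInt_swap, h2]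
      constructor
      · rintro ⟨hij, h⟩
        exact ⟨hij.symm, (show j = i from hij) ▸ h⟩
      · rintro ⟨hij, h⟩
        exact ⟨hij.symm, (show i = j from hij) ▸ h⟩
  · have hr : ∀ {m : Finset ℕ}, m ⊆ Finset.range (n + 1) → n ∉ m → m ⊆ Finset.range n := by
      intro m hm hn i hi
      have := Finset.mem_range.1 (hm hi)
      have : i ≠ n := fun h => hn (h ▸ hi)
      exact Finset.mem_range.2 (by omega)
    have he : ∀ {m : Finset ℕ}, m ⊆ Finset.range (n + 1) → m.erase n ⊆ Finset.range n :=
      fun hm => hr ((Finset.erase_subset _ _).trans hm) (Finset.notMem_erase _ _)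
    by_cases h0 : n ∈ m₀ <;> by_cases h1 : n ∈ m₁
    · rw [if_pos (Finset.mem_inter.2 ⟨h0, h1⟩), if_pos h0, if_pos h1,
        ← hv.inter _ (he hm₀) _ (he hm₁)]
      congr 1
      ext i
      simp only [Finset.mem_erase, Finset.mem_inter]
      tauto
    · rw [if_neg (fun h => h1 (Finset.mem_inter.1 h).2), if_pos h0, if_neg h1, ← inter_assoc,
        ← hv.inter _ (he hm₀) _ (hr hm₁ h1)]
      congr 2
      ext i
      simp only [Finset.mem_erase, Finset.mem_inter]
      exact ⟨fun h => ⟨⟨fun h' => h1 (h' ▸ h.2), h.1⟩, h.2⟩, fun h => ⟨h.1.2, h.2⟩⟩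
    · rw [if_neg (fun h => h0 (Finset.mem_inter.1 h).1), if_neg h0, if_pos h1, inter_right_comm,
        ← hv.inter _ (hr hm₀ h0) _ (he hm₁)]
      congr 2
      ext i
      simp only [Finset.mem_erase, Finset.mem_inter]
      exact ⟨fun h => ⟨h.1, fun h' => h0 (h' ▸ h.1), h.2⟩, fun h => ⟨h.1, h.2.2⟩⟩
    · rw [if_neg (fun h => h0 (Finset.mem_inter.1 h).1), if_neg h0, if_neg h1,
        hv.inter _ (hr hm₀ h0) _ (hr hm₁ h1), inter_inter_distrib_right]
  · have hr : m.erase n ⊆ Finset.range n := by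
      intro i hi
      obtain ⟨h1, h2⟩ := Finset.mem_erase.1 hi
      have := Finset.mem_range.1 (hm h2)
      exact Finset.mem_range.2 (by omega)
    split_ifs with h
    · exact hv.sub _ hr
    · exact inter_subset_left.trans (hv.sub _ (Finset.erase_eq_of_notMem h ▸ hr))
  · intro a ha a' ha' γ hγ hγ' hal α hα hp hp'
    obtain ⟨β, hβ, b, hb, rfl⟩ := exists_top ha
    obtain ⟨β', hβ', b', hb', rfl⟩ := exists_top ha'
    rcases lt_trichotomy β β' with hββ | rfl | hββ
    · exact movelt β hβ β' hβ' hββ b hb b' hb' γ hγ hγ' hal α hα hp hp'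
    · have hpb : ∀ x ∈ b, (x < γ → x < α) ∧ (γ < x → α < x) := fun x hx =>
        hp x (Finset.mem_insert_of_mem hx)
      have hpb' : ∀ x ∈ b', (x < γ → x < α) ∧ (γ < x → α < x) := fun x hx =>
        hp' x (Finset.mem_insert_of_mem hx)
      by_cases hγβ : γ = β
      -- When the common top is moved, both sides reduce to the type of `v b` and `v b'`, which does
      -- not involve the top.
      · subst hγβ
        rw [Finset.erase_insert (hnot hb), Finset.erase_insert (hnot hb'),
          htop γ hβ b hb b' hb', htop α hα b _ b' _]
        · exact ⟨fun x hx => ⟨(hb.1 hx).1, (hpb x hx).1 (hlt hb x hx)⟩, hb.2⟩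
        · exact ⟨fun x hx => ⟨(hb'.1 hx).1, (hpb' x hx).1 (hlt hb' x hx)⟩, hb'.2⟩
      · have hγb : γ ∈ b := (Finset.mem_insert.1 hγ).resolve_left hγβ
        have hγb' : γ ∈ b' := (Finset.mem_insert.1 hγ').resolve_left hγβ
        have hlt' : γ < β := hlt hb _ hγb
        have hαβ : α < β := (hp β (Finset.mem_insert_self _ _)).2 hlt'
        have hb₁ := replace_mem_nSubsets hb hγb hα hαβ hpb
        have hb₁' := replace_mem_nSubsets hb' hγb' hα hαβ hpb'
        rw [Finset.erase_insert_of_ne hlt'.ne', Finset.erase_insert_of_ne hlt'.ne',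
          Finset.insert_comm, Finset.insert_comm α β, htop β hβ b hb b' hb', htop β hβ _ hb₁ _ hb₁',
          hv.move b (hH hb) b' (hH hb') γ hγb hγb' _ α hα hpb hpb']
        intro x hx hx' hle
        rw [← hposb hb x hx, ← hposb hb' x hx']
        exact hal x (Finset.mem_insert_of_mem hx) (Finset.mem_insert_of_mem hx') hle
    · exact hswap (movelt β' hβ' β hβ hββ b' hb' b hb γ hγ' hγ
        (fun x hx hx' hle => (hal x hx' hx hle).symm) α hα hp' hp)

/-! ### Thinning the index set: captured points and gaps -/

theorem finAligned_union {a e e' : Finset Ordinal.{u}} (he : ∀ x ∈ a, ∀ y ∈ e, x < y)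
    (he' : ∀ x ∈ a, ∀ y ∈ e', x < y) (hd : Disjoint e e') (hc : e.card = e'.card) :
    FinAligned (a ∪ e) (a ∪ e') ∧ finRset (a ∪ e) (a ∪ e') = Finset.range a.card := by
  have hda : ∀ {e : Finset Ordinal.{u}}, (∀ x ∈ a, ∀ y ∈ e, x < y) → Disjoint a e := fun h =>
    Finset.disjoint_left.2 fun x hx hx' => lt_irrefl _ (h x hx x hx')
  have hpos : ∀ {e : Finset Ordinal.{u}}, (∀ x ∈ a, ∀ y ∈ e, x < y) → ∀ x ∈ a,
      pos (a ∪ e) x = pos a x := by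
    intro e h x hx
    unfold pos
    rw [Finset.filter_union, Finset.filter_false_of_mem (s := e), Finset.union_empty]
    exact fun y hy => not_lt.2 (h x hx y hy).le
  have hmem : ∀ x ∈ a ∪ e, x ∈ a ∪ e' → x ∈ a := by
    intro x hx hx'
    rcases Finset.mem_union.1 hx with h | h
    · exact h
    · rcases Finset.mem_union.1 hx' with h' | h'
      · exact h'
      · exact absurd h' (Finset.disjoint_left.1 hd h)
  refine ⟨⟨?_, fun x hx hx' => ?_⟩, ?_⟩
  · rw [Finset.card_union_of_disjoint (hda he), Finset.card_union_of_disjoint (hda he'), hc]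
  · rw [hpos he x (hmem x hx hx'), hpos he' x (hmem x hx hx')]
  · ext i
    simp only [mem_finRset, Finset.mem_range]
    constructor
    · rintro ⟨x, hx, hx', rfl⟩
      rw [hpos he x (hmem x hx hx')]
      exact pos_lt_card (hmem x hx hx')
    · intro hi
      obtain ⟨x, hx, rfl⟩ := exists_pos hi
      exact ⟨x, Finset.mem_union_left _ hx, Finset.mem_union_left _ hx, hpos he x hx⟩

theorem Good.nth {n : ℕ} {H : Set Ordinal.{u}} {U : Finset Ordinal.{u} → Set Ordinal.{u}}
    {ρ : Ordinal.{u + 1}} {r : Finset ℕ → Set Ordinal.{u + 1}} (h : Good n H U ρ r)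
    {a b : Finset Ordinal.{u}} (ha : a ∈ nSubsets H n) (hb : b ∈ nSubsets H n)
    (hal : FinAligned a b) {i : Ordinal.{u + 1}} {x : Ordinal.{u}} (hx : IsNth (U a) i x)
    (hi : i ∈ r (finRset a b)) : IsNth (U b) i x := by
  have : (i, i) ∈ tpInt (U a) (U b) := by
    rw [h.tp a ha b hb hal]
    exact ⟨rfl, hi⟩
  obtain ⟨y, hy, hy'⟩ := this
  exact hx.unique hy ▸ hy'

theorem Good.mem_of_nth {n : ℕ} {H : Set Ordinal.{u}} {U : Finset Ordinal.{u} → Set Ordinal.{u}}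
    {ρ : Ordinal.{u + 1}} {r : Finset ℕ → Set Ordinal.{u + 1}} (h : Good n H U ρ r)
    {a b : Finset Ordinal.{u}} (ha : a ∈ nSubsets H n) (hb : b ∈ nSubsets H n)
    (hal : FinAligned a b) {i j : Ordinal.{u + 1}} {x : Ordinal.{u}} (hx : IsNth (U a) i x)
    (hx' : IsNth (U b) j x) : i = j ∧ i ∈ r (finRset a b) := by
  have : (i, j) ∈ tpInt (U a) (U b) := ⟨x, hx, hx'⟩
  rw [h.tp a ha b hb hal] at this
  exact this

theorem Good.mono_range {n : ℕ} {H : Set Ordinal.{u}} {U : Finset Ordinal.{u} → Set Ordinal.{u}}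
    {ρ : Ordinal.{u + 1}} {r : Finset ℕ → Set Ordinal.{u + 1}} (h : Good n H U ρ r) {j k : ℕ}
    (hjk : j ≤ k) (hk : k ≤ n) : r (Finset.range j) ⊆ r (Finset.range k) := by
  have h1 := h.inter (Finset.range j) (by simpa using hjk.trans hk) (Finset.range k)
    (by simpa using hk)
  rw [Finset.inter_eq_left.2 (by simpa using hjk)] at h1
  exact inter_eq_left.1 h1.symm

theorem exists_finset_above {H : Set Ordinal.{u}} {lam : Cardinal.{u + 1}} (hlam : lam.IsRegular)
    (hc : #H = lam) (hinit : ∀ x ∈ H, #(H ∩ Iio x : Set Ordinal.{u}) < lam)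
    (F : Finset Ordinal.{u}) (hF : (F : Set Ordinal.{u}) ⊆ H) (m : ℕ) :
    ∃ e : Finset Ordinal.{u}, (e : Set Ordinal.{u}) ⊆ H ∧ e.card = m ∧
      ∀ x ∈ F, ∀ y ∈ e, x < y := by
  induction m with
  | zero => exact ⟨∅, by simp, rfl, by simp⟩
  | succ m ih =>
    obtain ⟨e, he, hem, hlt⟩ := ih
    have hfin : ((F ∪ e : Finset Ordinal.{u}) : Set Ordinal.{u}) ⊆ H := by
      rw [Finset.coe_union]
      exact union_subset hF he
    obtain ⟨γ, hγ, habove⟩ := exists_above hlam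
      ((lt_aleph0_of_finite _).trans_le hlam.aleph0_le) hfin hc.ge hinit
    refine ⟨insert γ e, ?_, ?_, ?_⟩
    · rw [Finset.coe_insert]
      exact insert_subset hγ he
    · rw [Finset.card_insert_of_notMem, hem]
      exact fun h => lt_irrefl _ (habove γ (Finset.mem_coe.2 (Finset.mem_union_right _ h)))
    · intro x hx y hy
      rcases Finset.mem_insert.1 hy with rfl | hy
      · exact habove x (Finset.mem_coe.2 (Finset.mem_union_left _ hx))
      · exact hlt x hx y hy

/-- `γ` realizes the `i`-th element of a set of the family as the point `x`, where `i` becomes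
determined exactly at `γ`. -/
def Captures (n : ℕ) (H : Set Ordinal.{u}) (v : Finset Ordinal.{u} → Set Ordinal.{u})
    (r : Finset ℕ → Set Ordinal.{u + 1}) (a : Finset Ordinal.{u}) (γ : Ordinal.{u})
    (i : Ordinal.{u + 1}) (x : Ordinal.{u}) : Prop :=
  ∃ d : Finset Ordinal.{u}, ((insert γ a ∪ d : Finset Ordinal.{u}) : Set Ordinal.{u}) ⊆ H ∧
    (∀ y ∈ a, y < γ) ∧ (∀ y ∈ d, γ < y) ∧ a.card + 1 + d.card = n ∧
    i ∈ r (Finset.range (a.card + 1)) ∧ i ∉ r (Finset.range a.card) ∧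
    IsNth (v (insert γ a ∪ d)) i x

/-- Suppose `γ ≠ γ'`. Replace the tails `d` and `d'` by disjoint fresh tails above everything. Since
`i` is determined by the first `a.card + 1` indices, `x` stays at position `i` in both sets. The two
index sets now meet exactly in `a`, so `i` would be determined by `a` alone, contrary to capture. -/
theorem Captures.unique {n : ℕ} {H : Set Ordinal.{u}}
    {v : Finset Ordinal.{u} → Set Ordinal.{u}} {ρ : Ordinal.{u + 1}}
    {r : Finset ℕ → Set Ordinal.{u + 1}} {lam : Cardinal.{u + 1}} (hlam : lam.IsRegular)
    (hc : #H = lam) (hinit : ∀ x ∈ H, #(H ∩ Iio x : Set Ordinal.{u}) < lam)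
    (hv : Good n H v ρ r) {a : Finset Ordinal.{u}} {γ γ' x : Ordinal.{u}} {i : Ordinal.{u + 1}}
    (h : Captures n H v r a γ i x) (h' : Captures n H v r a γ' i x) : γ = γ' := by
  by_contra hne
  obtain ⟨d, hdH, haγ, hγd, hcard, hi, hi', hnth⟩ := h
  obtain ⟨d', hdH', haγ', hγd', hcard', -, -, hnth'⟩ := h'
  obtain ⟨e, heH, hec, habove⟩ := exists_finset_above hlam hc hinit
    ((insert γ a ∪ d) ∪ (insert γ' a ∪ d')) (by
      rw [Finset.coe_union]
      exact union_subset hdH hdH') d.card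
  obtain ⟨e', heH', hec', habove'⟩ := exists_finset_above hlam hc hinit
    (((insert γ a ∪ d) ∪ (insert γ' a ∪ d')) ∪ e) (by
      rw [Finset.coe_union, Finset.coe_union]
      exact union_subset (union_subset hdH hdH') heH) d.card
  have hee : Disjoint e e' := Finset.disjoint_left.2 fun y hy hy' =>
    lt_irrefl _ (habove' y (Finset.mem_union_right _ hy) y hy')
  have main : ∀ {γ : Ordinal.{u}} {d e : Finset Ordinal.{u}},
      ((insert γ a ∪ d : Finset Ordinal.{u}) : Set Ordinal.{u}) ⊆ H → (∀ y ∈ a, y < γ) →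
      (∀ y ∈ d, γ < y) → a.card + 1 + d.card = n → IsNth (v (insert γ a ∪ d)) i x →
      (e : Set Ordinal.{u}) ⊆ H → e.card = d.card → (∀ x ∈ insert γ a ∪ d, ∀ y ∈ e, x < y) →
      insert γ a ∪ e ∈ nSubsets H n ∧ IsNth (v (insert γ a ∪ e)) i x := by
    intro γ d e hdH haγ hγd hcard hnth heH hec habove
    have hca : (insert γ a).card = a.card + 1 := Finset.card_insert_of_notMem fun h =>
      lt_irrefl _ (haγ γ h)
    have hd1 : ∀ x ∈ insert γ a, ∀ y ∈ d, x < y := by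
      intro x hx y hy
      rcases Finset.mem_insert.1 hx with rfl | hx
      · exact hγd y hy
      · exact (haγ x hx).trans (hγd y hy)
    have he1 : ∀ x ∈ insert γ a, ∀ y ∈ e, x < y := fun x hx => habove x (Finset.mem_union_left _ hx)
    have hdis : ∀ {e : Finset Ordinal.{u}}, (∀ x ∈ insert γ a, ∀ y ∈ e, x < y) →
        Disjoint (insert γ a) e := fun h =>
      Finset.disjoint_left.2 fun x hx hx' => lt_irrefl _ (h x hx x hx')
    have hde : Disjoint d e := Finset.disjoint_left.2 fun y hy hy' =>
      lt_irrefl _ (habove y (Finset.mem_union_right _ hy) y hy')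
    obtain ⟨hal, hr⟩ := finAligned_union hd1 he1 hde hec.symm
    have hmd : insert γ a ∪ d ∈ nSubsets H n :=
      ⟨hdH, by rw [Finset.card_union_of_disjoint (hdis hd1), hca, hcard]⟩
    have hme : insert γ a ∪ e ∈ nSubsets H n := by
      refine ⟨?_, by rw [Finset.card_union_of_disjoint (hdis he1), hca, hec, hcard]⟩
      rw [Finset.coe_union] at hdH ⊢
      exact union_subset (subset_union_left.trans hdH) heH
    exact ⟨hme, hv.nth hmd hme hal hnth (by rw [hr, hca]; exact hi)⟩
  obtain ⟨h1, h2⟩ := main hdH haγ hγd hcard hnth heH hec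
    (fun x hx => habove x (Finset.mem_union_left _ hx))
  obtain ⟨h1', h2'⟩ := main hdH' haγ' hγd' hcard' hnth' heH' (by omega)
    (fun x hx => habove' x (Finset.mem_union_left _ (Finset.mem_union_right _ hx)))
  rw [Finset.insert_union, ← Finset.union_insert] at h1 h2 h1' h2'
  have hlow : ∀ x ∈ a, ∀ y ∈ insert γ e, x < y := by
    intro x hx y hy
    rcases Finset.mem_insert.1 hy with rfl | hy
    · exact haγ x hx
    · exact habove x (by simp [hx]) y hy
  have hlow' : ∀ x ∈ a, ∀ y ∈ insert γ' e', x < y := by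
    intro x hx y hy
    rcases Finset.mem_insert.1 hy with rfl | hy
    · exact haγ' x hx
    · exact habove' x (by simp [hx]) y hy
  have hγe : γ ∉ e := fun h => lt_irrefl _ (habove γ (by simp) γ h)
  have hγe' : γ ∉ e' := fun h => lt_irrefl _ (habove' γ (by simp) γ h)
  have hγ'e : γ' ∉ e := fun h => lt_irrefl _ (habove γ' (by simp) γ' h)
  have hγ'e' : γ' ∉ e' := fun h => lt_irrefl _ (habove' γ' (by simp) γ' h)
  obtain ⟨hal, hr⟩ := finAligned_union hlow hlow' (by
    rw [Finset.disjoint_insert_left, Finset.disjoint_insert_right, Finset.mem_insert]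
    exact ⟨by tauto, hγ'e, hee⟩) (by
    rw [Finset.card_insert_of_notMem hγe, Finset.card_insert_of_notMem hγ'e', hec, hec'])
  have := (hv.mem_of_nth h1 h1' hal h2 h2').2
  rw [hr] at this
  exact hi' this

/-- Between the finite subset `a` of `H` and `γ` there are only finitely many elements of `H`. -/
def Close (H : Set Ordinal.{u}) (a : Finset Ordinal.{u}) (γ : Ordinal.{u}) : Prop :=
  {x | x ∈ H ∧ (∀ y ∈ a, y < x) ∧ x < γ}.Finite

/-- A point above `a` and close to it is identified by the finite number of elements of `H` between,
so there are only countably many. The remaining points lie at or below an element of `a`. -/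
theorem mk_close_lt {lam : Cardinal.{u + 1}} (hlam : lam.IsRegular) (hlam0 : ℵ₀ < lam)
    {H : Set Ordinal.{u}} (hinit : ∀ x ∈ H, #(H ∩ Iio x : Set Ordinal.{u}) < lam)
    (a : Finset Ordinal.{u}) (ha : (a : Set Ordinal.{u}) ⊆ H) :
    #{γ | γ ∈ H ∧ Close H a γ} < lam := by
  have h1 : #{γ | γ ∈ H ∧ ∃ x ∈ (a : Set Ordinal.{u}), γ ≤ x} < lam :=
    mk_lower_lt hlam ((lt_aleph0_of_finite _).trans hlam0) ha hinit
  have h2 : #{γ | γ ∈ H ∧ (∀ y ∈ a, y < γ) ∧ Close H a γ} ≤ ℵ₀ := by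
    rw [mk_le_aleph0_iff]
    refine Function.Injective.countable
      (f := fun γ : {γ | γ ∈ H ∧ (∀ y ∈ a, y < γ) ∧ Close H a γ} =>
        {x | x ∈ H ∧ (∀ y ∈ a, y < x) ∧ x < γ.1}.ncard) ?_
    have key : ∀ γ γ' : {γ | γ ∈ H ∧ (∀ y ∈ a, y < γ) ∧ Close H a γ}, γ.1 < γ'.1 →
        {x | x ∈ H ∧ (∀ y ∈ a, y < x) ∧ x < γ.1}.ncard <
        {x | x ∈ H ∧ (∀ y ∈ a, y < x) ∧ x < γ'.1}.ncard := by
      intro γ γ' hlt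
      refine Set.ncard_lt_ncard ⟨fun x hx => ⟨hx.1, hx.2.1, hx.2.2.trans hlt⟩, fun h => ?_⟩ γ'.2.2.2
      exact lt_irrefl _ (h ⟨γ.2.1, γ.2.2.1, hlt⟩ : γ.1 ∈ H ∧ _ ∧ γ.1 < γ.1).2.2
    intro γ γ' heq
    rcases lt_trichotomy γ.1 γ'.1 with h | h | h
    · exact absurd heq (key _ _ h).ne
    · exact Subtype.ext h
    · exact absurd heq (key _ _ h).ne'
  refine lt_of_le_of_lt ((mk_le_mk_of_subset ?_).trans (mk_union_le _ _))
    (add_lt_of_lt hlam.aleph0_le h1 (h2.trans_lt hlam0))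
  rintro γ ⟨hγ, hcl⟩
  by_cases h : ∃ x ∈ (a : Set Ordinal.{u}), γ ≤ x
  · exact Or.inl ⟨hγ, h⟩
  · push Not at h
    exact Or.inr ⟨hγ, h, hcl⟩

theorem exists_spread {lam : Cardinal.{u + 1}} (hlam : lam.IsRegular) (hlam0 : ℵ₀ < lam)
    {H : Set Ordinal.{u}} (hc : #H = lam) (hinit : ∀ x ∈ H, #(H ∩ Iio x : Set Ordinal.{u}) < lam)
    (Bad : Set Ordinal.{u} → Ordinal.{u} → Prop)
    (hBad : ∀ X ⊆ H, #X < lam → #{γ | γ ∈ H ∧ Bad X γ} < lam) :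
    ∃ H' ⊆ H, #H' = lam ∧ ∀ γ ∈ H', ¬ Bad (H' ∩ Iio γ) γ ∧
      ∀ a : Finset Ordinal.{u}, (a : Set Ordinal.{u}) ⊆ H' ∩ Iio γ → ¬ Close H a γ := by
  obtain ⟨H', hH', hc', hthin⟩ := exists_thin hlam hc hinit
    (fun X γ => Bad X γ ∨ ∃ a : Finset Ordinal.{u}, (a : Set Ordinal.{u}) ⊆ X ∧ Close H a γ) (by
    intro X hX hXc
    have h2 : #(⋃ a ∈ ({a | (a : Set Ordinal.{u}) ⊆ X} : Set (Finset Ordinal.{u})),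
        {γ | γ ∈ H ∧ Close H a γ} : Set Ordinal.{u}) < lam :=
      (card_biUnion_lt_iff_forall_of_isRegular hlam (mk_finsets_lt hlam0 hXc)).2
        fun a ha => mk_close_lt hlam hlam0 hinit a (Subset.trans ha hX)
    refine lt_of_le_of_lt ((mk_le_mk_of_subset ?_).trans (mk_union_le _ _))
      (add_lt_of_lt hlam.aleph0_le (hBad X hX hXc) h2)
    rintro γ ⟨hγ, h | ⟨a, ha, h⟩⟩
    · exact Or.inl ⟨hγ, h⟩
    · exact Or.inr (mem_iUnion₂.2 ⟨a, ha, hγ, h⟩))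
  refine ⟨H', hH', hc', fun γ hγ => ⟨fun h => hthin γ hγ (Or.inl h), fun a ha h =>
    hthin γ hγ (Or.inr ⟨a, ha, h⟩)⟩⟩

theorem exists_finset_between {H : Set Ordinal.{u}} {a : Finset Ordinal.{u}} {γ : Ordinal.{u}}
    (h : ¬ Close H a γ) (m : ℕ) : ∃ e : Finset Ordinal.{u}, e.card = m ∧
      ∀ x ∈ e, x ∈ H ∧ (∀ y ∈ a, y < x) ∧ x < γ := by
  obtain ⟨e, he, hem⟩ := Set.Infinite.exists_subset_card_eq h m
  exact ⟨e, hem, fun x hx => he hx⟩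

/-- By `Captures.unique`, a capturing `γ` is determined by the position `i` and the point `x`, and
there are fewer than `lam` such pairs. -/
theorem mk_captures_lt {n : ℕ} {κ lam : Cardinal.{u + 1}} (hlam : lam.IsRegular)
    {H : Set Ordinal.{u}} (hc : #H = lam) (hinit : ∀ x ∈ H, #(H ∩ Iio x : Set Ordinal.{u}) < lam)
    (hlt : κ < lam) {v : Finset Ordinal.{u} → Set Ordinal.{u}} {ρ : Ordinal.{u + 1}}
    {r : Finset ℕ → Set Ordinal.{u + 1}} (hv : Good n H v ρ r)
    (hvκ : ∀ b ∈ nSubsets H n, #(v b) < κ) (a : Finset Ordinal.{u}) {u : Set Ordinal.{u}}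
    (hu : #u < κ) :
    #{γ | γ ∈ H ∧ ∃ x ∈ u, ∃ i, Captures n H v r a γ i x} < lam := by
  obtain ⟨b, hbH, hbn, -⟩ := exists_finset_above hlam hc hinit ∅ (by simp) n
  have hρ : ρ < κ.ord := hv.otp_eq b ⟨hbH, hbn⟩ ▸ otp_lt_ord (hvκ b ⟨hbH, hbn⟩)
  have hex : ∀ γ : {γ | γ ∈ H ∧ ∃ x ∈ u, ∃ i, Captures n H v r a γ i x},
      ∃ p : κ.ord.ToType × u, Captures n H v r a γ.1 (ordOf p.1) p.2.1 := by
    rintro ⟨γ, -, x, hx, i, hcap⟩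
    have hcap' := hcap
    obtain ⟨d, -, -, -, hcard, hi, -, -⟩ := hcap
    obtain ⟨t, rfl⟩ := exists_ordOf ((hv.sub _ (by simp; omega) hi : i < ρ).trans hρ)
    exact ⟨(t, ⟨x, hx⟩), hcap'⟩
  choose f hf using hex
  refine (mk_le_of_injective (f := f) fun γ γ' h => ?_).trans_lt
    (b := #(κ.ord.ToType × u)) ?_
  · have h1 := hf γ
    rw [h] at h1
    exact Subtype.ext (h1.unique hlam hc hinit hv (hf γ'))
  · rw [mk_prod]
    exact mul_lt_of_lt hlam.aleph0_le (by simpa using hlt) (by simpa using hu.trans hlt)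

/-- The inductive hypothesis is applied to `v b = U (insert δ b)`. A common point of `U (insert β
b)` and `U (insert β' b')` lies in `N` by closure, and reflection at `β'` puts it into `v b'`.
Reflection at `β` puts it into `v b` once it is known to lie in some `v b₀` with `b₀` below `β`; the
thinning of the index set guarantees this. -/
theorem refines_succ {n : ℕ} {κ lam σ : Cardinal.{u + 1}} (hκ : κ.IsRegular)
    (hlam : lam.IsRegular) (hlt : κ < lam) (hpow : PowClosed κ lam) (hσ : σ.IsRegular)
    (hlamσ : lam ≤ σ) (h : Refines n κ lam σ) :
    Refines (n + 1) κ lam (Order.succ (2 ^< σ)) := by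
  intro A hA Q g U hg hU
  obtain ⟨N, A', hA', δ, hδ, hcA', hltδ, hN, hrefl⟩ := exists_reflecting hκ.aleph0_le hσ
    (hlt.trans_le hlamσ) hA g U (hg.trans_le hlamσ) hU
  have hlam0 : ℵ₀ < lam := hκ.aleph0_le.trans_lt hlt
  have hins : ∀ b ∈ nSubsets A' n, insert δ b ∈ nSubsets A (n + 1) := fun b hb =>
    insert_mem_nSubsets hb hA' hδ hltδ
  have hvA : ∀ b ∈ nSubsets A' n, #(U (insert δ b)) < κ := fun b hb => hU _ (hins b hb)
  -- Besides `g`, the colour records which positions of `U (insert δ b)` are occupied by points of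
  -- `N`. Its constant value becomes the set `s`.
  obtain ⟨H₀, hH₀, hc₀, ⟨k, hk⟩, ρ, r, hgood₀⟩ := h A' hcA' (Q × Set κ.ord.ToType)
    (fun b => (g (insert δ b), {t | ∃ z ∈ N, IsNth (U (insert δ b)) (ordOf t) z}))
    (fun b => U (insert δ b)) (by
      refine mk_image_prod_lt hlam.aleph0_le ?_ ?_
      · refine (mk_le_mk_of_subset ?_).trans_lt hg
        rintro _ ⟨b, hb, rfl⟩
        exact mem_image_of_mem g (hins b hb)
      · refine mk_image_code_lt hκ.aleph0_le hlam hlt hpow (N := Set.univ) (by simpa using hlt) _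
          fun b hb => ⟨subset_univ _, ?_⟩
        refine (mk_le_mk_of_subset ?_).trans_lt (mk_ordOf_lt (otp_lt_ord (hvA b hb)))
        rintro t ⟨z, -, hz⟩
        exact hz.lt_otp) hvA
  obtain ⟨H₁, hH₁, hc₁, hinit⟩ := exists_subset_small_initial hc₀.ge
  set v : Finset Ordinal.{u} → Set Ordinal.{u} := fun b => U (insert δ b) with hvdef
  have hgood₁ : Good n H₁ v ρ r := hgood₀.mono hH₁
  have hH₁A' : H₁ ⊆ A' := hH₁.trans hH₀
  have hv₁ : ∀ b ∈ nSubsets H₁ n, #(v b) < κ := fun b hb => hvA b (nSubsets_mono hH₁A' n hb)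
  -- No `γ` in `H` captures a point of `U c` for an index set `c` below `γ`, and every gap of `H`
  -- contains infinitely many points of `H₁`.
  obtain ⟨H, hH, hc, hspread⟩ := exists_spread hlam hlam0 hc₁ hinit
    (fun X γ => ∃ a : Finset Ordinal.{u}, (a : Set Ordinal.{u}) ⊆ X ∧ ∃ c ∈ nSubsets X (n + 1),
      ∃ x ∈ U c, ∃ i, Captures n H₁ v r a γ i x) (by
    intro X hX hXc
    have h1 : #(⋃ a ∈ ({a | (a : Set Ordinal.{u}) ⊆ X} : Set (Finset Ordinal.{u})),
        ⋃ c ∈ nSubsets X (n + 1),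
        {γ | γ ∈ H₁ ∧ ∃ x ∈ U c, ∃ i, Captures n H₁ v r a γ i x} : Set Ordinal.{u}) < lam :=
      (card_biUnion_lt_iff_forall_of_isRegular hlam (mk_finsets_lt hlam0 hXc)).2
        fun a ha => (card_biUnion_lt_iff_forall_of_isRegular hlam (mk_nSubsets_lt hlam0 hXc _)).2
          fun c hc => mk_captures_lt hlam hc₁ hinit hlt hgood₁ hv₁ a
            (hU c (nSubsets_mono (hX.trans (hH₁A'.trans hA')) _ hc))
    refine (mk_le_mk_of_subset ?_).trans_lt h1
    rintro γ ⟨hγ, a, ha, c, hc, hcap⟩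
    exact mem_iUnion₂.2 ⟨a, ha, mem_iUnion₂.2 ⟨c, hc, hγ, hcap⟩⟩)
  have hHA' : H ⊆ A' := hH.trans hH₁A'
  have hbH : ∀ {β b}, b ∈ nSubsets (H ∩ Iio β) n → b ∈ nSubsets H₁ n := fun hb =>
    nSubsets_mono (inter_subset_left.trans hH) n hb
  have hbA : ∀ {β b}, b ∈ nSubsets (H ∩ Iio β) n → b ∈ nSubsets (A' ∩ Iio β) n := fun hb =>
    nSubsets_mono (inter_subset_inter_left _ hHA') n hb
  set s : Set Ordinal.{u + 1} := {i | ∃ t ∈ k.2, ordOf t = i} with hs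
  have hs' : ∀ b ∈ nSubsets H₁ n, ∀ i z, IsNth (v b) i z → (i ∈ s ↔ z ∈ N) := by
    intro b hb i z hz
    have hkb := congrArg Prod.snd (hk b (nSubsets_mono hH₁ n hb))
    dsimp only at hkb
    constructor
    · rintro ⟨t, ht, rfl⟩
      rw [← hkb] at ht
      obtain ⟨z', hz', hn⟩ := ht
      exact hz.unique hn ▸ hz'
    · intro hzN
      obtain ⟨t, rfl⟩ := exists_ordOf (hz.lt_otp.trans (otp_lt_ord (hv₁ b hb)))
      exact ⟨t, hkb ▸ ⟨z, hzN, hz⟩, rfl⟩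
  refine ⟨H, hHA'.trans hA', hc, ⟨k.1, fun c hcH => ?_⟩, ρ, _,
    (hgood₁.mono hH).succ (U := U) (s := s) ?_ ?_⟩
  · obtain ⟨β, hβ, b, hb, rfl⟩ := exists_top hcH
    rw [(hrefl β (hHA' hβ) b (hbA hb)).1]
    exact congrArg Prod.fst (hk b (nSubsets_mono hH₁ n (hbH hb)))
  · intro β hβ b hb b' hb'
    exact (hrefl β (hHA' hβ) b (hbA hb)).2.1 b' (hbA hb')
  · intro β hβ β' hβ' hββ b hb b' hb' hβb'
    have hb₂ : b ∈ nSubsets (H ∩ Iio β') n :=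
      nSubsets_mono (inter_subset_inter_right _ (Iio_subset_Iio hββ.le)) n hb
    have hcmem : insert β b ∈ nSubsets (H ∩ Iio β') (n + 1) :=
      insert_mem_nSubsets hb (inter_subset_inter_right _ (Iio_subset_Iio hββ.le)) ⟨hβ, hββ⟩
        fun x hx => hx.2
    have hcA : insert β b ∈ nSubsets (A' ∩ Iio β') (n + 1) :=
      nSubsets_mono (inter_subset_inter_left _ hHA') _ hcmem
    have htr : ∀ z ∈ N, ∀ b₀ ∈ nSubsets (A' ∩ Iio β) n, z ∈ v b₀ →
        ∀ i, IsNth (U (insert β b)) i z ↔ IsNth (v b) i z := fun z hzN b₀ hb₀ hz =>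
      (hrefl β (hHA' hβ) b (hbA hb)).2.2 z (Or.inr (Or.inl (mem_iUnion₂.2 ⟨b₀, hb₀, hz, hzN⟩)))
    have htr' : ∀ z ∈ U (insert β b), ∀ i,
        IsNth (U (insert β' b')) i z ↔ IsNth (v b') i z := fun z hz =>
      (hrefl β' (hHA' hβ') b' (hbA hb')).2.2 z (Or.inr (Or.inr (mem_iUnion₂.2 ⟨_, hcA, hz⟩)))
    have hUN : U (insert β b) ⊆ N := hN _ (nSubsets_mono inter_subset_left _ hcA)
    ext ⟨i, j⟩
    constructor
    · rintro ⟨z, hi, hj⟩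
      have hzN : z ∈ N := hUN hi.1
      have hj' : IsNth (v b') j z := (htr' z hi.1 j).1 hj
      -- `U (insert β b)` and `v b` are known to agree only on the trace below `β`, so `z` has to be
      -- found in a member of `v` indexed below `β`.
      suffices hex : ∃ b₀ ∈ nSubsets (A' ∩ Iio β) n, z ∈ v b₀ by
        obtain ⟨b₀, hb₀, hz⟩ := hex
        have hi' := (htr z hzN b₀ hb₀ hz i).1 hi
        exact ⟨⟨z, hi', hj'⟩, (hs' b (hbH hb) i z hi').2 hzN⟩
      have hjn : j ∈ r (Finset.range n) := by
        have := (hgood₁.mem_of_nth (hbH hb') (hbH hb') (finAligned_refl _) hj' hj').2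
        rwa [finRset_self, hb'.2] at this
      have hP : ∃ m, j ∈ r (Finset.range m) := ⟨n, hjn⟩
      classical
      -- `m` is the least number of initial elements of `b'` that determine the `j`-th point of `v
      -- b'`.
      obtain ⟨m, hm, hmin⟩ : ∃ m, j ∈ r (Finset.range m) ∧ ∀ l < m, j ∉ r (Finset.range l) :=
        ⟨Nat.find hP, Nat.find_spec hP, fun l hl => Nat.find_min hP hl⟩
      have hmn : m ≤ n := by
        by_contra! hcon
        exact hmin n hcon hjn
      set a := b'.filter (· < β) with ha
      have haH : (a : Set Ordinal.{u}) ⊆ H ∩ Iio β := fun x hx => by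
        obtain ⟨h1, h2⟩ := Finset.mem_filter.1 (Finset.mem_coe.1 hx)
        exact ⟨(hb'.1 h1).1, h2⟩
      have hacard : a.card ≤ n := hb'.2 ▸ Finset.card_le_card (Finset.filter_subset _ _)
      rcases le_or_gt m a.card with hma | hma
      -- The deciding elements of `b'` lie below `β`, so the rest of `b'` can be exchanged for
      -- points between `a` and `β` without moving `z`.
      · obtain ⟨e, hecard, he⟩ := exists_finset_between ((hspread β hβ).2 a haH) (n - a.card)
        set d := b'.filter (¬ · < β) with hd
        have hb'eq : a ∪ d = b' := Finset.filter_union_filter_not_eq _ _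
        have hdgt : ∀ x ∈ d, β < x := by
          intro x hx
          obtain ⟨h1, h2⟩ := Finset.mem_filter.1 hx
          exact lt_of_le_of_ne (not_lt.1 h2) fun h => hβb' (h ▸ h1)
        have had : ∀ x ∈ a, ∀ y ∈ d, x < y := fun x hx y hy => (haH hx).2.trans (hdgt y hy)
        have hae : ∀ x ∈ a, ∀ y ∈ e, x < y := fun x hx y hy => (he y hy).2.1 x hx
        have hdis : ∀ {e : Finset Ordinal.{u}}, (∀ x ∈ a, ∀ y ∈ e, x < y) →
            Disjoint a e := fun h =>
          Finset.disjoint_left.2 fun x hx hx' => lt_irrefl _ (h x hx x hx')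
        have hcd : d.card = e.card := by
          have h1 := Finset.card_union_of_disjoint (hdis had)
          rw [hb'eq, hb'.2] at h1
          omega
        obtain ⟨hal, hr⟩ := finAligned_union had hae (Finset.disjoint_left.2 fun x hx hx' =>
          lt_asymm (hdgt x hx) (he x hx').2.2) hcd
        rw [hb'eq] at hal hr
        have hsub : ((a ∪ e : Finset Ordinal.{u}) : Set Ordinal.{u}) ⊆ H₁ ∩ Iio β := by
          rw [Finset.coe_union]
          exact union_subset (haH.trans (inter_subset_inter_left _ hH))
            fun x hx => ⟨(he x hx).1, (he x hx).2.2⟩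
        have hcard : (a ∪ e).card = n := by
          rw [Finset.card_union_of_disjoint (hdis hae)]
          omega
        refine ⟨a ∪ e, ⟨hsub.trans (inter_subset_inter_left _ hH₁A'), hcard⟩, ?_⟩
        refine (hgood₁.nth (hbH hb') ⟨hsub.trans inter_subset_left, hcard⟩ hal hj' ?_).1
        rw [hr]
        exact hgood₁.mono_range hma hacard hm
      -- Otherwise `z` is decided at an element `γ > β` of `b'`. Then `γ` captures a point of `U
      -- (insert β b)`, whose index set lies below `γ`, against the choice of `H`.
      · exfalso
        obtain ⟨γ, hγ, hγpos⟩ := exists_pos (b := b') (i := m - 1) (by rw [hb'.2]; omega)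
        have hβγ : β < γ := by
          refine lt_of_le_of_ne ?_ fun h => hβb' (h ▸ hγ)
          by_contra! hcon
          have h1 := pos_lt_pos hγ hcon
          have h2 : pos b' β = a.card := rfl
          omega
        set a' := b'.filter (· < γ) with ha'
        have ha'card : a'.card = m - 1 := hγpos
        have hcover : insert γ a' ∪ b'.filter (γ < ·) = b' := by
          ext x
          simp only [ha', Finset.mem_union, Finset.mem_insert, Finset.mem_filter]
          constructor
          · rintro ((rfl | h) | h)
            · exact hγ
            · exact h.1
            · exact h.1
          · intro hx
            rcases lt_trichotomy x γ with h | h | h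
            · exact Or.inl (Or.inr ⟨hx, h⟩)
            · exact Or.inl (Or.inl h)
            · exact Or.inr ⟨hx, h⟩
        refine (hspread γ (hb'.1 hγ).1).1 ⟨a', fun x hx => ?_, insert β b, ?_, z, hi.1, j,
          b'.filter (γ < ·), ?_, ?_, ?_, ?_, ?_, ?_, ?_⟩
        · obtain ⟨h1, h2⟩ := Finset.mem_filter.1 (Finset.mem_coe.1 hx)
          exact ⟨(hb'.1 h1).1, h2⟩
        · exact insert_mem_nSubsets hb (inter_subset_inter_right _ (Iio_subset_Iio hβγ.le))
            ⟨hβ, hβγ⟩ fun x hx => hx.2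
        · rw [hcover]
          exact (hbH hb').1
        · exact fun y hy => (Finset.mem_filter.1 hy).2
        · exact fun y hy => (Finset.mem_filter.1 hy).2
        · have h1 : (insert γ a' ∪ b'.filter (γ < ·)).card = n := by rw [hcover, hb'.2]
          rw [Finset.card_union_of_disjoint, Finset.card_insert_of_notMem] at h1
          · exact h1
          · simp [ha']
          · refine Finset.disjoint_left.2 fun x hx hx' => ?_
            have h2 := (Finset.mem_filter.1 hx').2
            rcases Finset.mem_insert.1 hx with rfl | hx
            · exact lt_irrefl _ h2
            · exact lt_asymm h2 (Finset.mem_filter.1 hx).2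
        · rw [ha'card, Nat.sub_add_cancel (by omega)]
          exact hm
        · rw [ha'card]
          exact hmin _ (by omega)
        · rw [hcover]
          exact hj'
    · rintro ⟨⟨z, hi, hj⟩, his⟩
      have hzN := (hs' b (hbH hb) i z hi).1 his
      have hi' := (htr z hzN b (hbA hb) hi.1 i).2 hi
      exact ⟨z, hi', (htr' z hi'.1 j).2 hj⟩

/-! ### From the combinatorial form to uniform `Δ`-systems -/

theorem filter_range_rset {a b : Finset Ordinal.{u}} {n : ℕ} (ha : a.card = n)
    [DecidablePred fun i : ℕ => (i : Ordinal.{u + 1}) ∈ rset (a : Set Ordinal.{u}) b] :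
    (Finset.range n).filter (fun i : ℕ => (i : Ordinal.{u + 1}) ∈ rset (a : Set Ordinal.{u}) b) =
      finRset a b := by
  ext i
  simp only [Finset.mem_filter, Finset.mem_range, rset_finset, Nat.cast_inj]
  constructor
  · rintro ⟨-, k, hk, rfl⟩
    exact hk
  · intro h
    exact ⟨ha ▸ Finset.mem_range.1 (finRset_subset _ _ h), i, h, rfl⟩

theorem Good.isUniformDeltaSystem {n : ℕ} {H : Set Ordinal.{u}}
    {U : Finset Ordinal.{u} → Set Ordinal.{u}} {ρ : Ordinal.{u + 1}}
    {r : Finset ℕ → Set Ordinal.{u + 1}} (h : Good n H U ρ r) : IsUniformDeltaSystem n H U := by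
  classical
  refine ⟨ρ, fun m => r ((Finset.range n).filter fun i : ℕ => (i : Ordinal.{u + 1}) ∈ m),
    fun m _ => h.sub _ (Finset.filter_subset _ _), h.otp_eq, ?_, fun m₀ _ m₁ _ => ?_⟩
  · rintro a ha b hb m - hal rfl
    have hal' := aligned_finset.1 hal
    beta_reduce
    rw [filter_range_rset ha.2]
    refine ⟨⟨(h.otp_eq a ha).trans (h.otp_eq b hb).symm, fun γ hγ => ?_⟩, ?_⟩
    · exact (h.mem_of_nth ha hb hal' (isNth_of_mem hγ.1) (isNth_of_mem hγ.2)).1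
    · ext i
      constructor
      · rintro ⟨γ, hγb, hγ⟩
        exact (h.mem_of_nth ha hb hal' hγ (isNth_of_mem hγb)).2
      · intro hi
        have : (i, i) ∈ tpInt (U a) (U b) := by
          rw [h.tp a ha b hb hal']
          exact ⟨rfl, hi⟩
        obtain ⟨γ, hγ, hγ'⟩ := this
        exact ⟨γ, hγ'.1, hγ⟩
  · dsimp only
    rw [← h.inter _ (Finset.filter_subset _ _) _ (Finset.filter_subset _ _)]
    congr 1
    ext i
    simp only [Finset.mem_filter, Finset.mem_inter, mem_inter_iff]
    tauto

theorem sub_Ici_finset (a : Finset Ordinal.{u}) (γ : Ordinal.{u}) :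
    sub (a : Set Ordinal.{u}) (Ici (pos a γ : Ordinal.{u + 1})) =
      ((a.filter (γ ≤ ·) : Finset Ordinal.{u}) : Set Ordinal.{u}) := by
  ext x
  simp only [sub, mem_ofPred_eq, isNth_finset', Finset.coe_filter]
  constructor
  · rintro ⟨i, hi, hx, rfl⟩
    refine ⟨hx, ?_⟩
    by_contra! hlt
    exact absurd (pos_lt_pos hx hlt) (not_lt.2 (Nat.cast_le.1 (mem_Ici.1 hi)))
  · rintro ⟨hx, hle⟩
    exact ⟨_, mem_Ici.2 (Nat.cast_le.2 (pos_mono a hle)), hx, rfl⟩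

theorem pos_filter_add {a : Finset Ordinal.{u}} {γ x : Ordinal.{u}} (h : γ ≤ x) :
    pos a x = pos a γ + pos (a.filter (γ ≤ ·)) x := by
  unfold pos
  rw [← Finset.card_union_of_disjoint]
  · congr 1
    ext y
    simp only [Finset.mem_filter, Finset.mem_union]
    constructor
    · rintro ⟨hy, hlt⟩
      rcases lt_or_ge y γ with h' | h'
      · exact Or.inl ⟨hy, h'⟩
      · exact Or.inr ⟨⟨hy, h'⟩, hlt⟩
    · rintro (⟨hy, hlt⟩ | ⟨⟨hy, -⟩, hlt⟩)
      · exact ⟨hy, hlt.trans_le h⟩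
      · exact ⟨hy, hlt⟩
  · refine Finset.disjoint_left.2 fun y hy hy' => ?_
    simp only [Finset.mem_filter] at hy hy'
    exact absurd hy.2 (not_lt.2 hy'.1.2)

theorem possible_finset {a : Finset Ordinal.{u}} {m : ℕ} {γ α : Ordinal.{u}} (hγ : γ ∈ a)
    (hm : pos a γ = m) (h : Possible m (a : Set Ordinal.{u}) α) :
    ∀ x ∈ a, (x < γ → x < α) ∧ (γ < x → α < x) := by
  refine fun x hx => ⟨fun hlt => ?_, fun hlt => ?_⟩
  · have h1 := pos_lt_pos hx hlt
    obtain ⟨y, hy, hyp⟩ := exists_pos (b := a) (i := m - 1) (by have := pos_lt_card hγ; omega)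
    have h2 := h.1 (m - 1) y (by omega) (isNth_finset.2 ⟨hy, hyp⟩)
    refine lt_of_le_of_lt ?_ h2
    by_contra! h3
    have := pos_lt_pos hy h3
    omega
  · have h1 := pos_lt_pos hγ hlt
    obtain ⟨y, hy, hyp⟩ := exists_pos (b := a) (i := m + 1) (by have := pos_lt_card hx; omega)
    have h2 := h.2 y (isNth_finset.2 ⟨hy, hyp⟩)
    refine lt_of_lt_of_le h2 ?_
    by_contra! h3
    have := pos_lt_pos hx h3
    omega

theorem replaceNth_eq {a : Finset Ordinal.{u}} {m : ℕ} {γ α : Ordinal.{u}} (hγ : γ ∈ a)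
    (hm : pos a γ = m) : replaceNth a m α = insert α (a.erase γ) := by
  unfold replaceNth
  ext x
  simp only [Finset.mem_insert, Finset.mem_filter, Finset.mem_erase, isNth_finset]
  refine or_congr_right ⟨fun ⟨hx, hn⟩ => ⟨fun h => hn ?_, hx⟩, fun ⟨hne, hx⟩ => ⟨hx, fun h => ?_⟩⟩
  · subst h
    exact ⟨hx, hm⟩
  · exact hne (pos_inj hx hγ (h.2.trans hm.symm))

theorem Good.preservesIntersectionTypes {n : ℕ} {H : Set Ordinal.{u}}
    {U : Finset Ordinal.{u} → Set Ordinal.{u}} {ρ : Ordinal.{u + 1}}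
    {r : Finset ℕ → Set Ordinal.{u + 1}} (h : Good n H U ρ r) :
    PreservesIntersectionTypes n H U := by
  rintro a ha b hb m hm hal ⟨γ, hγ, hγ'⟩ α hα hp hp'
  rw [isNth_finset] at hγ hγ'
  obtain ⟨hγa, rfl⟩ := hγ
  obtain ⟨hγb, hpos⟩ := hγ'
  rw [replaceNth_eq hγa rfl, replaceNth_eq hγb hpos]
  refine h.move a ha b hb γ hγa hγb (fun x hx hx' hle => ?_) α hα (possible_finset hγa rfl hp)
    (possible_finset hγb hpos hp')
  unfold AlignedAbove at hal
  rw [sub_Ici_finset, ← hpos, sub_Ici_finset, aligned_finset] at hal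
  rw [pos_filter_add hle, pos_filter_add (a := b) hle, hpos,
    hal.2 x (Finset.mem_filter.2 ⟨hx, hle⟩) (Finset.mem_filter.2 ⟨hx', hle⟩)]

/-! ### The cardinals `σ(χ, n)` -/

theorem IsLTInaccessible.powClosed {κ χ : Cardinal.{v}} (h : IsLTInaccessible κ χ) :
    PowClosed κ χ := fun ν hν _ hc => (le_powerlt ν hc).trans_lt (h.2 ν hν)

theorem refines_sigma {κ lam : Cardinal.{u + 1}} (hκ : κ.IsRegular) (hlam : lam.IsRegular)
    (hlt : κ < lam) (hpow : PowClosed κ lam) (n : ℕ) :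
    (sigma lam (n + 1)).IsRegular ∧ lam ≤ sigma lam (n + 1) ∧
      Refines (n + 1) κ lam (sigma lam (n + 1)) := by
  induction n with
  | zero => exact ⟨hlam, le_rfl, refines_one hκ hlam hlt hpow⟩
  | succ n ih =>
    obtain ⟨h1, h2, h3⟩ := ih
    have hle : sigma lam (n + 1) ≤ 2 ^< sigma lam (n + 1) := le_powerlt_self le_rfl
    exact ⟨isRegular_succ (h1.aleph0_le.trans hle), (h2.trans hle).trans (Order.le_succ _),
      refines_succ hκ hlam hlt hpow h1 h2 h3⟩

theorem lift_powerlt_two (c : Cardinal.{u}) :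
    Cardinal.lift.{v} (2 ^< c) = 2 ^< Cardinal.lift.{v} c := by
  have h1 : 2 ^< Cardinal.lift.{v} c ≤ Cardinal.lift.{v} (2 ^< c) := by
    rw [powerlt_le]
    intro x hx
    obtain ⟨y, rfl⟩ := Cardinal.mem_range_lift_of_le hx.le
    have : (2 : Cardinal.{max u v}) ^ Cardinal.lift.{v} y = Cardinal.lift.{v} (2 ^ y) := by simp
    rw [this, Cardinal.lift_le]
    exact le_powerlt _ (Cardinal.lift_lt.1 hx)
  refine le_antisymm ?_ h1
  obtain ⟨w, hw⟩ := Cardinal.mem_range_lift_of_le h1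
  rw [← hw, Cardinal.lift_le, powerlt_le]
  intro x hx
  rw [← Cardinal.lift_le.{v}, hw]
  have : Cardinal.lift.{v} (2 ^ x) = (2 : Cardinal.{max u v}) ^ Cardinal.lift.{v} x := by simp
  rw [this]
  exact le_powerlt _ (Cardinal.lift_lt.2 hx)

theorem lift_sigma (χ : Cardinal.{u}) (n : ℕ) :
    Cardinal.lift.{v} (sigma χ (n + 1)) = sigma (Cardinal.lift.{v} χ) (n + 1) := by
  induction n with
  | zero => rfl
  | succ n ih =>
    change Cardinal.lift.{v} (Order.succ (2 ^< sigma χ (n + 1))) =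
      Order.succ (2 ^< sigma (Cardinal.lift.{v} χ) (n + 1))
    rw [Cardinal.lift_succ, lift_powerlt_two, ih]

theorem PowClosed.lift {κ lam : Cardinal.{u}} (h : PowClosed κ lam) :
    PowClosed (Cardinal.lift.{v} κ) (Cardinal.lift.{v} lam) := by
  intro ν hν c hc
  obtain ⟨ν, rfl⟩ := Cardinal.mem_range_lift_of_le hν.le
  obtain ⟨c, rfl⟩ := Cardinal.mem_range_lift_of_le hc.le
  rw [← Cardinal.lift_power, Cardinal.lift_lt]
  exact h ν (Cardinal.lift_lt.1 hν) c (Cardinal.lift_lt.1 hc)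

/-- The least `<κ`-inaccessible cardinal `≥ lam` is `lam` or a successor `(ν^{<κ})⁺`. -/
theorem isLeast_cases {κ lam lamStar : Cardinal.{u}} (hκ : κ.IsRegular) (hlt : κ < lam)
    (h : IsLeast {χ : Cardinal.{u} | lam ≤ χ ∧ IsLTInaccessible κ χ} lamStar) :
    lamStar = lam ∨ ∃ ν, 2 ≤ ν ∧ ν < lam ∧ lam ≤ ν ^< κ ∧ lamStar = Order.succ (ν ^< κ) := by
  by_cases hin : IsLTInaccessible κ lam
  · exact Or.inl (le_antisymm (h.2 ⟨le_rfl, hin⟩) h.1.1)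
  · right
    have : ∃ ν < lam, lam ≤ ν ^< κ := by
      by_contra! hcon
      exact hin ⟨hlt, hcon⟩
    obtain ⟨ν, hν, hle⟩ := this
    have h2 : 2 ≤ ν := by
      by_contra! hcon
      have h1 : ν ≤ 1 := by
        obtain ⟨k, rfl⟩ := lt_aleph0.1 (hcon.trans (natCast_lt_aleph0 (n := 2)))
        have : k < 2 := by exact_mod_cast hcon
        exact_mod_cast Nat.lt_succ_iff.1 this
      have h3 : ν ^< κ ≤ 1 := by
        rw [powerlt_le]
        exact fun x _ => (power_le_power_right h1).trans (one_power).le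
      exact absurd ((hκ.aleph0_le.trans hlt.le).trans (hle.trans h3)) (not_le.2 one_lt_aleph0)
    refine ⟨ν, h2, hν, hle, le_antisymm (h.2 ⟨hle.trans (Order.le_succ _), ?_, ?_⟩) ?_⟩
    · exact Order.lt_succ_of_le (hlt.le.trans hle)
    · intro τ hτ
      rw [Order.lt_succ_iff] at hτ ⊢
      rw [powerlt_le]
      exact fun c hc => (power_le_power_right hτ).trans (powerlt_pow_le hκ h2 hc)
    · exact Order.succ_le_of_lt (h.1.2.2 ν (hν.trans_le h.1.1))

/-- The induction runs at `lamStar`, one universe up, where sets of ordinals live; a subset of size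
`lam` is taken at the end, since goodness passes to subsets. -/
theorem uniformRefinement_of_sigma_le {n : ℕ} (hn : 1 ≤ n) {κ lam lamStar μ : Cardinal.{u}}
    (hκ : κ.IsRegular) (hlam : lam.IsRegular) (hlt : κ < lam)
    (h : IsLeast {χ : Cardinal.{u} | lam ≤ χ ∧ IsLTInaccessible κ χ} lamStar)
    (hμ : sigma lamStar n ≤ μ) : UniformRefinement n κ lam μ := by
  obtain ⟨n, rfl⟩ : ∃ k, n = k + 1 := ⟨n - 1, by omega⟩
  have hreg : lamStar.IsRegular := by
    rcases isLeast_cases hκ hlt h with rfl | ⟨ν, -, -, hle, rfl⟩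
    · exact hlam
    · exact isRegular_succ (hlam.aleph0_le.trans hle)
  intro ν hν g hg U hU
  obtain ⟨-, -, href⟩ := refines_sigma (IsRegular.lift.{u + 1} hκ) (IsRegular.lift.{u + 1} hreg)
    (Cardinal.lift_lt.2 h.1.2.1) h.1.2.powClosed.lift n
  have hcard : #(Iio μ.ord) = Cardinal.lift.{u + 1} μ := by
    rw [Cardinal.mk_Iio_ordinal, card_ord]
  obtain ⟨H₀, hH₀, hc₀, ⟨k, hk⟩, ρ, r, hgood⟩ := href (Iio μ.ord)
    (by rw [hcard, ← lift_sigma]; exact Cardinal.lift_le.2 hμ) Ordinal.{u} g U (by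
      have h1 : g '' nSubsets (Iio μ.ord) (n + 1) ⊆ Iio ν.ord := by
        rintro _ ⟨b, hb, rfl⟩
        exact hg b hb
      refine (mk_le_mk_of_subset h1).trans_lt ?_
      rw [Cardinal.mk_Iio_ordinal, card_ord]
      exact Cardinal.lift_lt.2 (hν.trans_le h.1.1)) hU
  obtain ⟨H, hH, hc⟩ := Cardinal.le_mk_iff_exists_subset.1
    (show Cardinal.lift.{u + 1} lam ≤ #H₀ by rw [hc₀]; exact Cardinal.lift_le.2 h.1.1)
  have hHμ : H ⊆ Iio μ.ord := hH.trans hH₀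
  have hinf : H.Infinite := by
    rw [← Set.infinite_coe_iff, Cardinal.infinite_iff, hc]
    simpa using hlam.aleph0_le
  -- An actual `(n + 1)`-subset is needed to see that the constant colour is below `ν`.
  obtain ⟨b, hb, hbn⟩ := hinf.exists_subset_card_eq (n + 1)
  refine ⟨H, ⟨hHμ, hc⟩, k, ?_, fun b hb => hk b (nSubsets_mono hH _ hb),
    (hgood.mono hH).isUniformDeltaSystem, (hgood.mono hH).preservesIntersectionTypes⟩
  rw [← hk b ⟨hb.trans hH, hbn⟩]
  exact hg b ⟨hb.trans hHμ, hbn⟩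

/-! ### From uniform `Δ`-systems to `Δ`-systems -/

theorem pos_le_of_finRset {b c b' c' : Finset Ordinal.{u}} (h : finRset b b' = finRset c c')
    (hmem : ∀ x, x ∈ b ∧ x ∈ b' ↔ x ∈ c ∧ x ∈ c') {γ : Ordinal.{u}} (hγ : γ ∈ b ∧ γ ∈ b')
    (ih : ∀ y < γ, y ∈ b ∧ y ∈ b' → pos b y = pos c y) : pos b γ ≤ pos c γ := by
  have h1 : pos c γ ∈ finRset b b' := by
    rw [h]
    exact mem_finRset.2 ⟨γ, ((hmem γ).1 hγ).1, ((hmem γ).1 hγ).2, rfl⟩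
  obtain ⟨y, hy, hy', heq⟩ := mem_finRset.1 h1
  rcases lt_or_ge y γ with hlt | hge
  · have h2 := ih y hlt ⟨hy, hy'⟩
    exact absurd (pos_lt_pos ((hmem y).1 ⟨hy, hy'⟩).1 hlt) (by omega)
  · exact heq ▸ pos_mono b hge

/-- Both pairs list the same common elements in increasing order along the same set of positions, so
each element receives the same position. -/
theorem pos_eq_of_finRset {b c b' c' : Finset Ordinal.{u}} (h : finRset b b' = finRset c c')
    (hmem : ∀ x, x ∈ b ∧ x ∈ b' ↔ x ∈ c ∧ x ∈ c') (γ : Ordinal.{u}) (hγ : γ ∈ b ∧ γ ∈ b') :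
    pos b γ = pos c γ := by
  induction γ using WellFoundedLT.induction with
  | ind γ ih =>
    refine le_antisymm (pos_le_of_finRset h hmem hγ ih) (pos_le_of_finRset h.symm
      (fun x => (hmem x).symm) ((hmem γ).1 hγ) fun y hy hy' => ?_)
    exact (ih y hy ((hmem y).2 hy')).symm

theorem pos_image {b : Finset Ordinal.{u}} {φ : Ordinal.{u} → Ordinal.{u}}
    (hφ : StrictMonoOn φ (b : Set Ordinal.{u})) {x : Ordinal.{u}} (hx : x ∈ b) :
    pos (b.image φ) (φ x) = pos b x := by
  unfold pos
  rw [← Finset.card_image_of_injOn (f := φ) (s := b.filter (· < x))]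
  · congr 1
    ext y
    simp only [Finset.mem_filter, Finset.mem_image]
    constructor
    · rintro ⟨⟨z, hz, rfl⟩, hlt⟩
      exact ⟨z, ⟨hz, (hφ.lt_iff_lt hz hx).1 hlt⟩, rfl⟩
    · rintro ⟨z, ⟨hz, hlt⟩, rfl⟩
      exact ⟨⟨z, hz, rfl⟩, hφ hz hx hlt⟩
  · exact hφ.injOn.mono fun y hy => (Finset.mem_filter.1 hy).1

theorem finRset_eq_of_rset {a b a' b' : Finset Ordinal.{u}}
    (h : rset (a : Set Ordinal.{u}) b = rset (a' : Set Ordinal.{u}) b') :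
    finRset a b = finRset a' b' := by
  have key : ∀ {a b a' b' : Finset Ordinal.{u}},
      rset (a : Set Ordinal.{u}) b = rset (a' : Set Ordinal.{u}) b' →
      finRset a b ⊆ finRset a' b' := by
    intro a b a' b' h i hi
    have h1 : (i : Ordinal.{u + 1}) ∈ rset (a' : Set Ordinal.{u}) b' :=
      h ▸ rset_finset.2 ⟨i, hi, rfl⟩
    obtain ⟨k, hk, hki⟩ := rset_finset.1 h1
    exact Nat.cast_inj.1 hki ▸ hk
  exact (key h).antisymm (key h.symm)

theorem rset_eq_of_finRset {a b a' b' : Finset Ordinal.{u}} (h : finRset a b = finRset a' b') :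
    rset (a : Set Ordinal.{u}) b = rset (a' : Set Ordinal.{u}) b' := by
  ext i
  rw [rset_finset, rset_finset, h]

theorem mem_inter_iff_of_rset {a b : Set Ordinal.{u}} {z : Ordinal.{u}} :
    z ∈ a ∩ b ↔ ∃ i ∈ rset a b, IsNth a i z := by
  constructor
  · rintro ⟨ha, hb⟩
    exact ⟨_, ⟨z, hb, isNth_of_mem ha⟩, isNth_of_mem ha⟩
  · rintro ⟨i, ⟨γ, hγ, hγi⟩, hz⟩
    exact ⟨hz.1, hz.unique hγi ▸ hγ⟩

/-- A set of fresh elements in the same relative positions as `b`, except on `b ∩ b'`. -/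
theorem exists_fresh {n : ℕ} {H H' : Set Ordinal.{u}} (hH' : H' ⊆ H)
    (hspread : ∀ γ ∈ H', ∀ a : Finset Ordinal.{u}, (a : Set Ordinal.{u}) ⊆ H' ∩ Iio γ →
      ¬ Close H a γ) {b b' c c' : Finset Ordinal.{u}} (hb : b ∈ nSubsets H' n)
    (hc : c ∈ nSubsets H' n) (h : finRset b b' = finRset c c')
    (hmem : ∀ x, x ∈ b ∧ x ∈ b' ↔ x ∈ c ∧ x ∈ c') :
    ∃ d ∈ nSubsets H n, FinAligned b d ∧ finRset b d = finRset b b' ∧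
      FinAligned c d ∧ finRset c d = finRset c c' := by
  classical
  set E : Finset Ordinal.{u} := b ∪ c with hE
  have hEH : ∀ x ∈ E, x ∈ H' := by
    intro x hx
    rcases Finset.mem_union.1 hx with h | h
    · exact hb.1 h
    · exact hc.1 h
  -- The gap below `x` supplies a new point of `H` between `x` and all smaller elements of `E`.
  have hw : ∀ x ∈ E, ∃ w ∈ H, (∀ y ∈ E, y < x → y < w) ∧ w < x := by
    intro x hx
    have h1 := hspread x (hEH x hx) (E.filter (· < x)) fun y hy => by
      obtain ⟨h1, h2⟩ := Finset.mem_filter.1 (Finset.mem_coe.1 hy)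
      exact ⟨hEH y h1, h2⟩
    obtain ⟨e, he, hlt⟩ := exists_finset_between h1 1
    obtain ⟨w, rfl⟩ := Finset.card_eq_one.1 he
    obtain ⟨h2, h3, h4⟩ := hlt w (Finset.mem_singleton_self w)
    exact ⟨w, h2, fun y hy hyx => h3 y (Finset.mem_filter.2 ⟨hy, hyx⟩), h4⟩
  choose! w hwH hwgt hwlt using hw
  -- Keep the common elements and move every other one slightly down into its gap. The order is
  -- preserved, and no moved point lands in `E`.
  set φ : Ordinal.{u} → Ordinal.{u} := fun x => if x ∈ b ∧ x ∈ b' then x else w x with hφ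
  have hφle : ∀ x ∈ E, φ x ≤ x := by
    intro x hx
    by_cases hx' : x ∈ b ∧ x ∈ b'
    · simp [hφ, hx']
    · simp only [hφ, if_neg hx']
      exact (hwlt x hx).le
  have hφgt : ∀ x ∈ E, ∀ y ∈ E, y < x → y < φ x := by
    intro x hx y hy hyx
    by_cases hx' : x ∈ b ∧ x ∈ b'
    · simpa [hφ, hx'] using hyx
    · simp only [hφ, if_neg hx']
      exact hwgt x hx y hy hyx
  have hφH : ∀ x ∈ E, φ x ∈ H := by
    intro x hx
    by_cases hx' : x ∈ b ∧ x ∈ b'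
    · simpa [hφ, hx'] using hH' (hEH x hx)
    · simp only [hφ, if_neg hx']
      exact hwH x hx
  have hφmono : StrictMonoOn φ (E : Set Ordinal.{u}) := fun x hx y hy hxy =>
    (hφle x hx).trans_lt (hφgt y hy x hx hxy)
  have hφE : ∀ x ∈ E, φ x ∈ E → φ x = x ∧ x ∈ b ∧ x ∈ b' := by
    intro x hx hx'
    have h1 : φ x = x := by
      by_contra hne
      exact lt_irrefl _ (hφgt x hx _ hx' (lt_of_le_of_ne (hφle x hx) hne))
    refine ⟨h1, ?_⟩
    by_contra h2
    simp only [hφ, if_neg h2] at h1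
    exact (hwlt x hx).ne h1
  have hφa : ∀ x, x ∈ b ∧ x ∈ b' → φ x = x := fun x hx => by simp [hφ, hx]
  have hbE : ∀ x ∈ b, x ∈ E := fun x hx => Finset.mem_union_left _ hx
  have hcE : ∀ x ∈ c, x ∈ E := fun x hx => Finset.mem_union_right _ hx
  have hφb : StrictMonoOn φ (b : Set Ordinal.{u}) := hφmono.mono fun x hx => hbE x hx
  have hmemd : ∀ x ∈ E, x ∈ b.image φ ↔ x ∈ b ∧ x ∈ b' := by
    intro x hx
    rw [Finset.mem_image]
    constructor
    · rintro ⟨y, hy, rfl⟩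
      obtain ⟨h1, h2⟩ := hφE y (hbE y hy) hx
      rwa [h1]
    · intro hx'
      exact ⟨x, hx'.1, hφa x hx'⟩
  have hposd : ∀ x, x ∈ b ∧ x ∈ b' → pos (b.image φ) x = pos b x := by
    intro x hx
    have := pos_image hφb hx.1
    rwa [hφa x hx] at this
  have hposc : ∀ x, x ∈ b ∧ x ∈ b' → pos b x = pos c x := pos_eq_of_finRset h hmem
  have hcard : (b.image φ).card = n := by
    rw [Finset.card_image_of_injOn hφb.injOn, hb.2]
  refine ⟨b.image φ, ⟨?_, hcard⟩, ⟨hb.2.trans hcard.symm, ?_⟩, ?_,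
    ⟨hc.2.trans hcard.symm, ?_⟩, ?_⟩
  · intro x hx
    obtain ⟨y, hy, rfl⟩ := Finset.mem_image.1 (Finset.mem_coe.1 hx)
    exact hφH y (hbE y hy)
  · intro x hx hx'
    exact (hposd x ((hmemd x (hbE x hx)).1 hx')).symm
  · ext i
    simp only [mem_finRset]
    refine exists_congr fun x => ?_
    constructor
    · rintro ⟨hx, hx', hi⟩
      exact ⟨hx, ((hmemd x (hbE x hx)).1 hx').2, hi⟩
    · rintro ⟨hx, hx', hi⟩
      exact ⟨hx, (hmemd x (hbE x hx)).2 ⟨hx, hx'⟩, hi⟩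
  · intro x hx hx'
    have := (hmemd x (hcE x hx)).1 hx'
    rw [hposd x this, hposc x this]
  · ext i
    simp only [mem_finRset]
    refine exists_congr fun x => ?_
    constructor
    · rintro ⟨hx, hx', hi⟩
      exact ⟨hx, ((hmem x).1 ((hmemd x (hcE x hx)).1 hx')).2, hi⟩
    · rintro ⟨hx, hx', hi⟩
      exact ⟨hx, (hmemd x (hcE x hx)).2 ((hmem x).2 ⟨hx, hx'⟩), hi⟩

/-- The root has to depend only on the pattern and on the common part. For pairs `b, b'` and `c, c'`
sharing both, a fresh `d` meets `b` and `c` in that common part with the same pattern. Each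
intersection consists of the points in the positions prescribed by the pattern, read in either
member, so it passes from `b, b'` to `b, d`, then to `c, d`, then to `c, c'`. -/
theorem IsUniformDeltaSystem.isDeltaSystem {n : ℕ} {H H' : Set Ordinal.{u}}
    {U : Finset Ordinal.{u} → Set Ordinal.{u}} (hU : IsUniformDeltaSystem n H U) (hH' : H' ⊆ H)
    (hspread : ∀ γ ∈ H', ∀ a : Finset Ordinal.{u}, (a : Set Ordinal.{u}) ⊆ H' ∩ Iio γ →
      ¬ Close H a γ) : IsDeltaSystem n H' U := by
  classical
  obtain ⟨ρ, r, -, -, hal, -⟩ := hU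
  have hint : ∀ a ∈ nSubsets H n, ∀ b ∈ nSubsets H n, FinAligned a b → ∀ z,
      z ∈ U a ∩ U b ↔ ∃ i ∈ r (rset (a : Set Ordinal.{u}) b), IsNth (U a) i z := by
    intro a ha b hb hab z
    rw [mem_inter_iff_of_rset, (hal a ha b hb _ ?_ (aligned_finset.2 hab) rfl).2]
    intro i hi
    obtain ⟨k, hk, rfl⟩ := rset_finset.1 hi
    have := Finset.mem_range.1 (finRset_subset _ _ hk)
    rw [ha.2] at this
    exact mem_Iio.2 (Nat.cast_lt.2 this)
  have main : ∀ b ∈ nSubsets H' n, ∀ b' ∈ nSubsets H' n, ∀ c ∈ nSubsets H' n,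
      ∀ c' ∈ nSubsets H' n, FinAligned b b' → FinAligned c c' →
      rset (b : Set Ordinal.{u}) b' = rset (c : Set Ordinal.{u}) c' →
      (∀ x, x ∈ b ∧ x ∈ b' ↔ x ∈ c ∧ x ∈ c') → U b ∩ U b' ⊆ U c ∩ U c' := by
    intro b hb b' hb' c hc c' hc' hbb hcc hr hmem z hz
    have hm : ∀ {b}, b ∈ nSubsets H' n → b ∈ nSubsets H n := fun h => nSubsets_mono hH' n h
    obtain ⟨d, hd, h1, h2, h3, h4⟩ :=
      exists_fresh hH' hspread hb hc (finRset_eq_of_rset hr) hmem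
    have e1 := rset_eq_of_finRset h2
    have e2 := rset_eq_of_finRset h4
    have e3 := rset_eq_of_finRset h1.finRset_comm
    have e4 := rset_eq_of_finRset h3.finRset_comm
    rw [hint b (hm hb) b' (hm hb') hbb, ← e1, ← hint b (hm hb) d hd h1, inter_comm,
      hint d hd b (hm hb) h1.symm, e3, e1, hr, ← e2, ← e4, ← hint d hd c (hm hc) h3.symm,
      inter_comm, hint c (hm hc) d hd h3, e2, ← hint c (hm hc) c' (hm hc') hcc] at hz
    exact hz
  refine ⟨fun m a => {z | ∃ b ∈ nSubsets H' n, ∃ b' ∈ nSubsets H' n, FinAligned b b' ∧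
    rset (b : Set Ordinal.{u}) b' = m ∧ b ∩ b' = a ∧ z ∈ U b ∩ U b'}, ?_⟩
  rintro m - b hb b' hb' hbb rfl
  ext z
  constructor
  · intro hz
    exact ⟨b, hb, b', hb', aligned_finset.1 hbb, rfl, rfl, hz⟩
  · rintro ⟨c, hc, c', hc', hcc, hr, hi, hz⟩
    refine main c hc c' hc' b hb b' hb' hcc (aligned_finset.1 hbb) hr (fun x => ?_) hz
    have := congrArg (x ∈ ·) hi
    simpa using this

theorem deltaRefinement_of_uniformRefinement {n : ℕ} {κ lam μ : Cardinal.{u}}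
    (hlam : lam.IsRegular) (hlam0 : ℵ₀ < lam) (h : UniformRefinement n κ lam μ) :
    DeltaRefinement n κ lam μ := by
  intro X U hU
  let e : X → Ordinal.{u} := Ordinal.typein (α := X) WellOrderingRel
  have he : Function.Injective e := Ordinal.typein_injective _
  obtain ⟨H, hH, k, -, -, hunif, -⟩ := h 1 (one_lt_aleph0.trans hlam0) (fun _ => 0)
    (fun _ _ => by simp) (fun b => e '' U b) (fun b hb => by
      have h1 : Cardinal.lift.{u} #(e '' U b) = Cardinal.lift.{u + 1} #(U b) :=
        mk_image_eq_of_injOn_lift _ _ he.injOn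
      have h2 : #(e '' U b) = Cardinal.lift.{u + 1} #(U b) := by
        rwa [Cardinal.lift_id'.{u, u + 1}] at h1
      rw [h2]
      exact Cardinal.lift_lt.2 (hU b hb))
  have hreg := IsRegular.lift.{u + 1} hlam
  obtain ⟨H₁, hH₁, hc₁, hinit⟩ := exists_subset_small_initial hH.2.ge
  -- Only infinite gaps are wanted here, so no point is declared bad.
  obtain ⟨H₂, hH₂, hc₂, hspread⟩ := exists_spread hreg (by simpa using hlam0) hc₁ hinit
    (fun _ _ => False) (fun X _ _ => by simpa using hreg.pos)
  refine ⟨H₂, ⟨hH₂.trans (hH₁.trans hH.1), hc₂⟩, ?_⟩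
  have hds : IsDeltaSystem n H₂ fun b => e '' U b :=
    hunif.isDeltaSystem (hH₂.trans hH₁) fun γ hγ a ha hcl =>
      (hspread γ hγ).2 a ha (Set.Finite.subset hcl fun x hx => ⟨hH₁ hx.1, hx.2⟩)
  obtain ⟨R, hR⟩ := hds
  refine ⟨fun m a => e ⁻¹' R m a, fun m hm b hb b' hb' hal hr => ?_⟩
  have h1 := hR m hm b hb b' hb' hal hr
  beta_reduce at h1 ⊢
  rw [← h1, preimage_inter, preimage_image_eq _ he,
    preimage_image_eq _ he]

/-! ### Splitting points -/

/-- The least ordinal at which `s` and `t` differ. -/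
def split (s t : Set Ordinal.{u}) : Ordinal.{u} := sInf {x | ¬(x ∈ s ↔ x ∈ t)}

theorem split_spec {s t : Set Ordinal.{u}} (h : s ≠ t) : ¬(split s t ∈ s ↔ split s t ∈ t) := by
  have hne : {x | ¬(x ∈ s ↔ x ∈ t)}.Nonempty := by
    by_contra hcon
    rw [Set.not_nonempty_iff_eq_empty] at hcon
    refine h (Set.ext fun x => ?_)
    by_contra hx
    have : x ∈ {x | ¬(x ∈ s ↔ x ∈ t)} := hx
    rw [hcon] at this
    exact this
  exact csInf_mem hne

theorem iff_of_lt_split {s t : Set Ordinal.{u}} {x : Ordinal.{u}} (h : x < split s t) :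
    x ∈ s ↔ x ∈ t := by
  by_contra hx
  exact notMem_of_lt_csInf' h hx

theorem split_le {s t : Set Ordinal.{u}} {x : Ordinal.{u}} (h : ¬(x ∈ s ↔ x ∈ t)) :
    split s t ≤ x := csInf_le' h

theorem split_compl (s t : Set Ordinal.{u}) : split sᶜ tᶜ = split s t := by
  unfold split
  congr 1
  ext x
  simp only [mem_ofPred_eq, mem_compl_iff, not_iff_not]

/-- For each `α`, let `t α` minimize the splitting point with `α`. A later `β` splitting from `α`
strictly higher would lack the point that `f (t α)` has, so `f (t α)` and `f β` would split
downwards. Hence the splitting point is constant from `t α` on, and thinning makes every later index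
exceed `t α`. If `e` failed to increase from `α` to `β`, later sets could not split upwards from `f
β` at `e β`. -/
theorem exists_comb_of_up {lam : Cardinal.{u + 1}} (hlam : lam.IsRegular) {H : Set Ordinal.{u}}
    (hc : #H = lam) (hinit : ∀ x ∈ H, #(H ∩ Iio x : Set Ordinal.{u}) < lam)
    {f : Ordinal.{u} → Set Ordinal.{u}} (hf : InjOn f H)
    (hup : ∀ α ∈ H, ∀ β ∈ H, α < β → split (f α) (f β) ∈ f β) :
    ∃ H' ⊆ H, #H' = lam ∧ ∃ e : Ordinal.{u} → Ordinal.{u}, StrictMonoOn e H' ∧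
      ∀ α ∈ H', ∀ β ∈ H', α < β → split (f α) (f β) = e α := by
  have hbit : ∀ α ∈ H, ∀ β ∈ H, α < β → split (f α) (f β) ∉ f α := by
    intro α hα β hβ hαβ h
    exact split_spec (hf.ne hα hβ hαβ.ne) ⟨fun _ => hup α hα β hβ hαβ, fun _ => h⟩
  have hmin : ∀ α ∈ H, ∃ β ∈ H, α < β ∧ ∀ β' ∈ H, α < β' →
      split (f α) (f β) ≤ split (f α) (f β') := by
    intro α hα
    obtain ⟨β₀, hβ₀, hαβ₀⟩ := exists_above hlam (X := {α})
      (by simpa using one_lt_aleph0.trans_le hlam.aleph0_le) (by simpa using hα) hc.ge hinit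
    obtain ⟨β, hβ, hle⟩ := WellFounded.has_min
      (InvImage.wf (fun β => split (f α) (f β)) (wellFounded_lt (α := Ordinal.{u})))
      {β | β ∈ H ∧ α < β} ⟨β₀, hβ₀, hαβ₀ α rfl⟩
    exact ⟨β, hβ.1, hβ.2, fun β' h1 h2 => not_lt.1 (hle β' ⟨h1, h2⟩)⟩
  choose! t htH hlt htmin using hmin
  have hconst : ∀ α ∈ H, ∀ β ∈ H, t α ≤ β → split (f α) (f β) = split (f α) (f (t α)) := by
    intro α hα β hβ hle
    rcases hle.eq_or_lt with rfl | hlt'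
    · rfl
    refine le_antisymm ?_ (htmin α hα β hβ ((hlt α hα).trans hlt'))
    by_contra! hcon
    set ε := split (f α) (f (t α)) with hε
    have h1 : ε ∈ f (t α) := hup α hα _ (htH α hα) (hlt α hα)
    have h2 : ε ∉ f α := hbit α hα _ (htH α hα) (hlt α hα)
    have h3 : ε ∉ f β := fun h => h2 ((iff_of_lt_split hcon).2 h)
    have h4 : split (f (t α)) (f β) = ε := by
      refine le_antisymm (split_le fun h => h3 (h.1 h1)) ?_
      by_contra! h5
      refine split_spec (hf.ne (htH α hα) hβ hlt'.ne) ?_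
      rw [← iff_of_lt_split (s := f α) (t := f (t α)) h5, iff_of_lt_split (h5.trans hcon)]
    exact h3 (h4 ▸ hup _ (htH α hα) β hβ hlt')
  obtain ⟨H', hH', hc', hthin⟩ := exists_thin hlam hc hinit (fun X γ => ∃ x ∈ t '' X, γ ≤ x)
    fun X hX hXc => mk_lower_lt hlam (mk_image_le.trans_lt hXc)
      (by rintro _ ⟨x, hx, rfl⟩; exact htH x (hX hx)) hinit
  have hsplit : ∀ α ∈ H', ∀ β ∈ H', α < β → split (f α) (f β) = split (f α) (f (t α)) := by
    intro α hα β hβ hαβ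
    refine hconst α (hH' hα) β (hH' hβ) ?_
    by_contra! hcon
    exact hthin β hβ ⟨t α, mem_image_of_mem t ⟨hα, hαβ⟩, hcon.le⟩
  refine ⟨H', hH', hc', fun α => split (f α) (f (t α)), fun α hα β hβ hαβ => ?_, hsplit⟩
  obtain ⟨γ, hγ, hβγ⟩ := exists_above hlam (X := {β})
    (by simpa using one_lt_aleph0.trans_le hlam.aleph0_le) (by simpa using hβ) hc'.ge
    fun x hx => (mk_le_mk_of_subset (inter_subset_inter_left _ hH')).trans_lt (hinit x (hH' hx))
  have hβγ : β < γ := hβγ β rfl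
  dsimp only
  rw [← hsplit α hα β hβ hαβ, ← hsplit β hβ γ hγ hβγ]
  have heq : split (f α) (f β) = split (f α) (f γ) := by
    rw [hsplit α hα β hβ hαβ, hsplit α hα γ hγ (hαβ.trans hβγ)]
  by_contra! hle
  rcases hle.eq_or_lt with h | h
  · have h1 := hbit β (hH' hβ) γ (hH' hγ) hβγ
    rw [h] at h1
    exact h1 (hup α (hH' hα) β (hH' hβ) hαβ)
  · refine split_spec (hf.ne (hH' hβ) (hH' hγ) hβγ.ne) ?_
    rw [← iff_of_lt_split (s := f α) (t := f β) h, iff_of_lt_split (heq ▸ h)]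

/-- Taking complements keeps the splitting points and reverses the direction of every split. -/
theorem exists_comb {lam : Cardinal.{u + 1}} (hlam : lam.IsRegular) {H : Set Ordinal.{u}}
    (hc : #H = lam) (hinit : ∀ x ∈ H, #(H ∩ Iio x : Set Ordinal.{u}) < lam)
    {f : Ordinal.{u} → Set Ordinal.{u}} (hf : InjOn f H) {q : Prop}
    (hup : ∀ α ∈ H, ∀ β ∈ H, α < β → (split (f α) (f β) ∈ f β ↔ q)) :
    ∃ H' ⊆ H, #H' = lam ∧ ∃ e : Ordinal.{u} → Ordinal.{u}, StrictMonoOn e H' ∧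
      ∀ α ∈ H', ∀ β ∈ H', α < β → split (f α) (f β) = e α := by
  by_cases hq : q
  · exact exists_comb_of_up hlam hc hinit hf fun α hα β hβ h => (hup α hα β hβ h).2 hq
  · have h1 := exists_comb_of_up hlam hc hinit (f := fun α => (f α)ᶜ)
      (fun α hα β hβ h => hf hα hβ (compl_injective h)) fun α hα β hβ h => by
        rw [split_compl]
        exact fun h' => hq ((hup α hα β hβ h).1 h')
    simpa only [split_compl] using h1

theorem split_mem_union {s t : Set Ordinal.{u}} (h : s ≠ t) : split s t ∈ s ∪ t := by
  by_contra hcon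
  rw [mem_union, not_or] at hcon
  exact split_spec h ⟨fun h => absurd h hcon.1, fun h => absurd h hcon.2⟩

/-! ### `Δ`-systems and colourings -/

theorem IsDeltaSystem.mono {X : Type v} {n : ℕ} {H H' : Set Ordinal.{u}}
    {U : Finset Ordinal.{u} → Set X} (h : IsDeltaSystem n H U) (hH : H' ⊆ H) :
    IsDeltaSystem n H' U := by
  obtain ⟨R, hR⟩ := h
  exact ⟨R, fun m hm b hb b' hb' =>
    hR m hm b (nSubsets_mono hH n hb) b' (nSubsets_mono hH n hb')⟩

theorem exists_mem_nSubsets_disjoint {H : Set Ordinal.{u}} (hH : H.Infinite) (n : ℕ)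
    (F : Finset Ordinal.{u}) : ∃ b ∈ nSubsets H n, Disjoint b F := by
  obtain ⟨b, hb, hbn⟩ := (hH.sdiff F.finite_toSet).exists_subset_card_eq n
  exact ⟨b, ⟨fun x hx => (hb hx).1, hbn⟩, Finset.disjoint_left.2 fun x hx hx' => (hb hx).2 hx'⟩

theorem IsDeltaSystem.exists_root {X : Type v} {n : ℕ} {H : Set Ordinal.{u}}
    {U : Finset Ordinal.{u} → Set X} (h : IsDeltaSystem n H U) :
    ∃ y, ∀ b ∈ nSubsets H n, ∀ b' ∈ nSubsets H n, Disjoint b b' → U b ∩ U b' = y := by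
  obtain ⟨R, hR⟩ := h
  refine ⟨R ∅ ∅, fun b hb b' hb' hd => ?_⟩
  have h1 := hR ∅ (empty_subset _) b hb b' hb'
    (aligned_finset.2 ⟨hb.2.trans hb'.2.symm, fun x hx hx' =>
      absurd hx' (Finset.disjoint_left.1 hd hx)⟩) ?_
  · rw [h1]
    congr 1
    ext x
    simp only [Finset.mem_inter, Finset.notMem_empty, iff_false, not_and]
    exact fun hx hx' => Finset.disjoint_left.1 hd hx hx'
  · rw [Set.eq_empty_iff_forall_notMem]
    intro i hi
    obtain ⟨k, hk, -⟩ := rset_finset.1 hi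
    obtain ⟨x, hx, hx', -⟩ := mem_finRset.1 hk
    exact Finset.disjoint_left.1 hd hx hx'

/-- A colouring with finitely many colours that is coded in a `Δ`-system is constant. -/
theorem IsDeltaSystem.exists_color {X : Type v} {n : ℕ} {H : Set Ordinal.{u}}
    {U : Finset Ordinal.{u} → Set X} (h : IsDeltaSystem n H U) (hH : H.Infinite) {Q : Type v}
    [Finite Q] (c : Finset Ordinal.{u} → Q) (code : Q → X)
    (hcode : ∀ b ∈ nSubsets H n, ∀ q, code q ∈ U b ↔ q = c b) :
    ∃ q, ∀ b ∈ nSubsets H n, c b = q := by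
  classical
  obtain ⟨y, hdis⟩ := h.exists_root
  -- Some colour occurs off every finite set. Two disjoint index sets with this colour put its code
  -- into the common root, hence into every member.
  have hfreq : ∃ q, ∀ F : Finset Ordinal.{u}, ∃ b ∈ nSubsets H n, Disjoint b F ∧ c b = q := by
    by_contra! hcon
    choose F hF using hcon
    have := Fintype.ofFinite Q
    obtain ⟨b, hb, hd⟩ := exists_mem_nSubsets_disjoint hH n (Finset.univ.biUnion F)
    exact hF (c b) b hb (hd.mono_right (Finset.subset_biUnion_of_mem F (Finset.mem_univ _))) rfl
  obtain ⟨q, hq⟩ := hfreq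
  obtain ⟨b₁, hb₁, -, hc₁⟩ := hq ∅
  obtain ⟨b₂, hb₂, hd, hc₂⟩ := hq b₁
  have hroot : code q ∈ y := by
    rw [← hdis b₂ hb₂ b₁ hb₁ hd]
    exact ⟨(hcode b₂ hb₂ q).2 hc₂.symm, (hcode b₁ hb₁ q).2 hc₁.symm⟩
  refine ⟨q, fun b hb => ?_⟩
  obtain ⟨b', hb', hd'⟩ := exists_mem_nSubsets_disjoint hH n b
  rw [← hdis b' hb' b hb hd'] at hroot
  exact ((hcode b hb q).1 hroot.2).symm

theorem infinite_of_mem_subsetsOfCard {μ lam : Cardinal.{u}} (hlam : ℵ₀ ≤ lam)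
    {H : Set Ordinal.{u}} (hH : H ∈ subsetsOfCard μ lam) : H.Infinite := by
  rw [← Set.infinite_coe_iff, Cardinal.infinite_iff, hH.2]
  simpa using hlam

/-! ### Stepping up -/

theorem exists_injOn_sets {μ μ' : Cardinal.{u}} (hμ : μ ≤ 2 ^ μ') :
    ∃ f : Ordinal.{u} → Set Ordinal.{u}, InjOn f (Iio μ.ord) ∧ ∀ α, f α ⊆ Iio μ'.ord := by
  have hle : #(Iio μ.ord) ≤ #(𝒫 (Iio μ'.ord)) := by
    rw [mk_powerset, Cardinal.mk_Iio_ordinal, Cardinal.mk_Iio_ordinal, card_ord, card_ord]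
    have : (2 : Cardinal.{u + 1}) ^ Cardinal.lift.{u + 1} μ' = Cardinal.lift.{u + 1} (2 ^ μ') := by
      simp
    rw [this]
    exact Cardinal.lift_le.2 hμ
  obtain ⟨j⟩ := hle
  classical
  refine ⟨fun α => if h : α ∈ Iio μ.ord then (j ⟨α, h⟩).1 else ∅, ?_, ?_⟩
  · intro α hα β hβ h
    dsimp only at h
    rw [dif_pos hα, dif_pos hβ] at h
    exact congrArg Subtype.val (j.injective (Subtype.ext h))
  · intro α
    dsimp only
    split_ifs with h
    · exact (j ⟨α, h⟩).2
    · exact empty_subset _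

open Classical in
/-- The set of splitting points of the sets indexed by `b`. -/
def splits (f : Ordinal.{u} → Set Ordinal.{u}) (b : Finset Ordinal.{u}) : Finset Ordinal.{u} :=
  ((b ×ˢ b).filter fun p => p.1 < p.2).image fun p => split (f p.1) (f p.2)

theorem mem_splits {f : Ordinal.{u} → Set Ordinal.{u}} {b : Finset Ordinal.{u}} {x : Ordinal.{u}} :
    x ∈ splits f b ↔ ∃ α ∈ b, ∃ β ∈ b, α < β ∧ split (f α) (f β) = x := by
  simp only [splits, Finset.mem_image, Finset.mem_filter, Finset.mem_product, Prod.exists]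
  constructor
  · rintro ⟨α, β, ⟨⟨hα, hβ⟩, hlt⟩, h⟩
    exact ⟨α, hα, β, hβ, hlt, h⟩
  · rintro ⟨α, hα, β, hβ, hlt, h⟩
    exact ⟨α, β, ⟨⟨hα, hβ⟩, hlt⟩, h⟩

/-- The first two elements of `b` index sets in increasing lexicographic order. -/
def FirstUp (f : Ordinal.{u} → Set Ordinal.{u}) (b : Finset Ordinal.{u}) : Prop :=
  ∃ α ∈ b, ∃ β ∈ b, α < β ∧ (∀ x ∈ b, x ≠ α → β ≤ x) ∧ split (f α) (f β) ∈ f β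

theorem firstUp_iff {f : Ordinal.{u} → Set Ordinal.{u}} {e : Finset Ordinal.{u}}
    {α β : Ordinal.{u}} (hαβ : α < β) (he : ∀ x ∈ e, β < x) :
    FirstUp f (insert α (insert β e)) ↔ split (f α) (f β) ∈ f β := by
  have hβm : β ∈ insert α (insert β e) := by simp
  have hαm : α ∈ insert α (insert β e) := by simp
  have hmin : ∀ x ∈ insert α (insert β e), x ≠ α → β ≤ x := by
    intro x hx hne
    rcases Finset.mem_insert.1 hx with rfl | hx
    · exact absurd rfl hne
    · rcases Finset.mem_insert.1 hx with rfl | hx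
      · exact le_rfl
      · exact (he x hx).le
  constructor
  · rintro ⟨α', hα', β', hβ', hlt, hall, hs⟩
    have h1 : α' = α := by
      by_contra hne
      have h2 := hmin α' hα' hne
      have h3 := hall α hαm (Ne.symm hne)
      exact absurd (hαβ.trans_le h2) (not_lt.2 (hlt.le.trans h3))
    subst h1
    have h2 : β' = β := le_antisymm (hall β hβm hαβ.ne') (hmin β' hβ' hlt.ne')
    exact h2 ▸ hs
  · intro h
    exact ⟨α, hαm, β, hβm, hαβ, hmin, h⟩

theorem finRset_insert_top {b b' : Finset Ordinal.{u}} {t t' : Ordinal.{u}}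
    (hb : ∀ x ∈ b, x < t ∧ x < t') (hb' : ∀ x ∈ b', x < t ∧ x < t') (htt : t ≠ t')
    (hal : FinAligned b b') : FinAligned (insert t b) (insert t' b') ∧
      finRset (insert t b) (insert t' b') = finRset b b' := by
  have htb : ∀ {c : Finset Ordinal.{u}} {s : Ordinal.{u}}, (∀ x ∈ c, x < s) → s ∉ c :=
    fun h h' => lt_irrefl _ (h _ h')
  have hcommon : ∀ x, x ∈ insert t b ∧ x ∈ insert t' b' ↔ x ∈ b ∧ x ∈ b' := by
    intro x
    simp only [Finset.mem_insert]
    constructor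
    · rintro ⟨rfl | h, rfl | h'⟩
      · exact absurd rfl htt
      · exact absurd h' (htb fun y hy => (hb' y hy).1)
      · exact absurd h (htb fun y hy => (hb y hy).2)
      · exact ⟨h, h'⟩
    · rintro ⟨h, h'⟩
      exact ⟨Or.inr h, Or.inr h'⟩
  refine ⟨⟨?_, fun x hx hx' => ?_⟩, ?_⟩
  · rw [Finset.card_insert_of_notMem (htb fun y hy => (hb y hy).1),
      Finset.card_insert_of_notMem (htb fun y hy => (hb' y hy).2), hal.1]
  · obtain ⟨h1, h2⟩ := (hcommon x).1 ⟨hx, hx'⟩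
    rw [pos_insert_of_le (hb x h1).1.le, pos_insert_of_le (hb' x h2).2.le]
    exact hal.2 x h1 h2
  · ext i
    simp only [mem_finRset, ← and_assoc, hcommon]
    refine exists_congr fun x => and_congr_right fun h => ?_
    rw [pos_insert_of_le (hb x h.1).1.le]

theorem finAligned_image {b b' : Finset Ordinal.{u}} {D : Set Ordinal.{u}}
    {φ : Ordinal.{u} → Ordinal.{u}} (hφ : StrictMonoOn φ D) (hb : (b : Set Ordinal.{u}) ⊆ D)
    (hb' : (b' : Set Ordinal.{u}) ⊆ D) (hal : FinAligned b b') :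
    FinAligned (b.image φ) (b'.image φ) ∧
      finRset (b.image φ) (b'.image φ) = finRset b b' ∧
      b.image φ ∩ b'.image φ = (b ∩ b').image φ := by
  have hmem : ∀ {b : Finset Ordinal.{u}}, (b : Set Ordinal.{u}) ⊆ D → ∀ x ∈ D,
      φ x ∈ b.image φ ↔ x ∈ b := by
    intro b hb x hx
    rw [Finset.mem_image]
    constructor
    · rintro ⟨y, hy, h⟩
      exact hφ.injOn (hb hy) hx h ▸ hy
    · exact fun h => ⟨x, h, rfl⟩
  refine ⟨⟨?_, fun y hy hy' => ?_⟩, ?_, ?_⟩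
  · rw [Finset.card_image_of_injOn (hφ.injOn.mono hb), Finset.card_image_of_injOn
      (hφ.injOn.mono hb'), hal.1]
  · obtain ⟨x, hx, rfl⟩ := Finset.mem_image.1 hy
    have hx' := (hmem hb' x (hb hx)).1 hy'
    rw [pos_image (hφ.mono hb) hx, pos_image (hφ.mono hb') hx', hal.2 x hx hx']
  · ext i
    simp only [mem_finRset]
    constructor
    · rintro ⟨y, hy, hy', rfl⟩
      obtain ⟨x, hx, rfl⟩ := Finset.mem_image.1 hy
      exact ⟨x, hx, (hmem hb' x (hb hx)).1 hy', (pos_image (hφ.mono hb) hx).symm⟩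
    · rintro ⟨x, hx, hx', rfl⟩
      exact ⟨φ x, Finset.mem_image_of_mem φ hx, Finset.mem_image_of_mem φ hx',
        pos_image (hφ.mono hb) hx⟩
  · ext y
    simp only [Finset.mem_inter]
    constructor
    · rintro ⟨hy, hy'⟩
      obtain ⟨x, hx, rfl⟩ := Finset.mem_image.1 hy
      exact Finset.mem_image_of_mem φ (Finset.mem_inter.2 ⟨hx, (hmem hb' x (hb hx)).1 hy'⟩)
    · intro hy
      obtain ⟨x, hx, rfl⟩ := Finset.mem_image.1 hy
      exact ⟨Finset.mem_image_of_mem φ (Finset.mem_inter.1 hx).1,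
        Finset.mem_image_of_mem φ (Finset.mem_inter.1 hx).2⟩

theorem splits_insert_top {f : Ordinal.{u} → Set Ordinal.{u}} {H : Set Ordinal.{u}}
    {e : Ordinal.{u} → Ordinal.{u}} (he : ∀ α ∈ H, ∀ β ∈ H, α < β → split (f α) (f β) = e α)
    {b : Finset Ordinal.{u}} {t : Ordinal.{u}} (hb : (b : Set Ordinal.{u}) ⊆ H) (ht : t ∈ H)
    (hbt : ∀ x ∈ b, x < t) : splits f (insert t b) = b.image e := by
  have hsub : ∀ x ∈ insert t b, x ∈ H := by
    intro x hx
    rcases Finset.mem_insert.1 hx with rfl | hx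
    · exact ht
    · exact hb hx
  ext y
  rw [mem_splits, Finset.mem_image]
  constructor
  · rintro ⟨α, hα, β, hβ, hlt, rfl⟩
    refine ⟨α, ?_, (he α (hsub α hα) β (hsub β hβ) hlt).symm⟩
    rcases Finset.mem_insert.1 hα with rfl | h
    · rcases Finset.mem_insert.1 hβ with rfl | h'
      · exact absurd hlt (lt_irrefl _)
      · exact absurd hlt (lt_asymm (hbt β h'))
    · exact h
  · rintro ⟨x, hx, rfl⟩
    exact ⟨x, Finset.mem_insert_of_mem hx, t, Finset.mem_insert_self _ _, hbt x hx,
      he x (hb hx) t ht (hbt x hx)⟩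

/-- Index `μ` injectively by subsets of `μ'` and evaluate `V` at the splitting points of an `(n +
1)`-set, coding also the direction of its first split. A Δ-system then has constant direction, so it
contains a comb with teeth `e`. On the comb the splitting points of an index set are the `e`-values
of all its elements but the top, so `V` on the teeth inherits the roots. -/
theorem deltaRefinement_of_succ {n : ℕ} (hn : 1 ≤ n) {κ lam μ μ' : Cardinal.{u}} (hκ : ℵ₀ ≤ κ)
    (hlam : lam.IsRegular) (hμ : μ ≤ 2 ^ μ') (h : DeltaRefinement (n + 1) κ lam μ) :
    DeltaRefinement n κ lam μ' := by
  classical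
  intro X V hV
  obtain ⟨f, hfinj, hfsub⟩ := exists_injOn_sets hμ
  let U : Finset Ordinal.{u} → Set (X ⊕ ULift.{u} Prop) := fun b =>
    {p | (∃ x, p = Sum.inl x ∧ splits f b ∈ nSubsets (Iio μ'.ord) n ∧ x ∈ V (splits f b)) ∨
      p = Sum.inr ⟨FirstUp f b⟩}
  have hUκ : ∀ b, #(U b) < κ := by
    intro b
    have h1 : U b ⊆ {p | ∃ x, p = Sum.inl x ∧ splits f b ∈ nSubsets (Iio μ'.ord) n ∧
        x ∈ V (splits f b)} ∪ {Sum.inr ⟨FirstUp f b⟩} := fun p hp => hp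
    refine (mk_le_mk_of_subset h1).trans_lt ((mk_union_le _ _).trans_lt
      (add_lt_of_lt hκ ?_ (by simpa using one_lt_aleph0.trans_le hκ)))
    by_cases hs : splits f b ∈ nSubsets (Iio μ'.ord) n
    · refine (mk_le_mk_of_subset (t := Sum.inl '' V (splits f b)) ?_).trans_lt
        (mk_image_le.trans_lt (hV _ hs))
      rintro _ ⟨x, rfl, -, hx⟩
      exact mem_image_of_mem _ hx
    · refine (mk_le_mk_of_subset (t := ∅) ?_).trans_lt (by simpa using aleph0_pos.trans_le hκ)
      rintro _ ⟨x, -, hx, -⟩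
      exact absurd hx hs
  obtain ⟨H, hH, hΔ⟩ := h _ U fun b _ => hUκ b
  obtain ⟨q, hq⟩ := hΔ.exists_color (infinite_of_mem_subsetsOfCard hlam.aleph0_le hH)
    (fun b => ULift.up.{u} (FirstUp f b)) Sum.inr fun b _ q => by simp [U]
  have hreg := IsRegular.lift.{u + 1} hlam
  obtain ⟨H₀, hH₀, hc₀, hinit⟩ := exists_subset_small_initial hH.2.ge
  have hfinj₀ : InjOn f H₀ := hfinj.mono (hH₀.trans hH.1)
  have hup : ∀ α ∈ H₀, ∀ β ∈ H₀, α < β → (split (f α) (f β) ∈ f β ↔ q.down) := by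
    intro α hα β hβ hαβ
    -- Any pair can be completed from above to an `(n + 1)`-set whose first two elements it forms,
    -- so the constant colour fixes the direction of every split.
    obtain ⟨e, heH, hec, habove⟩ := exists_finset_above hreg hc₀ hinit {β} (by simpa using hβ)
      (n - 1)
    have hβe : ∀ x ∈ e, β < x := fun x hx => habove β (Finset.mem_singleton_self β) x hx
    rw [← firstUp_iff hαβ hβe, ← hq (insert α (insert β e)) ⟨?_, ?_⟩]
    · rw [Finset.coe_insert, Finset.coe_insert]
      exact insert_subset (hH₀ hα) (insert_subset (hH₀ hβ) (heH.trans hH₀))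
    · rw [Finset.card_insert_of_notMem, Finset.card_insert_of_notMem, hec]
      · omega
      · exact fun h => lt_irrefl _ (hβe β h)
      · intro h
        rcases Finset.mem_insert.1 h with rfl | h
        · exact lt_irrefl _ hαβ
        · exact lt_asymm hαβ (hβe α h)
  obtain ⟨H', hH', hc', e, hemono, he⟩ := exists_comb hreg hc₀ hinit hfinj₀ hup
  have hinit' : ∀ x ∈ H', #(H' ∩ Iio x : Set Ordinal.{u}) < Cardinal.lift.{u + 1} lam :=
    fun x hx => (mk_le_mk_of_subset (inter_subset_inter_left _ hH')).trans_lt (hinit x (hH' hx))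
  obtain ⟨R, hR⟩ := hΔ.mono (hH'.trans hH₀)
  have heμ : e '' H' ⊆ Iio μ'.ord := by
    rintro _ ⟨α, hα, rfl⟩
    obtain ⟨β, hβ, hαβ⟩ := exists_above hreg (X := {α})
      (by simpa using one_lt_aleph0.trans_le hlam.aleph0_le) (by simpa using hα) hc'.ge hinit'
    rw [← he α hα β hβ (hαβ α rfl)]
    exact union_subset (hfsub _) (hfsub _)
      (split_mem_union (hfinj₀.ne (hH' hα) (hH' hβ) (hαβ α rfl).ne))
  refine ⟨e '' H', ⟨heμ, (mk_image_eq_of_injOn _ _ hemono.injOn).trans hc'⟩, ?_⟩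
  set φ := Function.invFunOn e H' with hφdef
  have hφH : ∀ y ∈ e '' H', φ y ∈ H' := fun y hy => Function.invFunOn_mem hy
  have heφ : ∀ y ∈ e '' H', e (φ y) = y := fun y hy => Function.invFunOn_eq hy
  have hφmono : StrictMonoOn φ (e '' H') := by
    intro y hy y' hy' hlt
    rw [← heφ y hy, ← heφ y' hy'] at hlt
    exact (hemono.lt_iff_lt (hφH y hy) (hφH y' hy')).1 hlt
  have hlift : ∀ b ∈ nSubsets (e '' H') n, b.image φ ∈ nSubsets H' n ∧ (b.image φ).image e = b := by
    intro b hb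
    refine ⟨⟨?_, ?_⟩, ?_⟩
    · intro x hx
      obtain ⟨y, hy, rfl⟩ := Finset.mem_image.1 (Finset.mem_coe.1 hx)
      exact hφH y (hb.1 hy)
    · rw [Finset.card_image_of_injOn (hφmono.injOn.mono hb.1), hb.2]
    · rw [Finset.image_image]
      ext y
      rw [Finset.mem_image]
      constructor
      · rintro ⟨z, hz, rfl⟩
        rw [Function.comp_apply, heφ z (hb.1 hz)]
        exact hz
      · exact fun hy => ⟨y, hy, heφ y (hb.1 hy)⟩
  refine ⟨fun m a => Sum.inl ⁻¹' R m (a.image φ), ?_⟩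
  rintro m hm b hb b' hb' hbb rfl
  obtain ⟨h1, h2, h3⟩ := finAligned_image hφmono hb.1 hb'.1 (aligned_finset.1 hbb)
  obtain ⟨hbH, hbe⟩ := hlift b hb
  obtain ⟨hbH', hbe'⟩ := hlift b' hb'
  -- Two distinct tops leave the common part and its positions unchanged, and they do not affect the
  -- splitting points.
  obtain ⟨E, hEH, hEc, habove⟩ := exists_finset_above hreg hc' hinit' (b.image φ ∪ b'.image φ)
    (by rw [Finset.coe_union]; exact union_subset hbH.1 hbH'.1) 2
  obtain ⟨t, t', htt, rfl⟩ := Finset.card_eq_two.1 hEc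
  have hlt : ∀ x ∈ b.image φ, x < t ∧ x < t' := fun x hx =>
    ⟨habove x (Finset.mem_union_left _ hx) t (by simp),
      habove x (Finset.mem_union_left _ hx) t' (by simp)⟩
  have hlt' : ∀ x ∈ b'.image φ, x < t ∧ x < t' := fun x hx =>
    ⟨habove x (Finset.mem_union_right _ hx) t (by simp),
      habove x (Finset.mem_union_right _ hx) t' (by simp)⟩
  have ht : t ∈ H' := hEH (by simp)
  have ht' : t' ∈ H' := hEH (by simp)
  obtain ⟨h4, h5⟩ := finRset_insert_top hlt hlt' htt h1
  have hUV : ∀ {c : Finset Ordinal.{u}} {s : Ordinal.{u}}, c ∈ nSubsets (e '' H') n → s ∈ H' →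
      (∀ x ∈ c.image φ, x < s) → ∀ x, Sum.inl x ∈ U (insert s (c.image φ)) ↔ x ∈ V c := by
    intro c s hc hs hlt x
    obtain ⟨hcH, hce⟩ := hlift c hc
    have hsp : splits f (insert s (c.image φ)) = c := by
      rw [splits_insert_top he hcH.1 hs hlt, hce]
    have hmem : c ∈ nSubsets (Iio μ'.ord) n := nSubsets_mono heμ n hc
    simp only [U, mem_ofPred_eq, hsp]
    constructor
    · rintro (⟨y, hy, -, hyV⟩ | hcon)
      · exact Sum.inl.inj hy ▸ hyV
      · cases hcon
    · exact fun hx => Or.inl ⟨x, rfl, hmem, hx⟩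
  have hins : ∀ {c : Finset Ordinal.{u}} {s : Ordinal.{u}}, c ∈ nSubsets H' n → s ∈ H' →
      (∀ x ∈ c, x < s) → insert s c ∈ nSubsets H' (n + 1) := by
    intro c s hc hs hlt
    refine ⟨?_, ?_⟩
    · rw [Finset.coe_insert]
      exact insert_subset hs hc.1
    · rw [Finset.card_insert_of_notMem fun h => lt_irrefl _ (hlt s h), hc.2]
  have hroot := hR (rset (b : Set Ordinal.{u}) b')
    (hm.trans (Iio_subset_Iio (Nat.cast_le.2 (Nat.le_succ n))))
    _ (hins hbH ht fun x hx => (hlt x hx).1) _ (hins hbH' ht' fun x hx => (hlt' x hx).2)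
    (aligned_finset.2 h4) (rset_eq_of_finRset (h5.trans h2))
  have hinter : insert t (b.image φ) ∩ insert t' (b'.image φ) = (b ∩ b').image φ := by
    rw [← h3]
    ext x
    simp only [Finset.mem_inter, Finset.mem_insert]
    constructor
    · rintro ⟨rfl | h, rfl | h'⟩
      · exact absurd rfl htt
      · exact absurd (hlt' x h').1 (lt_irrefl _)
      · exact absurd (hlt x h).2 (lt_irrefl _)
      · exact ⟨h, h'⟩
    · rintro ⟨h, h'⟩
      exact ⟨Or.inr h, Or.inr h'⟩
  rw [hinter] at hroot
  ext x
  rw [mem_preimage, ← hroot, mem_inter_iff, mem_inter_iff,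
    hUV hb ht (fun x hx => (hlt x hx).1), hUV hb' ht' fun x hx => (hlt' x hx).2]

/-! ### Families without large `Δ`-subsystems -/

/-- Partial functions from proper initial segments of a well-order. -/
theorem exists_branches {κ ν μ : Cardinal.{u}} (hμ : μ ≤ ν ^< κ) :
    ∃ F : Ordinal.{u} → κ.ord.ToType → Option ν.out, InjOn F (Iio μ.ord) ∧
      ∀ α ∈ Iio μ.ord, ∃ i, ∀ z, F α z ≠ none ↔ z < i := by
  classical
  let P : Set (κ.ord.ToType → Option ν.out) := {F | ∃ i, ∀ z, F z ≠ none ↔ z < i}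
  have hP : ν ^< κ ≤ #P := by
    rw [powerlt_le]
    intro x hx
    obtain ⟨i, hi⟩ := exists_toType_bound hx
    have h1 : ν ^ x = #(Iio i → ν.out) := by simp [hi]
    rw [h1]
    refine mk_le_of_injective
      (f := fun g => (⟨fun z => if h : z < i then some (g ⟨z, h⟩) else none, i, fun z => ?_⟩ : P)) ?_
    · by_cases h : z < i <;> simp [h]
    · intro g g' h
      ext ⟨z, hz⟩
      have h2 := congrFun (congrArg Subtype.val h) z
      have hz : z < i := hz
      simpa [hz] using h2
  have hle : Cardinal.lift.{u} #(Iio μ.ord) ≤ Cardinal.lift.{u + 1} #P := by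
    rw [Cardinal.mk_Iio_ordinal, card_ord, Cardinal.lift_id'.{u, u + 1}]
    exact Cardinal.lift_le.2 (hμ.trans hP)
  obtain ⟨j⟩ := Cardinal.lift_mk_le'.1 hle
  refine ⟨fun α => if h : α ∈ Iio μ.ord then (j ⟨α, h⟩).1 else fun _ => none, ?_, ?_⟩
  · intro α hα β hβ h
    dsimp only at h
    rw [dif_pos hα, dif_pos hβ] at h
    exact congrArg Subtype.val (j.injective (Subtype.ext h))
  · intro α hα
    simp only [dif_pos hα]
    exact (j ⟨α, hα⟩).2

/-- Each index is a sequence of length `< κ` over `ν`, and its set consists of the nodes along it.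
In a Δ-system all sequences agree below the first level missing from the root. At that level they
must be pairwise different, which allows at most `ν + 1` of them, counting the sequences that have
ended. -/
theorem not_deltaRefinement_one {κ lam ν μ : Cardinal.{u}} (hlam : ℵ₀ ≤ lam) (hν : ν < lam)
    (hμ : μ ≤ ν ^< κ) : ¬ DeltaRefinement 1 κ lam μ := by
  classical
  intro h
  obtain ⟨F, hF, hdom⟩ := exists_branches hμ
  let K := κ.ord.ToType
  -- A node retains its level, so equality of nodes gives agreement up to and including that level.
  let node : K → (K → Option ν.out) → K × (K → Option ν.out) :=
    fun x f => (x, fun z => if z ≤ x then f z else none)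
  have hnode : ∀ {x x' f f'}, node x f = node x' f' → x = x' ∧ ∀ z ≤ x, f z = f' z := by
    intro x x' f f' h
    obtain ⟨h1, h2⟩ := Prod.mk.inj h
    refine ⟨h1, fun z hz => ?_⟩
    have := congrFun h2 z
    simpa [hz, h1 ▸ hz] using this
  have hnode' : ∀ {x f f'}, (∀ z ≤ x, f z = f' z) → node x f = node x f' := by
    intro x f f' h
    refine Prod.ext rfl (funext fun z => ?_)
    by_cases hz : z ≤ x
    · simp [node, hz, h z hz]
    · simp [node, hz]
  let T : Ordinal.{u} → Set (K × (K → Option ν.out)) := fun α => {p | ∃ x, F α x ≠ none ∧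
    p = node x (F α)}
  obtain ⟨H, hH, hΔ⟩ := h _ (fun b => ⋃ α ∈ b, T α) (by
    rintro b ⟨hb, hb1⟩
    obtain ⟨α, rfl⟩ := Finset.card_eq_one.1 hb1
    obtain ⟨i, hi⟩ := hdom α (hb (by simp))
    have h1 : (⋃ β ∈ ({α} : Finset Ordinal.{u}), T β) ⊆ (fun x => node x (F α)) '' Iio i := by
      intro p hp
      obtain ⟨β, hβ, x, hx, rfl⟩ := mem_iUnion₂.1 hp
      obtain rfl := Finset.mem_singleton.1 hβ
      exact ⟨x, (hi x).1 hx, rfl⟩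
    exact (mk_le_mk_of_subset h1).trans_lt (mk_image_le.trans_lt (mk_Iio_toType_lt i)))
  obtain ⟨y, hy⟩ := hΔ.exists_root
  have hroot : ∀ α ∈ H, ∀ β ∈ H, α ≠ β → T α ∩ T β = y := by
    intro α hα β hβ hne
    have := hy {α} ⟨by simpa using hα, by simp⟩ {β} ⟨by simpa using hβ, by simp⟩ (by simpa using hne)
    simpa using this
  have hinf := infinite_of_mem_subsetsOfCard hlam hH
  have hyT : ∀ α ∈ H, y ⊆ T α := by
    intro α hα
    obtain ⟨β, hβ, hne⟩ := hinf.exists_notMem_finset {α}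
    rw [← hroot α hα β hβ (by simpa [eq_comm] using hne)]
    exact inter_subset_left
  obtain ⟨α₀, hα₀⟩ := hinf.nonempty
  obtain ⟨i₀, hi₀⟩ := hdom α₀ (hH.1 hα₀)
  -- Such a level exists: the root lies in the set of `α₀`, which has no node at the level `i₀` of
  -- its length.
  obtain ⟨x, hx, hxmin⟩ := WellFounded.has_min (wellFounded_lt (α := K))
    {x | ∀ p ∈ y, p.1 ≠ x} ⟨i₀, by
      rintro p hp rfl
      obtain ⟨x, hx, hpx⟩ := hyT α₀ hα₀ hp
      have : p.1 = x := congrArg Prod.fst hpx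
      exact lt_irrefl _ ((hi₀ _).1 (this ▸ hx))⟩
  have hbelow : ∀ α ∈ H, ∀ β ∈ H, ∀ z < x, F α z = F β z := by
    intro α hα β hβ z hz
    have h1 : ¬ ∀ p ∈ y, p.1 ≠ z := fun h => hxmin z h hz
    push Not at h1
    obtain ⟨p, hp, rfl⟩ := h1
    obtain ⟨x₁, -, h2⟩ := hyT α hα hp
    obtain ⟨x₂, -, h3⟩ := hyT β hβ hp
    have h4 := hnode (h2.symm.trans h3)
    have h5 : p.1 = x₁ := congrArg Prod.fst h2
    exact h4.2 _ h5.le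
  have hinj : Function.Injective fun α : H => F α.1 x := by
    intro α β heq
    by_contra hne
    have hne' : α.1 ≠ β.1 := fun h => hne (Subtype.ext h)
    have heq : F α.1 x = F β.1 x := heq
    have hle : ∀ z ≤ x, F α.1 z = F β.1 z := by
      intro z hz
      rcases hz.eq_or_lt with rfl | hz
      · exact heq
      · exact hbelow _ α.2 _ β.2 z hz
    by_cases hnone : F α.1 x = none
    · refine hne' (hF (hH.1 α.2) (hH.1 β.2) (funext fun z => ?_))
      rcases le_or_gt z x with hz | hz
      · exact hle z hz
      · have key : ∀ γ ∈ H, F γ x = none → F γ z = none := by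
          intro γ hγ hγx
          obtain ⟨i, hi⟩ := hdom γ (hH.1 hγ)
          by_contra hcon
          exact (hi x).2 (hz.trans ((hi z).1 hcon)) hγx
        rw [key _ α.2 hnone, key _ β.2 (heq ▸ hnone)]
    · have hmem : node x (F α.1) ∈ y := by
        rw [← hroot _ α.2 _ β.2 hne']
        exact ⟨⟨x, hnone, rfl⟩, x, heq ▸ hnone, hnode' hle⟩
      exact hx _ hmem rfl
  have hcard := Cardinal.lift_mk_le_lift_mk_of_injective hinj
  rw [hH.2, Cardinal.lift_id'.{u, u + 1}, Cardinal.lift_le, mk_option, mk_out] at hcard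
  exact absurd hcard (not_le.2 (add_lt_of_lt hlam hν (one_lt_aleph0.trans_le hlam)))

/-- Binary sequences of length `< lam`: `lvl` is the length, and `f` is the set of places carrying
the digit one. -/
theorem exists_levels {lam μ : Cardinal.{u}} (hμ : μ ≤ 2 ^< lam) :
    ∃ (lvl : Ordinal.{u} → Ordinal.{u}) (f : Ordinal.{u} → Set Ordinal.{u}),
      InjOn (fun α => (lvl α, f α)) (Iio μ.ord) ∧
      ∀ α ∈ Iio μ.ord, lvl α < lam.ord ∧ f α ⊆ Iio (lvl α) := by
  classical
  let T : Set (Ordinal.{u} × Set Ordinal.{u}) := {p | p.1 < lam.ord ∧ p.2 ⊆ Iio p.1}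
  have hT : Cardinal.lift.{u + 1} (2 ^< lam) ≤ #T := by
    rw [lift_powerlt_two, powerlt_le]
    intro c hc
    obtain ⟨c, rfl⟩ := Cardinal.mem_range_lift_of_le hc.le
    have h1 : (2 : Cardinal.{u + 1}) ^ Cardinal.lift.{u + 1} c = #(𝒫 (Iio c.ord)) := by
      rw [mk_powerset, Cardinal.mk_Iio_ordinal, card_ord]
    rw [h1]
    refine mk_le_of_injective (f := fun s =>
      (⟨(c.ord, s.1), ord_lt_ord.2 (Cardinal.lift_lt.1 hc), s.2⟩ : T)) fun s t h => ?_
    exact Subtype.ext (Prod.mk.inj (congrArg Subtype.val h)).2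
  have hle : #(Iio μ.ord) ≤ #T := by
    rw [Cardinal.mk_Iio_ordinal, card_ord]
    exact (Cardinal.lift_le.2 hμ).trans hT
  obtain ⟨j⟩ := hle
  let F : Ordinal.{u} → Ordinal.{u} × Set Ordinal.{u} :=
    fun α => if h : α ∈ Iio μ.ord then (j ⟨α, h⟩).1 else (0, ∅)
  have hF : ∀ α (h : α ∈ Iio μ.ord), F α = (j ⟨α, h⟩).1 := fun α h => dif_pos h
  refine ⟨fun α => (F α).1, fun α => (F α).2, ?_, ?_⟩
  · intro α hα β hβ h
    have h : F α = F β := h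
    rw [hF α hα, hF β hβ] at h
    exact congrArg Subtype.val (j.injective (Subtype.ext h))
  · intro α hα
    beta_reduce
    rw [hF α hα]
    exact (j ⟨α, hα⟩).2

/-- Each pair is sent to the singleton of its colour, which records whether the levels agree, the
direction of splitting, and the value of the bad colouring `c₀` on the levels. A Δ-system makes all
three constant, and either value of the first leads to a contradiction. -/
theorem not_deltaRefinement_two {κ lam μ : Cardinal.{u}} (hκ : ℵ₀ ≤ κ) (hlam : lam.IsRegular)
    (harrow : ¬ Arrow lam lam 2 2) (hμ : μ ≤ 2 ^< lam) : ¬ DeltaRefinement 2 κ lam μ := by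
  classical
  intro h
  unfold Arrow at harrow
  push Not at harrow
  obtain ⟨c₀, hc₀, hbad⟩ := harrow
  obtain ⟨lvl, f, hinj, hlvl⟩ := exists_levels hμ
  let c : Finset Ordinal.{u} → ULift.{u} (Prop × Prop × Prop) := fun b =>
    ⟨∀ x ∈ b, ∀ y ∈ b, lvl x = lvl y, FirstUp f b, c₀ (b.image lvl) = 0⟩
  obtain ⟨H, hH, hΔ⟩ := h _ (fun b => {c b}) fun b _ => by
    simpa using one_lt_aleph0.trans_le hκ
  obtain ⟨q, hq⟩ := hΔ.exists_color (infinite_of_mem_subsetsOfCard hlam.aleph0_le hH) c id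
    fun b _ q => by simp
  have hreg := IsRegular.lift.{u + 1} hlam
  have hpair : ∀ {α β}, α ∈ H → β ∈ H → α ≠ β → c {α, β} = q := by
    intro α β hα hβ hne
    refine hq _ ⟨?_, Finset.card_pair hne⟩
    rw [Finset.coe_pair]
    exact insert_subset hα (singleton_subset_iff.2 hβ)
  by_cases hq1 : q.down.1
  -- With all levels equal, a comb would have `lam` many teeth below a single ordinal smaller than
  -- `lam.ord`.
  · obtain ⟨H₀, hH₀, hcard₀, hinit⟩ := exists_subset_small_initial hH.2.ge
    have hsame : ∀ α ∈ H₀, ∀ β ∈ H₀, lvl α = lvl β := by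
      intro α hα β hβ
      by_cases hne : α = β
      · rw [hne]
      · have h1 := hpair (hH₀ hα) (hH₀ hβ) hne
        rw [← h1] at hq1
        exact hq1 α (by simp) β (by simp)
    have hfinj : InjOn f H₀ := fun α hα β hβ hαβ =>
      hinj (hH.1 (hH₀ hα)) (hH.1 (hH₀ hβ)) (Prod.ext (hsame α hα β hβ) hαβ)
    have hup : ∀ α ∈ H₀, ∀ β ∈ H₀, α < β → (split (f α) (f β) ∈ f β ↔ q.down.2.1) := by
      intro α hα β hβ hαβ
      have h1 := firstUp_iff (f := f) hαβ (e := ∅) (by simp)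
      have h2 := hpair (hH₀ hα) (hH₀ hβ) hαβ.ne
      rw [← h1, ← h2]
      rfl
    obtain ⟨H', hH', hcard', e, hemono, he⟩ := exists_comb hreg hcard₀ hinit hfinj hup
    have hinit' : ∀ x ∈ H', #(H' ∩ Iio x : Set Ordinal.{u}) < Cardinal.lift.{u + 1} lam :=
      fun x hx => (mk_le_mk_of_subset (inter_subset_inter_left _ hH')).trans_lt (hinit x (hH' hx))
    have hne : H'.Nonempty := by
      rw [← Set.nonempty_coe_sort, ← mk_ne_zero_iff, hcard']
      exact hreg.ne_zero
    obtain ⟨α₀, hα₀⟩ := hne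
    have hα₀μ := hlvl α₀ (hH.1 (hH₀ (hH' hα₀)))
    have hmaps : e '' H' ⊆ Iio (lvl α₀) := by
      rintro _ ⟨α, hα, rfl⟩
      obtain ⟨β, hβ, hαβ⟩ := exists_above hreg (X := {α})
        (by simpa using one_lt_aleph0.trans_le hlam.aleph0_le) (by simpa using hα) hcard'.ge hinit'
      have hfs : ∀ γ ∈ H', f γ ⊆ Iio (lvl α₀) := fun γ hγ => by
        rw [hsame α₀ (hH' hα₀) γ (hH' hγ)]
        exact (hlvl γ (hH.1 (hH₀ (hH' hγ)))).2
      rw [← he α hα β hβ (hαβ α rfl)]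
      exact union_subset (hfs α hα) (hfs β hβ)
        (split_mem_union (hfinj.ne (hH' hα) (hH' hβ) (hαβ α rfl).ne))
    have h1 := mk_le_mk_of_subset hmaps
    rw [mk_image_eq_of_injOn _ _ hemono.injOn, hcard', Cardinal.mk_Iio_ordinal,
      Cardinal.lift_le] at h1
    exact absurd h1 (not_le.2 (lt_ord.1 hα₀μ.1))
  -- With all levels distinct, they form a set of size `lam` homogeneous for `c₀`.
  · have hlinj : InjOn lvl H := by
      intro α hα β hβ hαβ
      by_contra hne
      have h1 := hpair hα hβ hne
      rw [← h1] at hq1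
      refine hq1 fun x hx y hy => ?_
      rw [Finset.mem_insert, Finset.mem_singleton] at hx hy
      rcases hx with rfl | rfl <;> rcases hy with rfl | rfl <;> simp [hαβ]
    have hsub : lvl '' H ⊆ Iio lam.ord := by
      rintro _ ⟨α, hα, rfl⟩
      exact (hlvl α (hH.1 hα)).1
    obtain ⟨b, hb, hne⟩ := hbad (lvl '' H) ⟨hsub, (mk_image_eq_of_injOn _ _ hlinj).trans hH.2⟩
      (if q.down.2.2 then 0 else 1)
    obtain ⟨x, y, hxy, rfl⟩ := Finset.card_eq_two.1 hb.2
    obtain ⟨α, hα, rfl⟩ := hb.1 (show x ∈ (({x, y} : Finset Ordinal.{u}) : Set Ordinal.{u}) by simp)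
    obtain ⟨β, hβ, rfl⟩ := hb.1
      (show y ∈ (({lvl α, y} : Finset Ordinal.{u}) : Set Ordinal.{u}) by simp)
    have h1 := hpair hα hβ fun h => hxy (congrArg lvl h)
    have h2 : ({α, β} : Finset Ordinal.{u}).image lvl = {lvl α, lvl β} := by
      rw [Finset.image_insert, Finset.image_singleton]
    have h3 : c₀ {lvl α, lvl β} = 0 ↔ q.down.2.2 := by
      rw [← h1, ← h2]
    have h4 := hc₀ {lvl α, lvl β} (nSubsets_mono hsub 2 hb)
    rw [Cardinal.ord_ofNat] at h4
    refine hne ?_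
    split_ifs with h5
    · exact h3.2 h5
    · have h6 : c₀ {lvl α, lvl β} ≠ 0 := fun h => h5 (h3.1 h)
      have h7 : c₀ {lvl α, lvl β} < 1 + 1 := by
        rwa [one_add_one_eq_two]
      exact le_antisymm (Order.lt_add_one_iff.1 h7) (Order.one_le_iff_ne_zero.2 h6)

/-! ### The lower bound for `μ` -/

theorem not_deltaRefinement_succ {n : ℕ} {κ lam χ τ : Cardinal.{u}} (hκ : ℵ₀ ≤ κ)
    (hlam : lam.IsRegular) (hτ : sigma χ (n + 1) = Order.succ τ)
    (h : ∀ μ < sigma χ (n + 1), ¬ DeltaRefinement (n + 1) κ lam μ) :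
    ∀ μ < sigma χ (n + 2), ¬ DeltaRefinement (n + 2) κ lam μ := by
  intro μ hμ hD
  have h1 : μ < Order.succ (2 ^< sigma χ (n + 1)) := hμ
  -- Since `sigma χ (n + 1)` is the successor of `τ`, the supremum `2^{<τ⁺}` is `2^τ`, the form that
  -- stepping up needs.
  rw [Order.lt_succ_iff, hτ, powerlt_succ two_ne_zero] at h1
  exact h τ (hτ ▸ Order.lt_succ τ) (deltaRefinement_of_succ (by omega) hκ hlam h1 hD)

theorem le_of_deltaRefinement {n : ℕ} {κ lam μ : Cardinal.{u}} (hκ : ℵ₀ ≤ κ)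
    (h : DeltaRefinement n κ lam μ) : lam ≤ μ := by
  obtain ⟨H, hH, -⟩ := h PUnit (fun _ => ∅) fun _ _ => by simpa using aleph0_pos.trans_le hκ
  have h1 := mk_le_mk_of_subset hH.1
  rwa [hH.2, Cardinal.mk_Iio_ordinal, card_ord, Cardinal.lift_le] at h1

theorem sigma_le_of_deltaRefinement {n : ℕ} (hn : 1 ≤ n) {κ lam lamStar μ : Cardinal.{u}}
    (hκ : κ.IsRegular) (hlam : lam.IsRegular) (hlt : κ < lam)
    (h : IsLeast {χ : Cardinal.{u} | lam ≤ χ ∧ IsLTInaccessible κ χ} lamStar)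
    (hwc : n = 1 ∨ ¬ IsWeaklyCompact lam) (hD : DeltaRefinement n κ lam μ) :
    sigma lamStar n ≤ μ := by
  by_contra! hcon
  rcases isLeast_cases hκ hlt h with rfl | ⟨ν, hν2, hν, hle, rfl⟩
  · rcases hwc with rfl | hwc
    · exact absurd (le_of_deltaRefinement hκ.aleph0_le hD) (not_le.2 hcon)
    · rcases hn.eq_or_lt with rfl | hn2
      · exact absurd (le_of_deltaRefinement hκ.aleph0_le hD) (not_le.2 hcon)
      have harrow : ¬ Arrow lamStar lamStar 2 2 := fun ha =>
        hwc ⟨hκ.aleph0_le.trans_lt hlt, ha⟩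
      -- The induction starts in dimension two, because `sigma lamStar 1 = lamStar` need not be a
      -- successor.
      have key : ∀ k, ∀ μ < sigma lamStar (k + 2), ¬ DeltaRefinement (k + 2) κ lamStar μ := by
        intro k
        induction k with
        | zero =>
          intro μ hμ
          exact not_deltaRefinement_two hκ.aleph0_le hlam harrow (Order.lt_succ_iff.1 hμ)
        | succ k ih => exact not_deltaRefinement_succ hκ.aleph0_le hlam rfl ih
      obtain ⟨k, rfl⟩ : ∃ k, n = k + 2 := ⟨n - 2, by omega⟩
      exact key k μ hcon hD
  · have key : ∀ k, ∀ μ < sigma (Order.succ (ν ^< κ)) (k + 1),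
        ¬ DeltaRefinement (k + 1) κ lam μ := by
      intro k
      induction k with
      | zero =>
        intro μ hμ
        exact not_deltaRefinement_one hlam.aleph0_le hν (Order.lt_succ_iff.1 hμ)
      | succ k ih =>
        -- The split lets `sigma` unfold: its first value is `(ν^{<κ})⁺` and the later ones are
        -- successors by definition.
        rcases k with - | k <;> exact not_deltaRefinement_succ hκ.aleph0_le hlam rfl ih
    obtain ⟨k, rfl⟩ : ∃ k, n = k + 1 := ⟨n - 1, by omega⟩
    exact key k μ hcon hD

end DeltaSystem

end

theorem corollary3p12 (n : ℕ) (hn : 1 ≤ n) (κ lam lamStar μ : Cardinal.{u})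
    (hκ : κ.IsRegular) (hlam : lam.IsRegular) (hκlam : κ < lam)
    (hlamStar : IsLeast {χ : Cardinal.{u} | lam ≤ χ ∧ DeltaSystem.IsLTInaccessible κ χ} lamStar)
    (hμ : ℵ₀ ≤ μ) :
    (DeltaSystem.sigma lamStar n ≤ μ → DeltaSystem.UniformRefinement n κ lam μ) ∧
    (DeltaSystem.UniformRefinement n κ lam μ → DeltaSystem.DeltaRefinement n κ lam μ) ∧
    ((n = 1 ∨ ¬ DeltaSystem.IsWeaklyCompact lam) →
      [DeltaSystem.sigma lamStar n ≤ μ,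
        DeltaSystem.UniformRefinement n κ lam μ,
        DeltaSystem.DeltaRefinement n κ lam μ].TFAE) := by
  have h12 : DeltaSystem.sigma lamStar n ≤ μ → DeltaSystem.UniformRefinement n κ lam μ :=
    DeltaSystem.uniformRefinement_of_sigma_le hn hκ hlam hκlam hlamStar
  have h23 : DeltaSystem.UniformRefinement n κ lam μ → DeltaSystem.DeltaRefinement n κ lam μ :=
    DeltaSystem.deltaRefinement_of_uniformRefinement hlam (hκ.aleph0_le.trans_lt hκlam)
  refine ⟨h12, h23, fun hwc => ?_⟩
  tfae_have 1 → 2 := h12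
  tfae_have 2 → 3 := h23
  tfae_have 3 → 1 :=
    DeltaSystem.sigma_le_of_deltaRefinement hn hκ hlam hκlam hlamStar hwc
  tfae_finish
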